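/- Consider edge-to-edge tilings of the unit sphere by $f$ congruent simple quadrilaterals whose sides are geodesic arcs, in which every vertex has degree at least $3$ (mirror images count as congruent). Assume that each tile $ABCD$ has side lengths $AB=AD=a$, $BC=b$, $CD=c$ with $a,b,c$ pairwise distinct, and let $\alpha,\beta,\gamma,\delta$ denote its angles at $A,B,C,D$. A vertex at which exactly $k$ angles $\alpha$, $l$ angles $\beta$, $m$ angles $\gamma$ and $n$ angles $\delta$ of tiles meet is written $\alpha^k\beta^l\gamma^m\delta^n$ (angles are distinguished by their position in the tile, not by their value), and $\mathrm{AVC}\equiv\{\dots\}$ means that the listed vertices are exactly those that occur in the tiling. A symmetry of a tiling is an element of $O(3)$ that maps tiles to tiles (corners to corners). Then, up to conjugation in $O(3)$, the symmetry group of the tiling is as follows: - $\mathrm{AVC}\equiv\{\beta\gamma\delta,\ \alpha^{f/2}\}$ (earth map tilings): $f$ is even and the group is $D_{f/2}$; - $\mathrm{AVC}\equiv\{\alpha^3,\ \beta^2\delta^2,\ \gamma^4\}$ (quadrilateral subdivision of the cube): $T_h$; - $\mathrm{AVC}\equiv\{\alpha^3,\ \alpha\beta^2,\ \alpha^2\delta^2,\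 \beta^2\delta^2,\ \gamma^4\}$ (quadrilateral subdivision of the triangular prism): $D_3$; - $\mathrm{AVC}\equiv\{\alpha\beta^2,\ \alpha^2\delta^2,\ \gamma^4,\ \delta^{f/4}\}$ ($(f/4,4)$-earth map tilings): $8$ divides $f$ and the group is $D_{(f/8)v}$; - $\mathrm{AVC}\equiv\{\alpha\beta^2,\ \alpha^2\delta^2,\ \gamma^4,\ \beta^2\delta^{(f-8)/8},\ \alpha\delta^{(f+8)/8}\}$: $C_2$; - $\mathrm{AVC}\equiv\{\alpha\beta^2,\ \alpha^2\delta^2,\ \gamma^4,\ \alpha\delta^{(f+8)/8}\}$: $D_2$. (The exponents are understood to be integers.) Here $C_n$ is the group of order $n$ of rotations about one $n$-fold axis; $D_n$ is the group of order $2n$ generated by $C_n$ and a half-turn about a perpendicular axis; $D_{nv}$ (also written $D_{nd}$, the symmetry group of an $n$-gonal antiprism) is the group of order $4n$ generated by $D_n$ and the reflection in a plane that contains the $n$-fold axis and bisects the angle between two adjacent two-fold axes; $T_h$ is the group of order $24$ generated by the rotation group of a regular tetrahedron and the inversion $-1$. -/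

import Mathlib

namespace SphereTiling

/-- Euclidean three-space. -/
abbrev E3 : Type := EuclideanSpace ℝ (Fin 3)

/-- The unit sphere in Euclidean three-space, with its subspace topology. -/
abbrev S2 : Type := Metric.sphere (0 : E3) 1

/-- The orthogonal group `O(3)`: the linear isometries of Euclidean three-space onto itself. -/
abbrev O3 : Type := E3 ≃ₗᵢ[ℝ] E3

/-- The isometry of the unit sphere induced by an element of `O(3)`. -/
noncomputable def act (g : O3) (x : S2) : S2 :=
  ⟨g (x : E3), by
    have hx : ‖(x : E3)‖ = 1 := mem_sphere_zero_iff_norm.mp x.2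
    rw [mem_sphere_zero_iff_norm, g.norm_map, hx]⟩

theorem act_one : act 1 = id := by
  funext x
  rfl

theorem act_mul (g h : O3) : act (g * h) = act g ∘ act h := by
  funext x
  rfl

/-- `s` is a geodesic arc (a part of a great circle) of length `l` from `p` to `q`. The length may
exceed `π`, but the arc does not go once around the great circle. -/
def IsGeodesicArc (s : Set S2) (p q : S2) (l : ℝ) : Prop :=
  0 < l ∧ l < 2 * Real.pi ∧
    ∃ v : E3, ‖v‖ = 1 ∧ inner ℝ (p : E3) v = 0 ∧
      (q : E3) = Real.cos l • (p : E3) + Real.sin l • v ∧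
      s = {x : S2 | ∃ t ∈ Set.Icc (0 : ℝ) l,
        (x : E3) = Real.cos t • (p : E3) + Real.sin t • v}

/-- A spherical quadrilateral `ABCD` with marked corners `A, B, C, D = corner 0, 1, 2, 3` and sides
`AB, BC, CD, DA = side 0, 1, 2, 3`. The sides are geodesic arcs which together form a simple closed
curve, and `region` is one of the two closed domains bounded by that curve. Corners of angle `π` and
reflex corners are allowed. -/
structure Quad where
  corner : Fin 4 → S2
  side : Fin 4 → Set S2
  len : Fin 4 → ℝ
  region : Set S2
  isGeodesicArc_side : ∀ k, IsGeodesicArc (side k) (corner k) (corner (k + 1)) (len k)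
  corner_injective : Function.Injective corner
  adjacent_sides : ∀ k, side k ∩ side (k + 1) = {corner (k + 1)}
  opposite_sides : ∀ k, Disjoint (side k) (side (k + 2))
  isClosed_region : IsClosed region
  frontier_region : frontier region = ⋃ k, side k
  isConnected_interior : IsConnected (interior region)

/-- An edge-to-edge tiling of the sphere by `f` congruent quadrilaterals with exactly two equal
edges, the equal edges being adjacent: in each tile `AB` and `AD` have length `a`, `BC` has length
`b` and `CD` has length `c`, where `a, b, c` are distinct. Thus the angle `α` of a tile is the one
at `A` (between the two `a`-edges), `β` is at `B` (between an `a`-edge and the `b`-edge), `γ` is at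
`C` (between the `b`-edge and the `c`-edge) and `δ` is at `D` (between the `c`-edge and an
`a`-edge). Tiles may be congruent through an orientation-reversing isometry. -/
structure Tiling (f : ℕ) where
  tile : Fin f → Quad
  a : ℝ
  b : ℝ
  c : ℝ
  a_ne_b : a ≠ b
  a_ne_c : a ≠ c
  b_ne_c : b ≠ c
  len_eq : ∀ i, (tile i).len = ![a, b, c, a]
  congruent : ∀ i j, ∃ g : O3, act g '' (tile i).region = (tile j).region ∧
    ∀ k, act g ((tile i).corner k) = (tile j).corner k
  cover : (⋃ i, (tile i).region) = Set.univ
  disjoint_interior : ∀ i j, i ≠ j →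
    Disjoint (interior (tile i).region) (interior (tile j).region)
  /-- Edge-to-edge: a corner of one tile that lies in another tile is a corner of the latter. -/
  edge_to_edge : ∀ i j k, (tile i).corner k ∈ (tile j).region →
    ∃ l, (tile i).corner k = (tile j).corner l
  /-- At least three tiles meet at every vertex. -/
  three_le_degree : ∀ i k,
    3 ≤ Set.ncard {p : Fin f × Fin 4 | (tile p.1).corner p.2 = (tile i).corner k}

namespace Tiling

variable {f : ℕ} (T : Tiling f)

/-- The vertices of the tiling. -/
def vertices : Set S2 := {v | ∃ i k, v = (T.tile i).corner k}

/-- The numbers of angles `α, β, γ, δ` at the point `v`. The vector `![a, b, c, d]` stands for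
the vertex `α^a β^b γ^c δ^d`. -/
noncomputable def vertexType (v : S2) : Fin 4 → ℕ :=
  fun k => Set.ncard {i : Fin f | (T.tile i).corner k = v}

/-- The set of all the vertices, as combinations of angles, that occur in the tiling (the exact
list, in which every member occurs). -/
noncomputable def avc : Set (Fin 4 → ℕ) := T.vertexType '' T.vertices

/-- The tiles of the tiling as unmarked quadrilaterals: a region with its set of corners. -/
def cells : Set (Set S2 × Set S2) :=
  Set.range fun i => ((T.tile i).region, Set.range (T.tile i).corner)

/-- The symmetry group of the tiling: the elements of `O(3)` which permute the tiles. -/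
def symmetryGroup : Subgroup O3 where
  carrier := {g | Set.image (Prod.map (Set.image (act g)) (Set.image (act g))) T.cells = T.cells}
  one_mem' := by
    simp [act_one]
  mul_mem' := by
    intro g h hg hh
    change _ '' _ = _
    have hg' : Prod.map (Set.image (act g)) (Set.image (act g)) '' T.cells = T.cells := hg
    have hh' : Prod.map (Set.image (act h)) (Set.image (act h)) '' T.cells = T.cells := hh
    conv_rhs => rw [← hg', ← hh']
    rw [Set.image_image]
    refine Set.image_congr fun x _ => ?_
    simp only [Prod.map_apply', act_mul, Set.image_comp]
  inv_mem' := by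
    intro g hg
    change _ '' _ = _
    have hg' : Prod.map (Set.image (act g)) (Set.image (act g)) '' T.cells = T.cells := hg
    conv_lhs => rw [← hg']
    have h : act g⁻¹ ∘ act g = id := by rw [← act_mul, inv_mul_cancel, act_one]
    have h2 : ∀ s : Set S2, act g⁻¹ '' (act g '' s) = s := by
      intro s
      rw [← Set.image_comp, h, Set.image_id]
    rw [Set.image_image]
    conv_rhs => rw [← Set.image_id T.cells]
    refine Set.image_congr fun x _ => ?_
    rw [Prod.map_apply', Prod.map_apply', h2, h2]
    rfl

end Tiling

/-- The element of `O(3)` given by an orthogonal matrix. -/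
noncomputable def ofMatrix (M : Matrix (Fin 3) (Fin 3) ℝ)
    (hM : M ∈ Matrix.orthogonalGroup (Fin 3) ℝ) : O3 :=
  Unitary.linearIsometryEquiv
    ⟨Matrix.toEuclideanCLM (n := Fin 3) (𝕜 := ℝ) M, Unitary.map_mem _ hM⟩

theorem ofMatrix_apply (M : Matrix (Fin 3) (Fin 3) ℝ)
    (hM : M ∈ Matrix.orthogonalGroup (Fin 3) ℝ) (x : E3) :
    ofMatrix M hM x = WithLp.toLp 2 (M.mulVec x.ofLp) := by
  rfl

/-- The rotation by the angle `θ` about the third axis. -/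
noncomputable def rotZ (θ : ℝ) : O3 :=
  ofMatrix !![Real.cos θ, -Real.sin θ, 0; Real.sin θ, Real.cos θ, 0; 0, 0, 1] (by
    rw [Matrix.mem_orthogonalGroup_iff]
    ext i j
    fin_cases i <;> fin_cases j <;>
      simp [Matrix.mul_apply, Fin.sum_univ_three] <;> nlinarith [Real.sin_sq_add_cos_sq θ])

/-- The half-turn about the first axis. -/
noncomputable def halfTurnX : O3 :=
  ofMatrix !![1, 0, 0; 0, -1, 0; 0, 0, -1] (by
    rw [Matrix.mem_orthogonalGroup_iff]
    ext i j
    fin_cases i <;> fin_cases j <;> simp [Matrix.mul_apply, Fin.sum_univ_three])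

/-- The reflection in the plane through the third axis that makes the angle `φ` with the
first axis. -/
noncomputable def mirror (φ : ℝ) : O3 :=
  ofMatrix !![Real.cos (2 * φ), Real.sin (2 * φ), 0; Real.sin (2 * φ), -Real.cos (2 * φ), 0;
      0, 0, 1] (by
    rw [Matrix.mem_orthogonalGroup_iff]
    ext i j
    fin_cases i <;> fin_cases j <;>
      simp [Matrix.mul_apply, Fin.sum_univ_three] <;> nlinarith [Real.sin_sq_add_cos_sq (2 * φ)])

/-- The rotation of order three that permutes the three coordinate axes cyclically. -/
noncomputable def cyclicTurn : O3 :=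
  ofMatrix !![0, 0, 1; 1, 0, 0; 0, 1, 0] (by
    rw [Matrix.mem_orthogonalGroup_iff]
    ext i j
    fin_cases i <;> fin_cases j <;> simp [Matrix.mul_apply, Fin.sum_univ_three])

/-- The point group `C_n` (order `n`): the rotations about one `n`-fold axis. -/
noncomputable def groupC (n : ℕ) : Subgroup O3 :=
  Subgroup.closure {rotZ (2 * Real.pi / n)}

/-- The point group `D_n` (order `2 n`): the rotations about one `n`-fold axis and the half-turns
about `n` axes perpendicular to it. -/
noncomputable def groupD (n : ℕ) : Subgroup O3 :=
  Subgroup.closure {rotZ (2 * Real.pi / n), halfTurnX}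

/-- The point group `D_{nv}` (order `4 n`, also written `D_{nd}`; the symmetry group of an `n`-gonal
antiprism): it is generated by `D_n` and the reflection in a plane that contains the `n`-fold axis
and bisects the angle between two adjacent two-fold axes. -/
noncomputable def groupDv (n : ℕ) : Subgroup O3 :=
  Subgroup.closure {rotZ (2 * Real.pi / n), halfTurnX, mirror (Real.pi / (2 * n))}

/-- The point group `T_h` (order `24`): it is generated by the rotation group of the regular
tetrahedron with vertices `(1, 1, 1), (1, -1, -1), (-1, 1, -1), (-1, -1, 1)` and the inversion. -/
noncomputable def groupTh : Subgroup O3 :=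
  Subgroup.closure {halfTurnX, cyclicTurn, LinearIsometryEquiv.neg ℝ}

/-- Two subgroups of `O(3)` are conjugate in `O(3)`, that is, equal up to the choice of an
orthonormal coordinate system. -/
def Conjugate (G H : Subgroup O3) : Prop :=
  ∃ g : O3, G = H.map (MulAut.conj g).toMonoidHom

end SphereTiling

/-!
The proof reduces the geometry to combinatorics, determines the combinatorics from the list of
vertices, and recognizes the resulting group of isometries.

*From geometry to combinatorics.* A flag of a tile is a corner together with a side at this corner.
Across each side of a tile there is exactly one other tile, which shares the whole side, so there is
an involution `Tiling.nbr` on the flags of all tiles. That a region lies on one side only of each of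
its sides (`Quad.not_thin`) makes the isometry class of a tile and `nbr` determine the position of
the neighbours: if an isometry takes tile `i` to tile `j`, and the corresponding neighbours of `i`
and `j` are attached by flags of the same name, then it takes the neighbour of `i` to that of `j`
(`Tiling.Maps.nbr`). The tiles around a vertex form one cycle (`Tiling.mem_of_vtx_eq`), and any two
tiles are joined by a chain of neighbours (`Tiling.eq_univ_of_nbr`). Hence an isometry between two
tiles is a symmetry as soon as the two tiles are related by a relation that is passed on to the
neighbours (`Tiling.mem_symmetryGroup_of_rel`). Conversely, since `a, b, c` are distinct, every
symmetry respects the names of the corners and the function `nbr`, and it is determined by the image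
of a single tile.

*Combinatorics.* Around a vertex the angles occur in a cyclic order in which sides of equal length
match. This restricts `nbr`. For example, if `γ` occurs only in `γ⁴`, then the tiles across `BC` and
across `CD` are mirror images (`Tiling.GammaFour`), and only the neighbours along the sides of
length `a` remain to be found. In each case the tiles get finitely many labels such that the label
of a tile determines the labels of its neighbours and the way in which they are attached
(`Tiling.GammaFour.mem_symmetryGroup_of_label`), so isometries between tiles with equal labels are
symmetries. In the first four cases there are at most four labels. In the last two cases the label
is the position of a tile in the fan of angles `δ` at a vertex of high degree; the key fact is that
two fans which are linked somewhere are linked all along (`Tiling.GammaFour.link_fan`).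

*The groups.* An isometry from a tile to a neighbour that is attached with the ends of the common
side exchanged is a half-turn, and one to a mirror-image neighbour is a reflection
(`Tiling.Maps.half_turn`, `Tiling.Maps.reflection`). In the first four cases such isometries, and a
rotation about a vertex, generate the symmetry group (`Tiling.symmetryGroup_eq`), and their
relations are read off at the vertices: the order of a rotation about a vertex is found by counting
the tiles there (`Tiling.orderOf_of_turn`). In the last two cases the group acts freely on the
vertices with a single `α`, whose number follows from counting angles
(`Tiling.card_symmetryGroup_le`, `Tiling.mul_ncard_vertices`). The lemmas `conjugate_groupC_two`,
`conjugate_groupD`, `conjugate_groupDv`, `conjugate_groupTh` and `conjugate_groupD_two` identify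
subgroups of `O(3)` with such generators.
-/

namespace SphereTiling

open Set Topology Filter

/-! ### Orthonormal frames and great circles -/

/-- `(p, v, n)` is an orthonormal basis of Euclidean three-space (of either orientation). -/
structure IsFrame (p v n : E3) : Prop where
  norm_p : ‖p‖ = 1
  norm_v : ‖v‖ = 1
  norm_n : ‖n‖ = 1
  pv : inner ℝ p v = 0
  pn : inner ℝ p n = 0
  vn : inner ℝ v n = 0

/-- The point at distance `t` from `p` on the great circle through `p` in the direction `v`. -/
noncomputable def gc (p v : E3) (t : ℝ) : E3 := Real.cos t • p + Real.sin t • v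

/-- The velocity at time `t` of the great circle through `p` in the direction `v`. -/
noncomputable def gcVel (p v : E3) (t : ℝ) : E3 := -Real.sin t • p + Real.cos t • v

theorem IsFrame.orthonormal {p v n : E3} (h : IsFrame p v n) : Orthonormal ℝ ![p, v, n] := by
  constructor
  · intro i
    fin_cases i
    · exact h.norm_p
    · exact h.norm_v
    · exact h.norm_n
  · intro i j hij
    fin_cases i <;> fin_cases j <;> first | exact absurd rfl hij | skip
    · exact h.pv
    · exact h.pn
    · exact (real_inner_comm _ _).trans h.pv
    · exact h.vn
    · exact (real_inner_comm _ _).trans h.pn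
    · exact (real_inner_comm _ _).trans h.vn

/-- The orthonormal basis given by a frame. -/
noncomputable def IsFrame.basis {p v n : E3} (h : IsFrame p v n) :
    OrthonormalBasis (Fin 3) ℝ E3 :=
  OrthonormalBasis.mk h.orthonormal (by
    have := h.orthonormal.linearIndependent.span_eq_top_of_card_eq_finrank (by simp)
    rw [this])

theorem IsFrame.basis_apply {p v n : E3} (h : IsFrame p v n) (i : Fin 3) :
    h.basis i = ![p, v, n] i := by
  simp [IsFrame.basis]

theorem IsFrame.expand {p v n : E3} (h : IsFrame p v n) (x : E3) :
    x = (inner ℝ p x : ℝ) • p + (inner ℝ v x : ℝ) • v + (inner ℝ n x : ℝ) • n := by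
  have := h.basis.sum_repr' x
  rw [Fin.sum_univ_three] at this
  simpa [h.basis_apply] using this.symm

theorem IsFrame.ext_iso {p v n : E3} (h : IsFrame p v n) {g k : O3} (hp : g p = k p)
    (hv : g v = k v) (hn : g n = k n) : g = k := by
  ext1 x
  rw [h.expand x]
  simp only [map_add, map_smul, hp, hv, hn]

theorem IsFrame.map {p v n : E3} (h : IsFrame p v n) (g : O3) : IsFrame (g p) (g v) (g n) := by
  obtain ⟨h1, h2, h3, h4, h5, h6⟩ := h
  constructor <;> simp [LinearIsometryEquiv.inner_map_map, *]

theorem IsFrame.neg {p v n : E3} (h : IsFrame p v n) : IsFrame p v (-n) := by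
  obtain ⟨h1, h2, h3, h4, h5, h6⟩ := h
  constructor <;> simp [*]

theorem inner_self_of_norm_one {p : E3} (h : ‖p‖ = 1) : inner ℝ p p = (1 : ℝ) := by
  rw [real_inner_self_eq_norm_sq, h]; norm_num

theorem IsFrame.inner_gc {p v n : E3} (h : IsFrame p v n) (t : ℝ) :
    inner ℝ p (gc p v t) = Real.cos t ∧ inner ℝ v (gc p v t) = Real.sin t ∧
      inner ℝ n (gc p v t) = 0 := by
  have h1 := inner_self_of_norm_one h.norm_p
  have h2 := inner_self_of_norm_one h.norm_v
  have h3 := h.pv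
  have h4 := (real_inner_comm p v).trans h.pv
  have h5 := (real_inner_comm p n).trans h.pn
  have h6 := (real_inner_comm v n).trans h.vn
  refine ⟨?_, ?_, ?_⟩ <;> simp only [gc, inner_add_right, inner_smul_right, h1, h2, h3, h4, h5, h6]
    <;> ring

/-- The frame carried along the great circle. -/
theorem IsFrame.transport {p v n : E3} (h : IsFrame p v n) (t : ℝ) :
    IsFrame (gc p v t) (gcVel p v t) n := by
  have h1 := inner_self_of_norm_one h.norm_p
  have h2 := inner_self_of_norm_one h.norm_v
  have h3 := h.pv
  have h4 := (real_inner_comm p v).trans h.pv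
  have key : ∀ x : E3, inner ℝ x x = (1 : ℝ) → ‖x‖ = 1 := by
    intro x hx
    rw [real_inner_self_eq_norm_sq] at hx
    nlinarith [norm_nonneg x]
  constructor
  · apply key
    simp only [gc, inner_add_right, inner_smul_right, inner_add_left, inner_smul_left, h1, h2, h3,
      h4]
    simp
    nlinarith [Real.sin_sq_add_cos_sq t]
  · apply key
    simp only [gcVel, inner_add_right, inner_smul_right, inner_add_left, inner_smul_left, h1, h2,
      h3, h4]
    simp
    nlinarith [Real.sin_sq_add_cos_sq t]
  · exact h.norm_n
  · simp only [gc, gcVel, inner_add_right, inner_smul_right, inner_add_left, inner_smul_left, h1,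
      h2, h3, h4]
    simp
    ring
  · simp only [gc, inner_add_left, inner_smul_left, h.pn, h.vn]
    simp
  · simp only [gcVel, inner_add_left, inner_smul_left, h.pn, h.vn]
    simp

/-- The frame at the other end of an arc, looking backwards. -/
theorem IsFrame.reverse {p v n : E3} (h : IsFrame p v n) (t : ℝ) :
    IsFrame (gc p v t) (-gcVel p v t) n := by
  obtain ⟨h1, h2, h3, h4, h5, h6⟩ := h.transport t
  constructor <;> simp [*]

theorem gc_gc (p v : E3) (s t : ℝ) : gc (gc p v s) (gcVel p v s) t = gc p v (s + t) := by
  simp only [gc, gcVel, Real.cos_add, Real.sin_add]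
  module

theorem gc_reverse (p v : E3) (s t : ℝ) : gc (gc p v s) (-gcVel p v s) t = gc p v (s - t) := by
  simp only [gc, gcVel, Real.cos_sub, Real.sin_sub]
  module

theorem gc_zero (p v : E3) : gc p v 0 = p := by simp [gc]

theorem gc_map (p v : E3) (t : ℝ) (g : O3) : g (gc p v t) = gc (g p) (g v) t := by
  simp [gc]

theorem continuous_gc (p v : E3) : Continuous (gc p v) := by
  unfold gc; fun_prop

theorem exists_frame {p v : E3} (hp : ‖p‖ = 1) (hv : ‖v‖ = 1) (h : inner ℝ p v = 0) :
    ∃ n, IsFrame p v n := by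
  have ho : Orthonormal ℝ (({0, 1} : Set (Fin 3)).domRestrict ![p, v, 0]) := by
    constructor
    · rintro ⟨i, hi⟩
      fin_cases i
      · exact hp
      · exact hv
      · simp at hi
    · rintro ⟨i, hi⟩ ⟨j, hj⟩ hij
      fin_cases i <;> fin_cases j <;> simp at hi hj hij ⊢
      · exact h
      · exact (real_inner_comm _ _).trans h
  obtain ⟨b, hb⟩ := Orthonormal.exists_orthonormalBasis_extension_of_card_eq (by simp) ho
  have h0 : b 0 = p := hb 0 (by simp)
  have h1 : b 1 = v := hb 1 (by simp)
  refine ⟨b 2, hp, hv, b.orthonormal.1 2, h, ?_, ?_⟩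
  · rw [← h0]; exact b.orthonormal.2 (by decide)
  · rw [← h1]; exact b.orthonormal.2 (by decide)

theorem norm_coe_S2 (x : S2) : ‖(x : E3)‖ = 1 := mem_sphere_zero_iff_norm.mp x.2

theorem exists_angle {a b : ℝ} (h : a ^ 2 + b ^ 2 = 1) :
    ∃ s, Real.cos s = a ∧ Real.sin s = b ∧ -Real.pi ≤ s ∧ s ≤ Real.pi ∧ (0 ≤ b → 0 ≤ s) ∧
      (b < 0 → s < 0) := by
  have ha : -1 ≤ a ∧ a ≤ 1 := ⟨by nlinarith [sq_nonneg b], by nlinarith [sq_nonneg b]⟩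
  have hs : Real.sqrt (1 - a ^ 2) = |b| := by
    rw [← Real.sqrt_sq_eq_abs]; congr 1; linarith
  rcases le_or_gt 0 b with hb | hb
  · refine ⟨Real.arccos a, Real.cos_arccos ha.1 ha.2, ?_, ?_, Real.arccos_le_pi a, ?_, ?_⟩
    · rw [Real.sin_arccos, hs, abs_of_nonneg hb]
    · linarith [Real.arccos_nonneg a, Real.pi_pos]
    · intro _; exact Real.arccos_nonneg a
    · intro h; linarith
  · refine ⟨-Real.arccos a, ?_, ?_, ?_, ?_, ?_, ?_⟩
    · rw [Real.cos_neg, Real.cos_arccos ha.1 ha.2]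
    · rw [Real.sin_neg, Real.sin_arccos, hs, abs_of_neg hb]; ring
    · linarith [Real.arccos_le_pi a]
    · linarith [Real.arccos_nonneg a, Real.pi_pos]
    · intro h; linarith
    · intro _
      have : 0 < Real.arccos a := by
        rw [Real.arccos_pos]
        nlinarith
      linarith

/-- A unit vector in the plane of a great circle is a point of the great circle. -/
theorem IsFrame.exists_gc {p v n x : E3} (h : IsFrame p v n) (hx : ‖x‖ = 1)
    (hn : inner ℝ n x = 0) : ∃ s, x = gc p v s ∧ -Real.pi ≤ s ∧ s ≤ Real.pi ∧
      (0 ≤ inner ℝ v x → 0 ≤ s) ∧ (inner ℝ v x < 0 → s < 0) := by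
  have hexp := h.expand x
  rw [hn, zero_smul, add_zero] at hexp
  have h1 : (inner ℝ p x) ^ 2 + (inner ℝ v x) ^ 2 = (1 : ℝ) := by
    have : inner ℝ x x = (1 : ℝ) := inner_self_of_norm_one hx
    nth_rw 1 [hexp] at this
    rw [inner_add_left, inner_smul_left, inner_smul_left] at this
    simp at this
    nlinarith
  obtain ⟨s, hs1, hs2, hs3, hs4, hs5, hs6⟩ := exists_angle h1
  refine ⟨s, ?_, hs3, hs4, hs5, hs6⟩
  rw [gc, hs1, hs2]; exact hexp

/-- The points `gc p v t` are distinct for `t` in a range of length less than `2 π`. -/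
theorem IsFrame.gc_inj {p v n : E3} (h : IsFrame p v n) {s t : ℝ} (hst : |s - t| < 2 * Real.pi)
    (heq : gc p v s = gc p v t) : s = t := by
  have h1 : Real.cos s = Real.cos t := by rw [← (h.inner_gc s).1, heq, (h.inner_gc t).1]
  have h2 : Real.sin s = Real.sin t := by rw [← (h.inner_gc s).2.1, heq, (h.inner_gc t).2.1]
  have h3 : Real.cos (s - t) = 1 := by
    rw [Real.cos_sub, h1, h2]; nlinarith [Real.sin_sq_add_cos_sq t]
  have h4 := (Real.cos_eq_one_iff_of_lt_of_lt (by linarith [(abs_lt.mp hst).1])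
    (abs_lt.mp hst).2).mp h3
  linarith

/-! ### Spherical caps -/

/-- The open spherical cap `{x | c < ⟨p, x⟩}` around `p`. -/
def cap (p : E3) (c : ℝ) : Set S2 := {x | c < inner ℝ p (x : E3)}

theorem isOpen_cap (p : E3) (c : ℝ) : IsOpen (cap p c) := by
  apply isOpen_lt continuous_const
  fun_prop

theorem mem_cap_self (p : S2) {c : ℝ} (hc : c < 1) : p ∈ cap (p : E3) c := by
  change c < inner ℝ (p : E3) (p : E3)
  rw [inner_self_of_norm_one (norm_coe_S2 p)]; exact hc

theorem norm_sub_sq_S2 (x y : S2) : ‖(x : E3) - y‖ ^ 2 = 2 - 2 * inner ℝ (x : E3) (y : E3) := by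
  rw [norm_sub_sq_real, norm_coe_S2, norm_coe_S2]; ring

/-- The caps around a point form a basis of its neighbourhoods. -/
theorem exists_cap_subset {p : S2} {s : Set S2} (hs : s ∈ 𝓝 p) :
    ∃ c, 0 < c ∧ c < 1 ∧ cap (p : E3) c ⊆ s := by
  obtain ⟨ε, hε, hb⟩ := Metric.mem_nhds_iff.mp hs
  refine ⟨max (1 / 2) (1 - ε ^ 2 / 2), by positivity, ?_, ?_⟩
  · apply max_lt
    · norm_num
    · nlinarith [sq_pos_of_pos hε]
  · intro x hx
    apply hb
    rw [Metric.mem_ball, Subtype.dist_eq, dist_eq_norm, ← norm_neg, neg_sub]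
    have h1 := norm_sub_sq_S2 p x
    have h2 : 1 - ε ^ 2 / 2 < inner ℝ (p : E3) (x : E3) := lt_of_le_of_lt (le_max_right _ _) hx
    nlinarith [norm_nonneg ((p : E3) - x)]

/-- The half of a spherical cap around `p` that lies on the positive side of the plane with
normal `n` through the origin. -/
def halfCap (p n : E3) (c : ℝ) : Set S2 := cap p c ∩ {x | 0 < inner ℝ n (x : E3)}

/-- Half-caps are connected, as radial projections of convex cones. -/
theorem isPreconnected_halfCap (p n : E3) {c : ℝ} (hc : 0 ≤ c) :
    IsPreconnected (halfCap p n c) := by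
  -- the cone over the half-cap
  let K : Set E3 := {y | c * ‖y‖ < inner ℝ p y ∧ 0 < inner ℝ n y}
  have hK : Convex ℝ K := by
    intro x hx y hy a b ha hb hab
    refine ⟨?_, ?_⟩
    · have h1 : ‖a • x + b • y‖ ≤ a * ‖x‖ + b * ‖y‖ := by
        refine (norm_add_le _ _).trans ?_
        rw [norm_smul, norm_smul, Real.norm_of_nonneg ha, Real.norm_of_nonneg hb]
      have h2 : c * ‖a • x + b • y‖ ≤ a * (c * ‖x‖) + b * (c * ‖y‖) := by
        nlinarith
      rw [inner_add_right, inner_smul_right, inner_smul_right]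
      rcases ha.eq_or_lt with h | h
      · subst h
        have : b = 1 := by linarith
        subst this
        simpa using hy.1
      · nlinarith [hx.1, hy.1, mul_pos h (sub_pos.mpr hx.1),
          mul_nonneg hb (sub_pos.mpr hy.1).le]
    · rw [inner_add_right, inner_smul_right, inner_smul_right]
      rcases ha.eq_or_lt with h | h
      · subst h
        have : b = 1 := by linarith
        subst this
        simpa using hy.2
      · have := mul_pos h hx.2
        have := mul_nonneg hb hy.2.le
        linarith
  have hpre := hK.isPreconnected
  have hne : ∀ y ∈ K, y ≠ 0 := by
    rintro y hy rfl
    simpa using hy.2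
  have hcont : ContinuousOn (fun y : E3 => ‖y‖⁻¹ • y) K := by
    apply ContinuousOn.fun_smul
    · apply ContinuousOn.inv₀ continuous_norm.continuousOn
      intro y hy
      exact norm_ne_zero_iff.mpr (hne y hy)
    · exact continuousOn_id
  rw [← Topology.IsInducing.subtypeVal.isPreconnected_image]
  convert hpre.image _ hcont using 1
  ext z
  constructor
  · rintro ⟨x, ⟨hx1, hx2⟩, rfl⟩
    have hx1' : c < inner ℝ p (x : E3) := hx1
    refine ⟨x, ⟨?_, hx2⟩, ?_⟩
    · rw [norm_coe_S2, mul_one]; exact hx1'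
    · simp
  · rintro ⟨y, ⟨hy1, hy2⟩, rfl⟩
    have h0 : 0 < ‖y‖ := norm_pos_iff.mpr (hne y ⟨hy1, hy2⟩)
    refine ⟨⟨‖y‖⁻¹ • y, ?_⟩, ⟨?_, ?_⟩, rfl⟩
    · rw [mem_sphere_zero_iff_norm, norm_smul, norm_inv, norm_norm, inv_mul_cancel₀ h0.ne']
    · change c < inner ℝ p (‖y‖⁻¹ • y)
      rw [inner_smul_right, ← div_eq_inv_mul, lt_div_iff₀ h0]; exact hy1
    · change 0 < inner ℝ n (‖y‖⁻¹ • y)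
      rw [inner_smul_right]
      positivity

/-- In every cap around `p` there are points in a prescribed direction `v`. -/
theorem IsFrame.exists_mem_cap {p v n : E3} (h : IsFrame p v n) {c : ℝ} (hc : c < 1) :
    ∃ δ, 0 < δ ∧ ∀ t, |t| < δ → c < inner ℝ p (gc p v t) := by
  have : ∀ᶠ t in 𝓝 (0 : ℝ), c < Real.cos t := by
    apply Real.continuous_cos.continuousAt.eventually_const_lt
    simpa using hc
  obtain ⟨δ, hδ, h2⟩ := Metric.eventually_nhds_iff.mp this
  refine ⟨δ, hδ, fun t ht => ?_⟩
  rw [(h.inner_gc t).1]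
  apply h2
  simpa using ht

theorem gc_mem_sphere {p v n : E3} (h : IsFrame p v n) (t : ℝ) :
    gc p v t ∈ Metric.sphere (0 : E3) 1 := by
  rw [mem_sphere_zero_iff_norm]; exact (h.transport t).norm_p

/-- The point of the sphere at distance `t` from `p` in the direction `v`. -/
noncomputable def IsFrame.pt {p v n : E3} (h : IsFrame p v n) (t : ℝ) : S2 :=
  ⟨gc p v t, gc_mem_sphere h t⟩

theorem IsFrame.continuous_pt {p v n : E3} (h : IsFrame p v n) : Continuous h.pt :=
  (continuous_gc p v).subtype_mk _

/-- Every cap contains points in the direction `v` at small positive distance. -/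
theorem IsFrame.exists_pt_mem {p v n : E3} (h : IsFrame p v n) {c : ℝ} (hc : c < 1) {l : ℝ}
    (hl : 0 < l) : ∃ t, 0 < t ∧ t < l ∧ h.pt t ∈ cap p c ∧ 0 < inner ℝ v (h.pt t : E3) := by
  obtain ⟨δ, hδ, h1⟩ := h.exists_mem_cap hc
  have hpi := Real.pi_pos
  have hm : 0 < min (min δ l) 1 := by positivity
  refine ⟨min (min δ l) 1 / 2, by positivity, ?_, ?_, ?_⟩
  · have : min (min δ l) 1 ≤ l := (min_le_left _ _).trans (min_le_right _ _)
    linarith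
  · apply h1
    have : min (min δ l) 1 ≤ δ := (min_le_left _ _).trans (min_le_left _ _)
    rw [abs_of_pos (by positivity)]
    linarith
  · change 0 < inner ℝ v (gc p v _)
    rw [(h.inner_gc _).2.1]
    have : min (min δ l) 1 ≤ 1 := min_le_right _ _
    apply Real.sin_pos_of_pos_of_lt_pi (by positivity)
    linarith [Real.pi_gt_three]

theorem IsFrame.swap {p v n : E3} (h : IsFrame p v n) : IsFrame p n v := by
  obtain ⟨h1, h2, h3, h4, h5, h6⟩ := h
  exact ⟨h1, h3, h2, h5, h4, (real_inner_comm _ _).trans h6⟩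

theorem IsFrame.neg_v {p v n : E3} (h : IsFrame p v n) : IsFrame p (-v) n := by
  obtain ⟨h1, h2, h3, h4, h5, h6⟩ := h
  constructor <;> simp [*]

theorem IsFrame.halfCap_nonempty {p v n : E3} (h : IsFrame p v n) {c : ℝ} (hc : c < 1) :
    (halfCap p n c).Nonempty := by
  obtain ⟨t, -, -, h1, h2⟩ := h.swap.exists_pt_mem hc one_pos
  exact ⟨_, h1, h2⟩

/-- A cap with a radius removed is connected. -/
theorem IsFrame.isPreconnected_slitCap {p v n : E3} (h : IsFrame p v n) {c : ℝ} (hc : 0 ≤ c)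
    (hc1 : c < 1) : IsPreconnected (cap p c \ {x | inner ℝ n (x : E3) = 0 ∧
      0 ≤ inner ℝ v (x : E3)}) := by
  have heq : cap p c \ {x | inner ℝ n (x : E3) = 0 ∧ 0 ≤ inner ℝ v (x : E3)} =
      (halfCap p n c ∪ halfCap p (-v) c) ∪ halfCap p (-n) c := by
    ext x
    simp only [halfCap, Set.mem_sdiff, mem_union, mem_inter_iff, mem_ofPred_eq, inner_neg_left]
    constructor
    · rintro ⟨h1, h2⟩
      rcases lt_trichotomy (inner ℝ n (x : E3)) 0 with h3 | h3 | h3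
      · right; exact ⟨h1, by linarith⟩
      · left; right
        refine ⟨h1, ?_⟩
        by_contra h4
        exact h2 ⟨h3, by linarith⟩
      · left; left; exact ⟨h1, h3⟩
    · rintro ((⟨h1, h2⟩ | ⟨h1, h2⟩) | ⟨h1, h2⟩) <;>
        refine ⟨h1, fun h3 => ?_⟩ <;> linarith [h3.1, h3.2]
  rw [heq]
  -- a point of the half-cap on the side `-v` on each side of the plane `n`
  have key : ∀ m : E3, IsFrame p v m → (halfCap p m c ∩ halfCap p (-v) c).Nonempty := by
    intro m hm
    let w : E3 := gc m (-v) (Real.pi / 4)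
    have hF : IsFrame m (-v) p :=
      ⟨hm.norm_n, by rw [norm_neg, hm.norm_v], hm.norm_p, by
        rw [inner_neg_right, real_inner_comm, hm.vn, neg_zero], by
        rw [real_inner_comm, hm.pn], by rw [inner_neg_left, real_inner_comm, hm.pv, neg_zero]⟩
    have hw := hF.transport (Real.pi / 4)
    have hw2 : IsFrame p w (gcVel m (-v) (Real.pi / 4)) :=
      ⟨hw.norm_n, hw.norm_p, hw.norm_v, (real_inner_comm _ _).trans hw.pn,
        (real_inner_comm _ _).trans hw.vn, hw.pv⟩
    obtain ⟨t, ht0, ht1, h1, h2⟩ := hw2.exists_pt_mem hc1 one_pos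
    have hs : 0 < Real.sin t := Real.sin_pos_of_pos_of_lt_pi ht0 (by linarith [Real.pi_gt_three])
    have hin := hF.inner_gc (Real.pi / 4)
    refine ⟨hw2.pt t, ⟨h1, ?_⟩, h1, ?_⟩
    · change 0 < inner ℝ m (gc p w t)
      rw [gc, inner_add_right, inner_smul_right, inner_smul_right, hin.1, real_inner_comm, hm.pn,
        Real.cos_pi_div_four]
      simp; positivity
    · change 0 < inner ℝ (-v) (gc p w t)
      rw [gc, inner_add_right, inner_smul_right, inner_smul_right, hin.2.1, real_inner_comm,
        inner_neg_right, hm.pv, Real.sin_pi_div_four]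
      simp; positivity
  have h1 := isPreconnected_halfCap p n hc
  have h2 := isPreconnected_halfCap p (-v) hc
  have h3 := isPreconnected_halfCap p (-n) hc
  obtain ⟨x, hx1, hx2⟩ := key n h
  obtain ⟨y, hy1, hy2⟩ := key (-n) h.neg
  exact (h1.union x hx1 hx2 h2).union y (Or.inr hy2) hy1 h3

/-- A cap without its centre is connected. -/
theorem IsFrame.isPreconnected_puncturedCap {p v n : E3} (h : IsFrame p v n) {c : ℝ} (hc : 0 ≤ c)
    (hc1 : c < 1) : IsPreconnected (cap p c \ {x | (x : E3) = p}) := by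
  have heq : cap p c \ {x | (x : E3) = p} =
      (cap p c \ {x | inner ℝ n (x : E3) = 0 ∧ 0 ≤ inner ℝ v (x : E3)}) ∪
      (cap p c \ {x | inner ℝ n (x : E3) = 0 ∧ 0 ≤ inner ℝ (-v) (x : E3)}) := by
    ext x
    simp only [Set.mem_sdiff, mem_union, mem_ofPred_eq, inner_neg_left]
    constructor
    · rintro ⟨h1, h2⟩
      by_contra hcon
      push Not at hcon
      have h3 := hcon.1 h1
      have h4 := hcon.2 h1
      have hv : inner ℝ v (x : E3) = (0 : ℝ) := by linarith [h3.2, h4.2]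
      obtain ⟨s, hs, hs1, hs2, hs3, -⟩ := h.exists_gc (norm_coe_S2 x) h3.1
      have h5 : Real.sin s = 0 := by rw [← (h.inner_gc s).2.1, ← hs, hv]
      have h6 : 0 < Real.cos s := by
        rw [← (h.inner_gc s).1, ← hs]; exact lt_of_le_of_lt hc h1
      have h7 : Real.cos s = 1 := by nlinarith [Real.sin_sq_add_cos_sq s]
      apply h2
      rw [hs, gc, h5, h7]; simp
    · have h0 : inner ℝ n p = (0 : ℝ) := (real_inner_comm _ _).trans h.pn
      have h1 : inner ℝ v p = (0 : ℝ) := (real_inner_comm _ _).trans h.pv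
      rintro (⟨h2, h3⟩ | ⟨h2, h3⟩) <;> refine ⟨h2, fun h4 => h3 ?_⟩ <;> rw [h4, h0, h1] <;> simp
  rw [heq]
  obtain ⟨x, hx, hx2⟩ := h.halfCap_nonempty hc1
  have hx2' : 0 < inner ℝ n (x : E3) := hx2
  refine (h.isPreconnected_slitCap hc hc1).union x ⟨hx, ?_⟩ ⟨hx, ?_⟩
    (h.neg_v.isPreconnected_slitCap hc hc1)
  · intro h3; linarith [h3.1]
  · intro h3; linarith [h3.1]

/-! ### Geodesic arcs -/

/-- The closed arc of length `l` from `p` in the direction `v`. -/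
def arcSet (p v : E3) (l : ℝ) : Set S2 := {x | ∃ t ∈ Icc (0 : ℝ) l, (x : E3) = gc p v t}

/-- The arc of length `l` from `p` in the direction `v`, without its end points. -/
def openArc (p v : E3) (l : ℝ) : Set S2 := {x | ∃ t ∈ Ioo (0 : ℝ) l, (x : E3) = gc p v t}

theorem openArc_reverse (p v : E3) (l : ℝ) :
    openArc (gc p v l) (-gcVel p v l) l = openArc p v l := by
  ext x
  simp only [openArc, gc_reverse, mem_ofPred_eq]
  constructor
  · rintro ⟨t, ht, hx⟩
    exact ⟨l - t, ⟨by linarith [ht.2], by linarith [ht.1]⟩, hx⟩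
  · rintro ⟨t, ht, hx⟩
    exact ⟨l - t, ⟨by linarith [ht.2], by linarith [ht.1]⟩, by rw [hx]; congr 1; ring⟩

theorem openArc_map (p v : E3) (l : ℝ) (g : O3) :
    act g '' openArc p v l = openArc (g p) (g v) l := by
  ext x
  constructor
  · rintro ⟨y, ⟨t, ht, hy⟩, rfl⟩
    refine ⟨t, ht, ?_⟩
    change g (y : E3) = _
    rw [hy, gc_map]
  · rintro ⟨t, ht, hx⟩
    refine ⟨act g⁻¹ x, ⟨t, ht, ?_⟩, ?_⟩
    · change g.symm (x : E3) = _
      rw [hx, ← gc_map, g.symm_apply_apply]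
    · apply Subtype.ext
      change g (g.symm (x : E3)) = _
      simp

section

variable {p v n : E3} (h : IsFrame p v n)
include h

theorem IsFrame.openArc_eq (l : ℝ) : openArc p v l = h.pt '' Ioo 0 l := by
  ext x
  constructor
  · rintro ⟨t, ht, hx⟩; exact ⟨t, ht, Subtype.ext hx.symm⟩
  · rintro ⟨t, ht, rfl⟩; exact ⟨t, ht, rfl⟩

theorem IsFrame.arcSet_eq (l : ℝ) : arcSet p v l = h.pt '' Icc 0 l := by
  ext x
  constructor
  · rintro ⟨t, ht, hx⟩; exact ⟨t, ht, Subtype.ext hx.symm⟩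
  · rintro ⟨t, ht, rfl⟩; exact ⟨t, ht, rfl⟩

theorem IsFrame.isClosed_arcSet (l : ℝ) : IsClosed (arcSet p v l) := by
  rw [h.arcSet_eq]
  exact (isCompact_Icc.image h.continuous_pt).isClosed

theorem IsFrame.isPreconnected_openArc (l : ℝ) : IsPreconnected (openArc p v l) := by
  rw [h.openArc_eq]
  exact isPreconnected_Ioo.image _ h.continuous_pt.continuousOn

theorem IsFrame.arcSet_subset_closure {l : ℝ} (hl : 0 < l) :
    arcSet p v l ⊆ closure (openArc p v l) := by
  rw [h.openArc_eq, h.arcSet_eq, ← closure_Ioo hl.ne]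
  exact image_closure_subset_closure_image h.continuous_pt

/-- Near an interior point, an arc coincides with its great circle. -/
theorem IsFrame.arc_local {l t₀ : ℝ} (ht : t₀ ∈ Ioo 0 l) :
    ∃ c, 0 < c ∧ c < 1 ∧ ∀ x ∈ cap (gc p v t₀) c, inner ℝ n (x : E3) = 0 → x ∈ openArc p v l := by
  have hpi := Real.pi_pos
  have h0 := h.transport t₀
  set τ := min (min t₀ (l - t₀)) 1 with hτ
  have hτ0 : 0 < τ := by
    have := ht.1; have := ht.2
    apply lt_min (lt_min _ _) <;> linarith
  have hτ1 : τ ≤ 1 := min_le_right _ _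
  have h3 := Real.pi_gt_three
  refine ⟨Real.cos τ, Real.cos_pos_of_mem_Ioo ⟨by linarith, by linarith⟩, ?_, ?_⟩
  · rw [← Real.cos_zero]
    exact Real.cos_lt_cos_of_nonneg_of_le_pi le_rfl (by linarith) hτ0
  · intro x hx hn
    obtain ⟨s, hs, hs1, hs2, -⟩ := h0.exists_gc (norm_coe_S2 x) hn
    have h4 : Real.cos τ < Real.cos s := by
      rw [← (h0.inner_gc s).1, ← hs]; exact hx
    have h5 : |s| < τ := by
      by_contra hcon
      push Not at hcon
      rw [← Real.cos_abs s] at h4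
      have := Real.cos_le_cos_of_nonneg_of_le_pi hτ0.le (abs_le.mpr ⟨hs1, hs2⟩) hcon
      linarith
    rw [abs_lt] at h5
    have h6 : τ ≤ t₀ := (min_le_left _ _).trans (min_le_left _ _)
    have h7 : τ ≤ l - t₀ := (min_le_left _ _).trans (min_le_right _ _)
    refine ⟨t₀ + s, ⟨by linarith, by linarith⟩, ?_⟩
    rw [hs, gc_gc]

/-- Near its initial point, an arc is a ray. -/
theorem IsFrame.arc_local_start {l : ℝ} (hl0 : 0 < l) (hl : l < 2 * Real.pi) :
    ∃ c, 0 < c ∧ c < 1 ∧ ∀ x ∈ cap p c,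
      (x ∈ arcSet p v l ↔ inner ℝ n (x : E3) = 0 ∧ 0 ≤ inner ℝ v (x : E3)) := by
  have hpi := Real.pi_pos
  have h3 := Real.pi_gt_three
  set τ := min (min l (2 * Real.pi - l)) 1 with hτ
  have hτ0 : 0 < τ := by
    apply lt_min (lt_min _ _) <;> linarith
  have hτ1 : τ ≤ 1 := min_le_right _ _
  have h6 : τ ≤ l := (min_le_left _ _).trans (min_le_left _ _)
  have h7 : τ ≤ 2 * Real.pi - l := (min_le_left _ _).trans (min_le_right _ _)
  refine ⟨Real.cos τ, Real.cos_pos_of_mem_Ioo ⟨by linarith, by linarith⟩, ?_, ?_⟩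
  · rw [← Real.cos_zero]
    exact Real.cos_lt_cos_of_nonneg_of_le_pi le_rfl (by linarith) hτ0
  · intro x hx
    have hx' : Real.cos τ < inner ℝ p (x : E3) := hx
    constructor
    · rintro ⟨t, ht, hxt⟩
      rw [hxt] at hx' ⊢
      rw [(h.inner_gc t).1] at hx'
      refine ⟨(h.inner_gc t).2.2, ?_⟩
      rw [(h.inner_gc t).2.1]
      rcases le_or_gt t Real.pi with h8 | h8
      · exact Real.sin_nonneg_of_nonneg_of_le_pi ht.1 h8
      · exfalso
        have h9 : Real.cos t ≤ Real.cos τ := by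
          rw [← Real.cos_two_pi_sub t]
          apply Real.cos_le_cos_of_nonneg_of_le_pi hτ0.le (by linarith)
          linarith [ht.2]
        linarith
    · rintro ⟨hn, hv⟩
      obtain ⟨s, hs, hs1, hs2, hs3, -⟩ := h.exists_gc (norm_coe_S2 x) hn
      rw [hs, (h.inner_gc s).1] at hx'
      refine ⟨s, ⟨hs3 hv, ?_⟩, hs⟩
      by_contra hcon
      push Not at hcon
      have := Real.cos_le_cos_of_nonneg_of_le_pi hτ0.le hs2 (by linarith)
      linarith

/-- The initial direction and the length of an arc are determined by the set of its points and its
end points. -/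
theorem IsFrame.arc_unique {v' n' : E3} (h' : IsFrame p v' n') {l l' : ℝ} (hl0 : 0 < l)
    (hl : l < 2 * Real.pi) (hl0' : 0 < l') (hl' : l' < 2 * Real.pi)
    (hs : openArc p v l = openArc p v' l') (hq : gc p v l = gc p v' l') : v = v' ∧ l = l' := by
  have hpi := Real.pi_gt_three
  have hv : v = v' := by
    -- a point close to `p`, so close that it is not near the end of the second arc
    set t := min (min l (2 * Real.pi - l')) 1 / 2 with ht
    have hm : 0 < min (min l (2 * Real.pi - l')) 1 := by
      apply lt_min (lt_min _ _) <;> linarith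
    have h1 : min (min l (2 * Real.pi - l')) 1 ≤ l := (min_le_left _ _).trans (min_le_left _ _)
    have h2 : min (min l (2 * Real.pi - l')) 1 ≤ 2 * Real.pi - l' :=
      (min_le_left _ _).trans (min_le_right _ _)
    have h3 : min (min l (2 * Real.pi - l')) 1 ≤ 1 := min_le_right _ _
    have hmem : h.pt t ∈ openArc p v' l' := by
      rw [← hs]; exact ⟨t, ⟨by linarith, by linarith⟩, rfl⟩
    obtain ⟨t', ht', heq⟩ := hmem
    change gc p v t = gc p v' t' at heq
    have hc : Real.cos t = Real.cos t' := by
      rw [← (h.inner_gc t).1, heq, (h'.inner_gc t').1]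
    have hsv : Real.sin t • v = Real.sin t' • v' := by
      simpa [gc, hc] using heq
    have hst : 0 < Real.sin t := Real.sin_pos_of_pos_of_lt_pi (by linarith) (by linarith)
    have htt : t' = t := by
      rcases le_or_gt t' Real.pi with h8 | h8
      · exact (Real.injOn_cos ⟨ht'.1.le, h8⟩ ⟨by linarith, by linarith⟩ hc.symm)
      · exfalso
        rw [← Real.cos_two_pi_sub t'] at hc
        have := (Real.injOn_cos ⟨by linarith, by linarith⟩
          ⟨by linarith [ht'.2], by linarith⟩ hc)
        linarith [ht'.2]
    rw [htt] at hsv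
    exact smul_right_injective _ hst.ne' hsv
  subst hv
  refine ⟨rfl, h.gc_inj ?_ hq⟩
  rw [abs_lt]; constructor <;> linarith

end

theorem IsGeodesicArc.exists_frame {s : Set S2} {p q : S2} {l : ℝ} (h : IsGeodesicArc s p q l) :
    0 < l ∧ l < 2 * Real.pi ∧ ∃ v n, IsFrame (p : E3) v n ∧ (q : E3) = gc p v l ∧
      s = arcSet p v l := by
  obtain ⟨h1, h2, v, hv, hpv, hq, hs⟩ := h
  obtain ⟨n, hn⟩ := SphereTiling.exists_frame (norm_coe_S2 p) hv hpv
  exact ⟨h1, h2, v, n, hn, hq, hs⟩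

/-- A preconnected set covered by finitely many closed sets which are disjoint on it lies in one
of them. -/
theorem _root_.IsPreconnected.subset_of_finite_closed_cover {X ι : Type*} [TopologicalSpace X]
    [Finite ι]
    {s : Set X} (hs : IsPreconnected s) (hne : s.Nonempty) (K : ι → Set X)
    (hK : ∀ i, IsClosed (K i)) (hcov : s ⊆ ⋃ i, K i)
    (hdis : ∀ i j, i ≠ j → ∀ x ∈ s, x ∈ K i → x ∉ K j) : ∃ i, s ⊆ K i := by
  obtain ⟨x, hx⟩ := hne
  obtain ⟨i, hi⟩ := mem_iUnion.mp (hcov hx)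
  refine ⟨i, ?_⟩
  have hcl : IsClosed (⋃ j ∈ {j | j ≠ i}, K j) := by
    apply Set.Finite.isClosed_biUnion (Set.toFinite _)
    intro j _; exact hK j
  have hcov' : s ⊆ K i ∪ ⋃ j ∈ {j | j ≠ i}, K j := by
    intro y hy
    obtain ⟨j, hj⟩ := mem_iUnion.mp (hcov hy)
    by_cases hji : j = i
    · subst hji; exact Or.inl hj
    · right; simp only [mem_iUnion]; exact ⟨j, hji, hj⟩
  rcases (isPreconnected_iff_subset_of_disjoint_closed.mp hs) _ _ (hK i) hcl hcov' (by
    apply eq_empty_of_forall_notMem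
    rintro y ⟨hy, hyi, hyj⟩
    simp only [mem_iUnion] at hyj
    obtain ⟨j, hji, hj⟩ := hyj
    exact hdis j i hji y hy hj hyi) with h1 | h1
  · exact h1
  · exfalso
    have := h1 hx
    simp only [mem_iUnion] at this
    obtain ⟨j, hji, hj⟩ := this
    exact hdis j i hji x hx hj hi

/-- A preconnected set on which `W` is closed, and a neighbourhood of all of its points that it
contains, lies in `W` as soon as it meets `W`. -/
theorem _root_.IsPreconnected.subset_of_mem_nhds {X : Type*} [TopologicalSpace X] {s W : Set X}
    (hs : IsPreconnected s) (hne : (s ∩ W).Nonempty) (hW : IsClosed W)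
    (h : ∀ x ∈ s, x ∈ W → W ∈ 𝓝 x) : s ⊆ W := by
  refine (hs.subset_left_of_subset_union isOpen_interior hW.isOpen_compl ?_ ?_ ?_).trans
    interior_subset
  · exact disjoint_left.mpr fun x hx hx' => hx' (interior_subset hx)
  · intro x hx
    by_cases hxW : x ∈ W
    · left; exact mem_interior_iff_mem_nhds.mpr (h x hx hxW)
    · right; exact hxW
  · obtain ⟨x, hx, hxW⟩ := hne
    exact ⟨x, hx, mem_interior_iff_mem_nhds.mpr (h x hx hxW)⟩

/-! ### The region of a quadrilateral near its sides -/

/-- Near the point `x`, the plane with normal `n` separates the interior of `R`, on the positive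
side, from the complement of `R`. -/
def Inward (R : Set S2) (x : S2) (n : E3) : Prop :=
  ∀ᶠ y : S2 in 𝓝 x,
    (0 < inner ℝ n (y : E3) → y ∈ interior R) ∧ (inner ℝ n (y : E3) < 0 → y ∉ R)

/-- The point `x` is not in the closure of the interior of `R`. -/
def Thin (R : Set S2) (x : S2) : Prop := ∀ᶠ y in 𝓝 x, y ∉ interior R

theorem isOpen_inward (R : Set S2) (n : E3) : IsOpen {x | Inward R x n} := by
  rw [isOpen_iff_mem_nhds]
  intro x hx
  exact eventually_eventually_nhds.mpr hx

theorem isOpen_thin (R : Set S2) : IsOpen {x | Thin R x} := by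
  rw [isOpen_iff_mem_nhds]
  intro x hx
  exact eventually_eventually_nhds.mpr hx

/-- Near every point of the great circle with normal `n` there are points on its positive side. -/
theorem IsFrame.exists_pos {x : S2} {v n : E3} (h : IsFrame (x : E3) v n) {P : S2 → Prop}
    (hP : ∀ᶠ y in 𝓝 x, P y) : ∃ y, P y ∧ 0 < inner ℝ n (y : E3) := by
  obtain ⟨c, -, hc1, hc⟩ := exists_cap_subset hP
  obtain ⟨y, hy1, hy2⟩ := h.halfCap_nonempty hc1
  exact ⟨y, hc hy1, hy2⟩

theorem IsFrame.not_inward_neg {R : Set S2} {x : S2} {v n : E3} (h : IsFrame (x : E3) v n)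
    (h1 : Inward R x n) (h2 : Inward R x (-n)) : False := by
  obtain ⟨y, ⟨hy1, hy2⟩, hy⟩ := h.exists_pos (h1.and h2)
  exact hy2.2 (by rw [inner_neg_left]; linarith) (interior_subset (hy1.1 hy))

theorem IsFrame.not_inward_thin {R : Set S2} {x : S2} {v n : E3} (h : IsFrame (x : E3) v n)
    (h1 : Inward R x n) (h2 : Thin R x) : False := by
  obtain ⟨y, ⟨hy1, hy2⟩, hy⟩ := h.exists_pos (h1.and h2)
  exact hy2 (hy1.1 hy)

theorem _root_.IsPreconnected.subset_interior_or_compl {X : Type*} [TopologicalSpace X]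
    {s R : Set X}
    (hs : IsPreconnected s) (hR : IsClosed R) (hd : ∀ x ∈ s, x ∉ frontier R) :
    s ⊆ interior R ∨ s ⊆ Rᶜ := by
  refine hs.subset_or_subset isOpen_interior hR.isOpen_compl ?_ ?_
  · exact disjoint_left.mpr fun x hx hx' => hx' (interior_subset hx)
  · intro x hx
    by_cases h : x ∈ R
    · left
      by_contra h2
      exact hd x hx ⟨subset_closure h, h2⟩
    · exact Or.inr h

/-- If the frontier of a closed set `R` is a great circle near `x`, then near `x` either `R` is on
exactly one side of this circle or `R` has no interior points. -/
theorem IsFrame.inward_or_thin {R : Set S2} (hR : IsClosed R) {x : S2} {v n : E3}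
    (h : IsFrame (x : E3) v n)
    (hfr : ∀ᶠ y : S2 in 𝓝 x, (y ∈ frontier R ↔ inner ℝ n (y : E3) = 0)) :
    Inward R x n ∨ Inward R x (-n) ∨ Thin R x := by
  obtain ⟨c, hc0, hc1, hc⟩ := exists_cap_subset hfr
  have key : ∀ m : E3, (m = n ∨ m = -n) → halfCap x m c ⊆ interior R ∨ halfCap x m c ⊆ Rᶜ := by
    intro m hm
    apply (isPreconnected_halfCap (x : E3) m hc0.le).subset_interior_or_compl hR
    rintro y ⟨hy1, hy2⟩ hy3
    have h0 := (hc hy1).mp hy3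
    have hy2' : 0 < inner ℝ m (y : E3) := hy2
    rcases hm with rfl | rfl
    · rw [h0] at hy2'; exact lt_irrefl _ hy2'
    · rw [inner_neg_left, h0] at hy2'; simp at hy2'
  have hnhds : cap (x : E3) c ∈ 𝓝 x := (isOpen_cap _ _).mem_nhds (mem_cap_self x hc1)
  have hneg : ∀ y : S2, inner ℝ n (y : E3) < 0 → 0 < inner ℝ (-n) (y : E3) := by
    intro y hy; rw [inner_neg_left]; linarith
  have hneg' : ∀ y : S2, inner ℝ (-n) (y : E3) < 0 → 0 < inner ℝ n (y : E3) := by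
    intro y hy; rw [inner_neg_left] at hy; linarith
  have hneg'' : ∀ y : S2, 0 < inner ℝ (-n) (y : E3) → inner ℝ n (y : E3) < 0 := by
    intro y hy; rw [inner_neg_left] at hy; linarith
  rcases key n (Or.inl rfl) with h1 | h1 <;> rcases key (-n) (Or.inr rfl) with h2 | h2
  · exfalso
    have hx : x ∈ interior R := by
      rw [mem_interior_iff_mem_nhds]
      filter_upwards [hnhds] with y hy
      rcases lt_trichotomy (inner ℝ n (y : E3)) 0 with h3 | h3 | h3
      · exact interior_subset (h2 ⟨hy, hneg y h3⟩)
      · exact hR.frontier_subset ((hc hy).mpr h3)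
      · exact interior_subset (h1 ⟨hy, h3⟩)
    have hx2 : x ∈ frontier R :=
      (hc (mem_cap_self x hc1)).mpr ((real_inner_comm _ _).trans h.pn)
    exact hx2.2 hx
  · left
    filter_upwards [hnhds] with y hy
    exact ⟨fun h3 => h1 ⟨hy, h3⟩, fun h3 => h2 ⟨hy, hneg y h3⟩⟩
  · right; left
    filter_upwards [hnhds] with y hy
    exact ⟨fun h3 => h2 ⟨hy, h3⟩, fun h3 => h1 ⟨hy, hneg' y h3⟩⟩
  · right; right
    filter_upwards [hnhds] with y hy hy2
    rcases lt_trichotomy (inner ℝ n (y : E3)) 0 with h3 | h3 | h3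
    · exact h2 ⟨hy, hneg y h3⟩ (interior_subset hy2)
    · exact ((hc hy).mpr h3).2 hy2
    · exact h1 ⟨hy, h3⟩ (interior_subset hy2)

/-- If near `q` the frontier of `R` consists of a curve `s`, along which `R` has no interior points,
and of an arc that starts at `q`, then `R` has no interior points near `q`, since the arc does not
separate a small cap. -/
theorem IsFrame.thin_of_thin {R : Set S2} (hR : IsClosed R) {q : S2} {v n : E3}
    (h : IsFrame (q : E3) v n) {l : ℝ} (hl0 : 0 < l) (hl : l < 2 * Real.pi) {s : Set S2}
    (hfr : ∀ᶠ y in 𝓝 q, y ∈ frontier R → y ∈ s ∨ y ∈ arcSet q v l)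
    (hs : ∀ y ∈ s, y ≠ q → y ∈ frontier R ∧ y ∉ arcSet q v l ∧ Thin R y)
    (hq : q ∈ closure (s \ {q})) (ha : arcSet q v l ⊆ frontier R) : Thin R q := by
  obtain ⟨c1, hc1, hc1', h1⟩ := exists_cap_subset hfr
  obtain ⟨c2, hc2, hc2', h2⟩ := h.arc_local_start hl0 hl
  set c := max c1 c2
  have hc0 : 0 < c := lt_max_of_lt_left hc1
  have hc : c < 1 := max_lt hc1' hc2'
  have hsub1 : ∀ y ∈ cap (q : E3) c, y ∈ cap (q : E3) c1 :=
    fun y hy => lt_of_le_of_lt (le_max_left c1 c2) hy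
  have hsub2 : ∀ y ∈ cap (q : E3) c, y ∈ cap (q : E3) c2 :=
    fun y hy => lt_of_le_of_lt (le_max_right c1 c2) hy
  have hslit := h.isPreconnected_slitCap hc0.le hc
  set W := cap (q : E3) c \ {x | inner ℝ n (x : E3) = 0 ∧ 0 ≤ inner ℝ v (x : E3)}
  have hW : ∀ y ∈ cap (q : E3) c, y ∉ arcSet q v l → y ∈ W :=
    fun y hy hya => ⟨hy, fun h3 => hya ((h2 y (hsub2 y hy)).mpr h3)⟩
  have hW' : ∀ y ∈ W, y ∉ arcSet q v l :=
    fun y hy hya => hy.2 ((h2 y (hsub2 y hy.1)).mp hya)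
  have hqa : q ∈ arcSet q v l := ⟨0, ⟨le_rfl, hl0.le⟩, (gc_zero _ _).symm⟩
  have hnhds : cap (q : E3) c ∈ 𝓝 q := (isOpen_cap _ _).mem_nhds (mem_cap_self q hc)
  have hor : W ⊆ interior R ∨ W ⊆ (closure (interior R))ᶜ := by
    refine hslit.subset_or_subset isOpen_interior isClosed_closure.isOpen_compl ?_ ?_
    · exact disjoint_left.mpr fun x hx hx' => hx' (subset_closure hx)
    · intro y hy
      by_contra hcon
      rw [mem_union, not_or, mem_compl_iff, not_not] at hcon
      have hyR : y ∈ R := (closure_minimal interior_subset hR) hcon.2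
      rcases h1 (hsub1 y hy.1) ⟨subset_closure hyR, hcon.1⟩ with h3 | h3
      · have hyq : y ≠ q := by rintro rfl; exact hW' _ hy hqa
        obtain ⟨z, hz1, hz2⟩ := mem_closure_iff_nhds.mp hcon.2 _ (hs y h3 hyq).2.2
        exact hz1 hz2
      · exact hW' y hy h3
  rcases hor with h3 | h3
  · exfalso
    obtain ⟨y, hy1, hy2, hy3⟩ := mem_closure_iff_nhds.mp hq _ hnhds
    obtain ⟨h4, h5, -⟩ := hs y hy2 hy3
    exact h4.2 (h3 (hW y hy1 h5))
  · filter_upwards [hnhds] with y hy hyR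
    by_cases hya : y ∈ arcSet q v l
    · exact (ha hya).2 hyR
    · exact h3 (hW y hy hya) (subset_closure hyR)

namespace Quad

variable (Q : Quad)

/-- A side without its end points. -/
def openSide (k : Fin 4) : Set S2 := Q.side k \ {Q.corner k, Q.corner (k + 1)}

/-- `v` is the direction of the side `k` at the corner `k`, and `(corner k, v, n)` is a frame. -/
structure IsSideDir (k : Fin 4) (v n : E3) : Prop where
  frame : IsFrame (Q.corner k : E3) v n
  corner_eq : (Q.corner (k + 1) : E3) = gc (Q.corner k) v (Q.len k)
  side_eq : Q.side k = arcSet (Q.corner k) v (Q.len k)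

theorem len_pos (k : Fin 4) : 0 < Q.len k := (Q.isGeodesicArc_side k).1

theorem len_lt (k : Fin 4) : Q.len k < 2 * Real.pi := (Q.isGeodesicArc_side k).2.1

theorem exists_isSideDir (k : Fin 4) : ∃ v n, Q.IsSideDir k v n := by
  obtain ⟨-, -, v, n, h1, h2, h3⟩ := (Q.isGeodesicArc_side k).exists_frame
  exact ⟨v, n, h1, h2, h3⟩

variable {Q}

theorem IsSideDir.openSide_eq {k : Fin 4} {v n : E3} (h : Q.IsSideDir k v n) :
    Q.openSide k = openArc (Q.corner k) v (Q.len k) := by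
  have hl := Q.len_lt k
  have hl0 := Q.len_pos k
  ext x
  rw [openSide, h.side_eq]
  constructor
  · rintro ⟨⟨t, ht, hx⟩, hx2⟩
    simp only [mem_insert_iff, mem_singleton_iff, not_or] at hx2
    refine ⟨t, ⟨lt_of_le_of_ne ht.1 ?_, lt_of_le_of_ne ht.2 ?_⟩, hx⟩
    · rintro rfl
      exact hx2.1 (Subtype.ext (hx.trans (gc_zero _ _)))
    · rintro rfl
      exact hx2.2 (Subtype.ext (hx.trans h.corner_eq.symm))
  · rintro ⟨t, ht, hx⟩
    refine ⟨⟨t, Ioo_subset_Icc_self ht, hx⟩, ?_⟩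
    simp only [mem_insert_iff, mem_singleton_iff, not_or]
    constructor
    · rintro rfl
      have := h.frame.gc_inj (s := 0) (t := t)
        (by rw [abs_lt]; constructor <;> linarith [ht.1, ht.2])
        (by rw [gc_zero]; exact hx)
      linarith [ht.1]
    · rintro rfl
      have := h.frame.gc_inj (s := Q.len k) (t := t)
        (by rw [abs_lt]; constructor <;> linarith [ht.1, ht.2]) (by rw [← h.corner_eq]; exact hx)
      linarith [ht.2]

variable (Q)

theorem isClosed_side (k : Fin 4) : IsClosed (Q.side k) := by
  obtain ⟨v, n, h⟩ := Q.exists_isSideDir k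
  rw [h.side_eq]; exact h.frame.isClosed_arcSet _

theorem isPreconnected_openSide (k : Fin 4) : IsPreconnected (Q.openSide k) := by
  obtain ⟨v, n, h⟩ := Q.exists_isSideDir k
  rw [h.openSide_eq]; exact h.frame.isPreconnected_openArc _

theorem side_subset_closure (k : Fin 4) : Q.side k ⊆ closure (Q.openSide k) := by
  obtain ⟨v, n, h⟩ := Q.exists_isSideDir k
  rw [h.openSide_eq, h.side_eq]; exact h.frame.arcSet_subset_closure (Q.len_pos k)

theorem corner_mem_side (k : Fin 4) : Q.corner k ∈ Q.side k := by
  obtain ⟨v, n, h⟩ := Q.exists_isSideDir k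
  rw [h.side_eq]; exact ⟨0, ⟨le_rfl, (Q.len_pos k).le⟩, (gc_zero _ _).symm⟩

theorem corner_succ_mem_side (k : Fin 4) : Q.corner (k + 1) ∈ Q.side k := by
  obtain ⟨v, n, h⟩ := Q.exists_isSideDir k
  rw [h.side_eq]; exact ⟨Q.len k, ⟨(Q.len_pos k).le, le_rfl⟩, h.corner_eq⟩

theorem openSide_nonempty (k : Fin 4) : (Q.openSide k).Nonempty := by
  obtain ⟨v, n, h⟩ := Q.exists_isSideDir k
  rw [h.openSide_eq]
  exact ⟨h.frame.pt (Q.len k / 2), Q.len k / 2, ⟨by linarith [Q.len_pos k],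
    by linarith [Q.len_pos k]⟩, rfl⟩

theorem closure_openSide (k : Fin 4) : closure (Q.openSide k) = Q.side k :=
  (closure_minimal sdiff_subset (Q.isClosed_side k)).antisymm (Q.side_subset_closure k)

theorem side_subset_frontier (k : Fin 4) : Q.side k ⊆ frontier Q.region := by
  rw [Q.frontier_region]; exact subset_iUnion _ k

theorem side_subset_region (k : Fin 4) : Q.side k ⊆ Q.region :=
  (Q.side_subset_frontier k).trans Q.isClosed_region.frontier_subset

theorem corner_mem_region (k : Fin 4) : Q.corner k ∈ Q.region :=
  Q.side_subset_region k (Q.corner_mem_side k)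

theorem fin4_cases : ∀ k m : Fin 4, m = k ∨ m = k + 1 ∨ m = k + 2 ∨ (k = m + 1) := by decide

theorem corner_mem_side_iff (k m : Fin 4) : Q.corner k ∈ Q.side m ↔ m = k ∨ m + 1 = k := by
  constructor
  · intro h
    rcases fin4_cases k m with rfl | rfl | rfl | rfl
    · exact Or.inl rfl
    · have : Q.corner k ∈ Q.side k ∩ Q.side (k + 1) := ⟨Q.corner_mem_side k, h⟩
      rw [Q.adjacent_sides] at this
      exact absurd (Q.corner_injective this) (by clear h this; revert k; decide)
    · exact absurd h (disjoint_left.mp (Q.opposite_sides k) (Q.corner_mem_side k))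
    · exact Or.inr rfl
  · rintro (rfl | rfl)
    · exact Q.corner_mem_side _
    · exact Q.corner_succ_mem_side _

theorem corner_notMem_openSide (k m : Fin 4) : Q.corner k ∉ Q.openSide m := by
  rintro ⟨h1, h2⟩
  simp only [mem_insert_iff, mem_singleton_iff, not_or] at h2
  rcases (Q.corner_mem_side_iff k m).mp h1 with rfl | rfl
  · exact h2.1 rfl
  · exact h2.2 rfl

theorem notMem_side_of_mem_openSide {k m : Fin 4} (hkm : m ≠ k) {x : S2} (hx : x ∈ Q.openSide k) :
    x ∉ Q.side m := by
  intro h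
  have hx' := hx.2
  simp only [mem_insert_iff, mem_singleton_iff, not_or] at hx'
  rcases fin4_cases k m with rfl | rfl | rfl | rfl
  · exact hkm rfl
  · have : x ∈ Q.side k ∩ Q.side (k + 1) := ⟨hx.1, h⟩
    rw [Q.adjacent_sides] at this
    exact hx'.2 this
  · exact disjoint_left.mp (Q.opposite_sides k) hx.1 h
  · have : x ∈ Q.side m ∩ Q.side (m + 1) := ⟨h, hx.1⟩
    rw [Q.adjacent_sides] at this
    exact hx'.1 this

theorem mem_frontier_cases {x : S2} (hx : x ∈ frontier Q.region) :
    (∃ k, x = Q.corner k) ∨ ∃ k, x ∈ Q.openSide k := by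
  rw [Q.frontier_region] at hx
  obtain ⟨k, hk⟩ := mem_iUnion.mp hx
  by_cases h : x ∈ Q.openSide k
  · exact Or.inr ⟨k, h⟩
  · left
    by_contra hcon
    push Not at hcon
    exact h ⟨hk, by simp [hcon]⟩

theorem mem_region_cases {x : S2} (hx : x ∈ Q.region) :
    x ∈ interior Q.region ∨ (∃ k, x = Q.corner k) ∨ ∃ k, x ∈ Q.openSide k := by
  by_cases h : x ∈ interior Q.region
  · exact Or.inl h
  · exact Or.inr (Q.mem_frontier_cases ⟨subset_closure hx, h⟩)

variable {Q}

theorem IsSideDir.exists_frame_at {k : Fin 4} {v n : E3} (h : Q.IsSideDir k v n) {x : S2}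
    (hx : x ∈ Q.openSide k) : ∃ w, IsFrame (x : E3) w n := by
  rw [h.openSide_eq] at hx
  obtain ⟨t, -, hx⟩ := hx
  rw [hx]
  exact ⟨_, h.frame.transport t⟩

/-- Near an inner point of a side, the frontier of the region is the great circle of this side. -/
theorem IsSideDir.frontier_iff {k : Fin 4} {v n : E3} (h : Q.IsSideDir k v n) {x : S2}
    (hx : x ∈ Q.openSide k) :
    ∀ᶠ y : S2 in 𝓝 x, ((y ∈ frontier Q.region ↔ inner ℝ n (y : E3) = 0) ∧
      (inner ℝ n (y : E3) = 0 → y ∈ Q.openSide k)) := by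
  have h1 : ∀ᶠ y in 𝓝 x, ∀ m, m ≠ k → y ∉ Q.side m := by
    rw [eventually_all]
    intro m
    by_cases hm : m = k
    · simp [hm]
    · filter_upwards [(Q.isClosed_side m).isOpen_compl.mem_nhds
        (Q.notMem_side_of_mem_openSide hm hx)] with y hy _
      exact hy
  have hx2 := hx
  rw [h.openSide_eq] at hx2
  obtain ⟨t, ht, hxt⟩ := hx2
  obtain ⟨c, -, hc1, hc⟩ := h.frame.arc_local ht
  rw [← hxt] at hc
  filter_upwards [h1, (isOpen_cap (x : E3) c).mem_nhds (mem_cap_self x hc1)] with y hy1 hy2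
  have h3 : inner ℝ n (y : E3) = 0 → y ∈ Q.openSide k := by
    intro h3; rw [h.openSide_eq]; exact hc y hy2 h3
  refine ⟨⟨?_, fun h4 => Q.side_subset_frontier k (h3 h4).1⟩, h3⟩
  intro h4
  rw [Q.frontier_region] at h4
  obtain ⟨m, hm⟩ := mem_iUnion.mp h4
  have hmk : m = k := by
    by_contra hne; exact hy1 m hne hm
  subst hmk
  rw [h.side_eq] at hm
  obtain ⟨s, -, hs⟩ := hm
  rw [hs]; exact (h.frame.inner_gc s).2.2

/-- The region lies on the same side of an open side near all of its points, or it has no interior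
points near any of them. -/
theorem IsSideDir.trichotomy {k : Fin 4} {v n : E3} (h : Q.IsSideDir k v n) :
    (∀ x ∈ Q.openSide k, Inward Q.region x n) ∨ (∀ x ∈ Q.openSide k, Inward Q.region x (-n)) ∨
      ∀ x ∈ Q.openSide k, Thin Q.region x := by
  have key : ∀ x ∈ Q.openSide k, Inward Q.region x n ∨ Inward Q.region x (-n) ∨
      Thin Q.region x := by
    intro x hx
    obtain ⟨w, hw⟩ := h.exists_frame_at hx
    exact hw.inward_or_thin Q.isClosed_region ((h.frontier_iff hx).mono fun y hy => hy.1)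
  have hpre := Q.isPreconnected_openSide k
  -- the three alternatives are open conditions, and they exclude each other
  obtain ⟨x₀, hx₀⟩ := Q.openSide_nonempty k
  have hopen : ∀ (A B : Set S2), IsOpen A → IsOpen B → (∀ x ∈ Q.openSide k, x ∈ A ∨ x ∈ B) →
      (∀ x ∈ Q.openSide k, x ∈ A → x ∈ B → False) → Q.openSide k ⊆ A ∨ Q.openSide k ⊆ B := by
    intro A B hA hB hAB hdis
    refine or_iff_not_imp_left.mpr fun hnA => ?_
    rw [isPreconnected_iff_subset_of_disjoint] at hpre
    rcases hpre A B hA hB hAB (by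
      apply eq_empty_of_forall_notMem
      rintro y ⟨h1, h2, h3⟩
      exact hdis y h1 h2 h3) with h1 | h1
    · exact absurd h1 hnA
    · exact h1
  rcases hopen {x | Inward Q.region x n} ({x | Inward Q.region x (-n)} ∪ {x | Thin Q.region x})
    (isOpen_inward _ _) ((isOpen_inward _ _).union (isOpen_thin _)) key (by
      rintro x hx h1 (h2 | h2)
      · obtain ⟨w, hw⟩ := h.exists_frame_at hx
        exact hw.not_inward_neg h1 h2
      · obtain ⟨w, hw⟩ := h.exists_frame_at hx
        exact hw.not_inward_thin h1 h2) with h1 | h1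
  · exact Or.inl h1
  · right
    exact hopen {x | Inward Q.region x (-n)} {x | Thin Q.region x} (isOpen_inward _ _)
      (isOpen_thin _) h1 (by
      intro x hx h2 h3
      obtain ⟨w, hw⟩ := h.exists_frame_at hx
      exact hw.neg.not_inward_thin h2 h3)

variable (Q)

/-- If the region has no interior points near an open side, then it has none near the end of this
side either. -/
theorem thin_corner {k : Fin 4} (h : ∀ x ∈ Q.openSide k, Thin Q.region x) :
    Thin Q.region (Q.corner (k + 1)) := by
  obtain ⟨v, n, hd⟩ := Q.exists_isSideDir (k + 1)
  have ha := hd.side_eq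
  refine hd.frame.thin_of_thin Q.isClosed_region (Q.len_pos (k + 1)) (Q.len_lt (k + 1))
    (s := Q.side k \ {Q.corner k}) ?_ ?_ ?_ ?_
  · rw [← ha]
    have h1 : ∀ m : Fin 4, m ≠ k → m ≠ k + 1 → ∀ᶠ y in 𝓝 (Q.corner (k + 1)), y ∉ Q.side m := by
      intro m h1 h2
      refine (Q.isClosed_side m).isOpen_compl.mem_nhds ?_
      rw [mem_compl_iff, Q.corner_mem_side_iff]
      rintro (h3 | h3)
      · exact h2 h3
      · exact h1 (add_right_cancel h3)
    have h2 : ∀ᶠ y in 𝓝 (Q.corner (k + 1)), ∀ m : Fin 4, m ≠ k → m ≠ k + 1 → y ∉ Q.side m := by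
      rw [eventually_all]
      intro m
      by_cases h3 : m ≠ k ∧ m ≠ k + 1
      · exact (h1 m h3.1 h3.2).mono fun y hy _ _ => hy
      · exact Eventually.of_forall fun y h4 h5 => absurd ⟨h4, h5⟩ h3
    have hk1 : Q.corner (k + 1) ≠ Q.corner k := fun h3 => by
      have := Q.corner_injective h3
      clear h2 h1 ha hd h h3; revert k; decide
    filter_upwards [h2, isOpen_ne.mem_nhds hk1] with y hy hy2 hyf
    rw [Q.frontier_region] at hyf
    obtain ⟨m, hm⟩ := mem_iUnion.mp hyf
    by_contra hcon
    rw [not_or] at hcon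
    refine hy m ?_ ?_ hm
    · rintro rfl; exact hcon.1 ⟨hm, hy2⟩
    · rintro rfl; exact hcon.2 hm
  · rintro y ⟨hy, hyk'⟩ hyq
    rw [← ha]
    have hyk : y ∉ Q.side (k + 1) := by
      intro h3
      have : y ∈ Q.side k ∩ Q.side (k + 1) := ⟨hy, h3⟩
      rw [Q.adjacent_sides] at this
      exact hyq this
    refine ⟨Q.side_subset_frontier k hy, hyk, ?_⟩
    refine h y ⟨hy, ?_⟩
    simp only [mem_insert_iff, mem_singleton_iff, not_or]
    exact ⟨hyk', hyq⟩
  · refine closure_mono ?_ (Q.side_subset_closure k (Q.corner_succ_mem_side k))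
    intro x hx
    refine ⟨⟨hx.1, ?_⟩, ?_⟩ <;> rintro rfl <;> exact Q.corner_notMem_openSide _ _ hx
  · rw [← ha]; exact Q.side_subset_frontier _

end Quad

theorem isPreconnected_univ_S2 : IsPreconnected (univ : Set S2) := by
  have : IsConnected (Metric.sphere (0 : E3) 1) := by
    apply isConnected_sphere
    · rw [← Module.finrank_eq_rank]; simp
    · norm_num
  exact (isPreconnected_iff_preconnectedSpace.mp this.isPreconnected).isPreconnected_univ

namespace Quad

variable (Q : Quad)

/-- At the points of each side the region has interior points: otherwise this would fail at all
sides, and the interior would be open and closed in the sphere. -/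
theorem not_thin (k : Fin 4) (h : ∀ x ∈ Q.openSide k, Thin Q.region x) : False := by
  have step : ∀ k : Fin 4, (∀ x ∈ Q.openSide k, Thin Q.region x) →
      ∀ x ∈ Q.openSide (k + 1), Thin Q.region x := by
    intro k hk
    have h1 := Q.thin_corner hk
    have h2 : Q.corner (k + 1) ∈ closure (Q.openSide (k + 1)) :=
      Q.side_subset_closure _ (Q.corner_mem_side _)
    obtain ⟨y, hy1, hy2⟩ := mem_closure_iff_nhds.mp h2 _ ((isOpen_thin Q.region).mem_nhds h1)
    obtain ⟨v, n, hd⟩ := Q.exists_isSideDir (k + 1)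
    obtain ⟨w, hw⟩ := hd.exists_frame_at hy2
    rcases hd.trichotomy with h3 | h3 | h3
    · exact (hw.not_inward_thin (h3 y hy2) hy1).elim
    · exact (hw.neg.not_inward_thin (h3 y hy2) hy1).elim
    · exact h3
  have hall : ∀ m : Fin 4, ∀ x ∈ Q.openSide m, Thin Q.region x := by
    have h1 := step _ h
    have h2 := step _ h1
    have h3 := step _ h2
    intro m
    rcases fin4_cases k m with rfl | rfl | rfl | hm
    · exact h
    · exact h1
    · rwa [add_assoc] at h2
    · have : m = k + 1 + 1 + 1 := by clear h3 h2 h1 h step; subst hm; revert m; decide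
      rwa [this]
  have hfr : ∀ x ∈ frontier Q.region, Thin Q.region x := by
    intro x hx
    rcases Q.mem_frontier_cases hx with ⟨m, rfl⟩ | ⟨m, hm⟩
    · have := Q.thin_corner (hall (m - 1))
      rwa [sub_add_cancel] at this
    · exact hall m x hm
  -- so the nonempty open set `interior Q.region` is closed, but it is not the whole sphere
  have hcl : IsClosed (interior Q.region) := by
    rw [← closure_subset_iff_isClosed]
    intro x hx
    by_contra hcon
    have hxR : x ∈ Q.region := closure_minimal interior_subset Q.isClosed_region hx
    obtain ⟨z, hz1, hz2⟩ := mem_closure_iff_nhds.mp hx _ (hfr x ⟨subset_closure hxR, hcon⟩)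
    exact hz1 hz2
  obtain ⟨z, hz⟩ := Q.isConnected_interior.nonempty
  have := isPreconnected_univ_S2.subset_of_mem_nhds ⟨z, mem_univ _, hz⟩ hcl
    (fun x _ hx => isOpen_interior.mem_nhds hx)
  exact (Q.side_subset_frontier 0 (Q.corner_mem_side 0)).2 (this (mem_univ _))

/-- `v` is the direction of the side `k` at the corner `k`, and `n` is the normal of the side which
points into the region. -/
structure IsSideFrame (k : Fin 4) (v n : E3) : Prop extends Q.IsSideDir k v n where
  inward : ∀ x ∈ Q.openSide k, Inward Q.region x n

theorem exists_isSideFrame (k : Fin 4) : ∃ v n, Q.IsSideFrame k v n := by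
  obtain ⟨v, n, hd⟩ := Q.exists_isSideDir k
  rcases hd.trichotomy with h | h | h
  · exact ⟨v, n, hd, h⟩
  · exact ⟨v, -n, ⟨hd.frame.neg, hd.corner_eq, hd.side_eq⟩, h⟩
  · exact (Q.not_thin k h).elim

variable {Q}

/-- Two unit normals of the same great circle agree up to sign. -/
theorem _root_.SphereTiling.IsFrame.normal_unique {p v n m : E3} (h : IsFrame p v n)
    (h' : IsFrame p v m) : m = n ∨ m = -n := by
  have h1 := h.expand m
  rw [h'.pn, h'.vn, zero_smul, zero_smul, zero_add, zero_add] at h1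
  have h2 : ‖m‖ = 1 := h'.norm_n
  rw [h1, norm_smul, h.norm_n, mul_one, Real.norm_eq_abs] at h2
  rcases eq_or_eq_neg_of_abs_eq h2 with h3 | h3
  · left; rw [h1, h3, one_smul]
  · right; rw [h1, h3, neg_smul, one_smul]

variable (Q)

theorem openSide_subset_closure_interior (k : Fin 4) :
    Q.openSide k ⊆ closure (interior Q.region) := by
  intro x hx
  obtain ⟨v, n, h⟩ := Q.exists_isSideFrame k
  obtain ⟨w, hw⟩ := h.exists_frame_at hx
  rw [mem_closure_iff_nhds]
  intro t ht
  obtain ⟨y, ⟨hy1, hy2⟩, hy⟩ := hw.exists_pos ((h.inward x hx).and ht)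
  exact ⟨y, hy2, hy1.1 hy⟩

theorem region_subset_closure_interior : Q.region ⊆ closure (interior Q.region) := by
  intro x hx
  rcases Q.mem_region_cases hx with h | ⟨k, rfl⟩ | ⟨k, h⟩
  · exact subset_closure h
  · exact closure_minimal (Q.openSide_subset_closure_interior k) isClosed_closure
      (Q.side_subset_closure k (Q.corner_mem_side k))
  · exact Q.openSide_subset_closure_interior k h

end Quad

/-! ### Isometries and tiles -/

theorem act_inv_act (g : O3) (x : S2) : act g⁻¹ (act g x) = x := by
  apply Subtype.ext
  exact g.symm_apply_apply x

theorem act_act_inv (g : O3) (x : S2) : act g (act g⁻¹ x) = x := by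
  apply Subtype.ext
  exact g.apply_symm_apply x

theorem continuous_act (g : O3) : Continuous (act g) :=
  (g.continuous.comp continuous_subtype_val).subtype_mk _

/-- The homeomorphism of the sphere induced by an element of `O(3)`. -/
noncomputable def actHomeo (g : O3) : S2 ≃ₜ S2 where
  toFun := act g
  invFun := act g⁻¹
  left_inv := act_inv_act g
  right_inv := act_act_inv g
  continuous_toFun := continuous_act g
  continuous_invFun := continuous_act g⁻¹

theorem act_injective (g : O3) : Function.Injective (act g) := (actHomeo g).injective

theorem act_image_interior (g : O3) (s : Set S2) :
    act g '' interior s = interior (act g '' s) := (actHomeo g).image_interior s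

theorem act_image_frontier (g : O3) (s : Set S2) :
    act g '' frontier s = frontier (act g '' s) := (actHomeo g).image_frontier s

theorem act_image_closure (g : O3) (s : Set S2) :
    act g '' closure s = closure (act g '' s) := (actHomeo g).image_closure s

/-- The isometry `g` maps the tile `Q` to the tile `Q'`, each marked corner to the marked corner
of the same name. -/
def Quad.Maps (g : O3) (Q Q' : Quad) : Prop :=
  act g '' Q.region = Q'.region ∧ ∀ k, act g (Q.corner k) = Q'.corner k

theorem Quad.Maps.inv {g : O3} {Q Q' : Quad} (h : Quad.Maps g Q Q') : Quad.Maps g⁻¹ Q' Q := by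
  refine ⟨?_, fun k => ?_⟩
  · rw [← h.1, ← image_comp]
    convert image_id _
    funext x; exact act_inv_act g x
  · rw [← h.2, act_inv_act]

theorem Quad.Maps.mul {g k : O3} {Q Q' Q'' : Quad} (h : Quad.Maps g Q' Q'')
    (h' : Quad.Maps k Q Q') : Quad.Maps (g * k) Q Q'' := by
  refine ⟨?_, fun m => ?_⟩
  · rw [act_mul, image_comp, h'.1, h.1]
  · rw [act_mul, Function.comp, h'.2, h.2]

theorem Quad.maps_one (Q : Quad) : Quad.Maps 1 Q Q := by
  refine ⟨?_, fun k => ?_⟩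
  · rw [act_one, image_id]
  · rw [act_one]; rfl

/-- An isometry that matches the regions and the sets of corners maps open sides into open
sides. -/
theorem Quad.image_openSide_subset {g : O3} {Q Q' : Quad} (hR : act g '' Q.region = Q'.region)
    {σ : Fin 4 → Fin 4} (hσ : Function.Surjective σ)
    (hc : ∀ k, act g (Q.corner k) = Q'.corner (σ k))
    (k : Fin 4) : ∃ m, act g '' Q.openSide k ⊆ Q'.openSide m := by
  have hfr : act g '' frontier Q.region = frontier Q'.region := by rw [act_image_frontier, hR]
  have hmem : ∀ x ∈ act g '' Q.openSide k, ∃ m, x ∈ Q'.openSide m := by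
    rintro _ ⟨y, hy, rfl⟩
    have h1 : act g y ∈ frontier Q'.region := by
      rw [← hfr]; exact mem_image_of_mem _ (Q.side_subset_frontier k hy.1)
    rcases Q'.mem_frontier_cases h1 with ⟨m, hm⟩ | h2
    · exfalso
      obtain ⟨m', rfl⟩ := hσ m
      rw [← hc, (act_injective g).eq_iff] at hm
      exact Q.corner_notMem_openSide m' k (hm ▸ hy)
    · exact h2
  -- the image is connected, and the sides cover it without overlapping on it
  obtain ⟨m, hm⟩ := ((Q.isPreconnected_openSide k).image _
    (continuous_act g).continuousOn).subset_of_finite_closed_cover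
    ((Q.openSide_nonempty k).image _) Q'.side Q'.isClosed_side
    (fun x hx => by
      obtain ⟨m, hm⟩ := hmem x hx
      exact mem_iUnion.mpr ⟨m, hm.1⟩)
    (fun i j hij x hx hxi hxj => by
      obtain ⟨m, hm⟩ := hmem x hx
      have h1 : i = m := by
        by_contra h; exact Q'.notMem_side_of_mem_openSide h hm hxi
      have h2 : j = m := by
        by_contra h; exact Q'.notMem_side_of_mem_openSide h hm hxj
      exact hij (h1.trans h2.symm))
  refine ⟨m, fun x hx => ?_⟩
  obtain ⟨m', hm'⟩ := hmem x hx
  have h1 : m = m' := by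
    by_contra h; exact Q'.notMem_side_of_mem_openSide h hm' (hm hx)
  rwa [h1]

/-- The sides of a quadrilateral are determined by their end points. -/
theorem Quad.eq_of_ends : ∀ m σ τ : Fin 4, (m = σ ∨ m + 1 = σ) → (m = τ ∨ m + 1 = τ) →
    σ ≠ τ → (m = σ ∧ τ = m + 1) ∨ (m = τ ∧ σ = m + 1) := by
  decide

/-- An isometry that matches the regions and the corners maps each open side onto an open side, and
its ends to the ends of the latter. -/
theorem Quad.image_openSide {g : O3} {Q Q' : Quad} (hR : act g '' Q.region = Q'.region)
    {σ : Fin 4 → Fin 4} (hσ : Function.Bijective σ)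
    (hc : ∀ k, act g (Q.corner k) = Q'.corner (σ k)) (k : Fin 4) :
    ∃ m, act g '' Q.openSide k = Q'.openSide m ∧
      ((σ k = m ∧ σ (k + 1) = m + 1) ∨ (σ k = m + 1 ∧ σ (k + 1) = m)) := by
  obtain ⟨m, hm⟩ := Quad.image_openSide_subset hR hσ.surjective hc k
  -- the inverse isometry maps the open side back into an open side, which must be the given one
  have hR' : act g⁻¹ '' Q'.region = Q.region := by
    rw [← hR, ← image_comp]; convert image_id _; funext x; exact act_inv_act g x
  let e := Equiv.ofBijective σ hσ
  have hc' : ∀ j, act g⁻¹ (Q'.corner j) = Q.corner (e.symm j) := by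
    intro j
    have h1 := hc (e.symm j)
    have h2 : σ (e.symm j) = j := e.apply_symm_apply j
    rw [h2] at h1
    rw [← h1, act_inv_act]
  obtain ⟨k', hk'⟩ := Quad.image_openSide_subset hR' e.symm.surjective hc' m
  have hkk : k' = k := by
    obtain ⟨x, hx⟩ := Q.openSide_nonempty k
    have h1 := hk' (mem_image_of_mem _ (hm (mem_image_of_mem _ hx)))
    rw [act_inv_act] at h1
    by_contra hne
    exact Q.notMem_side_of_mem_openSide hne hx h1.1
  subst hkk
  have heq : act g '' Q.openSide k' = Q'.openSide m := by
    refine hm.antisymm fun x hx => ?_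
    exact ⟨act g⁻¹ x, hk' (mem_image_of_mem _ hx), act_act_inv g x⟩
  refine ⟨m, heq, ?_⟩
  have hside : act g '' Q.side k' = Q'.side m := by
    rw [← Q.closure_openSide, ← Q'.closure_openSide, act_image_closure, heq]
  have h1 : Q'.corner (σ k') ∈ Q'.side m := by
    rw [← hside, ← hc]; exact mem_image_of_mem _ (Q.corner_mem_side k')
  have h2 : Q'.corner (σ (k' + 1)) ∈ Q'.side m := by
    rw [← hside, ← hc]; exact mem_image_of_mem _ (Q.corner_succ_mem_side k')
  rw [Q'.corner_mem_side_iff] at h1 h2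
  have hne : σ k' ≠ σ (k' + 1) := fun h3 => by
    have := hσ.injective h3
    clear * - this; revert k'; decide
  rcases Quad.eq_of_ends m _ _ h1 h2 hne with ⟨h3, h4⟩ | ⟨h3, h4⟩
  · exact Or.inl ⟨h3.symm, h4⟩
  · exact Or.inr ⟨h4, h3.symm⟩

theorem Quad.Maps.image_openSide {g : O3} {Q Q' : Quad} (h : Quad.Maps g Q Q') (k : Fin 4) :
    act g '' Q.openSide k = Q'.openSide k := by
  obtain ⟨m, hm, h1⟩ := Quad.image_openSide h.1 (σ := id) Function.bijective_id h.2 k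
  have : m = k := by
    rcases h1 with h1 | h1
    · exact h1.1.symm
    · exfalso
      have h2 := h1.1
      have h3 := h1.2
      clear * - h2 h3
      revert k m; decide
  rwa [this] at hm

/-- The image of an arc under an isometry, compared with a side. -/
theorem arc_eq_of_map {g : O3} {Q Q' : Quad} {k m : Fin 4}
    (ho : act g '' Q.openSide k = Q'.openSide m) {v n v' n' : E3} (h : Q.IsSideDir k v n)
    (h' : Q'.IsSideDir m v' n') (h1 : act g (Q.corner k) = Q'.corner m)
    (h2 : act g (Q.corner (k + 1)) = Q'.corner (m + 1)) : g v = v' ∧ Q.len k = Q'.len m := by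
  have e1 : g (Q.corner k : E3) = Q'.corner m := congrArg Subtype.val h1
  have e2 : g (Q.corner (k + 1) : E3) = Q'.corner (m + 1) := congrArg Subtype.val h2
  rw [h.openSide_eq, openArc_map, h'.openSide_eq, e1] at ho
  rw [h.corner_eq, gc_map, h'.corner_eq, e1] at e2
  have hF := h.frame.map g
  rw [e1] at hF
  exact hF.arc_unique h'.frame (Q.len_pos k) (Q.len_lt k) (Q'.len_pos m) (Q'.len_lt m) ho e2

/-- The same with reversed direction. -/
theorem arc_eq_of_map_reverse {g : O3} {Q Q' : Quad} {k m : Fin 4}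
    (ho : act g '' Q.openSide k = Q'.openSide m) {v n v' n' : E3} (h : Q.IsSideDir k v n)
    (h' : Q'.IsSideDir m v' n') (h1 : act g (Q.corner k) = Q'.corner (m + 1))
    (h2 : act g (Q.corner (k + 1)) = Q'.corner m) :
    g v = -gcVel (Q'.corner m) v' (Q'.len m) ∧ Q.len k = Q'.len m := by
  have e1 : g (Q.corner k : E3) = Q'.corner (m + 1) := congrArg Subtype.val h1
  have e2 : g (Q.corner (k + 1) : E3) = Q'.corner m := congrArg Subtype.val h2
  rw [h.openSide_eq, openArc_map, h'.openSide_eq, e1, ← openArc_reverse (Q'.corner m),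
    ← h'.corner_eq] at ho
  rw [h.corner_eq, gc_map, e1] at e2
  have hF := h.frame.map g
  have hF' := h'.frame.reverse (Q'.len m)
  rw [e1] at hF
  rw [← h'.corner_eq] at hF'
  refine hF.arc_unique hF' (Q.len_pos k) (Q.len_lt k) (Q'.len_pos m) (Q'.len_lt m) ho ?_
  rw [e2, h'.corner_eq, gc_reverse, sub_self, gc_zero]

theorem Quad.Maps.len_eq {g : O3} {Q Q' : Quad} (h : Quad.Maps g Q Q') (k : Fin 4) :
    Q.len k = Q'.len k := by
  obtain ⟨v, n, hd⟩ := Q.exists_isSideDir k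
  obtain ⟨v', n', hd'⟩ := Q'.exists_isSideDir k
  exact (arc_eq_of_map (h.image_openSide k) hd hd' (h.2 k) (h.2 (k + 1))).2

theorem Inward.map {R : Set S2} {x : S2} {n : E3} (h : Inward R x n) (g : O3) :
    Inward (act g '' R) (act g x) (g n) := by
  have h1 : Tendsto (act g⁻¹) (𝓝 (act g x)) (𝓝 x) := by
    have := (continuous_act g⁻¹).tendsto (act g x)
    rwa [act_inv_act] at this
  filter_upwards [h1.eventually h] with y hy
  have h2 : inner ℝ (g n) (y : E3) = inner ℝ n (act g⁻¹ y : E3) := by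
    rw [← g.inner_map_map n]
    congr 1
    exact (g.apply_symm_apply _).symm
  rw [h2]
  refine ⟨fun h3 => ?_, fun h3 => ?_⟩
  · rw [← act_image_interior]
    exact ⟨_, hy.1 h3, act_act_inv g y⟩
  · rintro ⟨z, hz, rfl⟩
    rw [act_inv_act] at hy h3
    exact hy.2 h3 hz

/-! ### Flags -/

/-- The flags of a tile: a corner together with a side at this corner. The letter names the corner,
the digit names the side (`AB`, `BC`, `CD`, `DA` are the sides `0`, `1`, `2`, `3`). -/
inductive Fl
  | a0 | a3 | b0 | b1 | c1 | c2 | d2 | d3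
  deriving DecidableEq

namespace Fl

instance : Fintype Fl := ⟨{a0, a3, b0, b1, c1, c2, d2, d3}, fun x => by cases x <;> decide⟩

/-- The corner of a flag. -/
def corner : Fl → Fin 4
  | a0 => 0 | a3 => 0 | b0 => 1 | b1 => 1 | c1 => 2 | c2 => 2 | d2 => 3 | d3 => 3

/-- The side of a flag. -/
def side : Fl → Fin 4
  | a0 => 0 | a3 => 3 | b0 => 0 | b1 => 1 | c1 => 1 | c2 => 2 | d2 => 2 | d3 => 3

/-- The flag at the other end of the same side. -/
def r0 : Fl → Fl
  | a0 => b0 | b0 => a0 | b1 => c1 | c1 => b1 | c2 => d2 | d2 => c2 | d3 => a3 | a3 => d3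

/-- The flag with the other side at the same corner. -/
def r1 : Fl → Fl
  | a0 => a3 | a3 => a0 | b0 => b1 | b1 => b0 | c1 => c2 | c2 => c1 | d2 => d3 | d3 => d2

/-- The class of a side: `0` for the two equal sides, `1` for `BC` and `2` for `CD`. -/
def cls : Fl → Fin 3
  | .a0 => 0 | .a3 => 0 | .b0 => 0 | .b1 => 1 | .c1 => 1 | .c2 => 2 | .d2 => 2 | .d3 => 0

@[simp] theorem r0_r0 (a : Fl) : a.r0.r0 = a := by cases a <;> rfl
@[simp] theorem r1_r1 (a : Fl) : a.r1.r1 = a := by cases a <;> rfl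
@[simp] theorem side_r0 (a : Fl) : a.r0.side = a.side := by cases a <;> rfl
@[simp] theorem corner_r1 (a : Fl) : a.r1.corner = a.corner := by cases a <;> rfl
theorem r1_ne (a : Fl) : a.r1 ≠ a := by cases a <;> decide

theorem corner_cases (a : Fl) : (a.corner = a.side ∧ a.r0.corner = a.side + 1) ∨
    (a.corner = a.side + 1 ∧ a.r0.corner = a.side) := by
  cases a <;> decide

theorem eq_of_corner_side : ∀ a b : Fl, a.corner = b.corner → a.side = b.side → a = b := by decide

theorem eq_or_r1_of_corner : ∀ a b : Fl, a.corner = b.corner → b = a ∨ b = a.r1 := by decide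

theorem exists_corner : ∀ k : Fin 4, ∃ a : Fl, a.corner = k := by decide

theorem exists_of_side_corner : ∀ k m : Fin 4, (k = m ∨ k + 1 = m) →
    ∃ a : Fl, a.side = k ∧ a.corner = m := by decide

end Fl

namespace Quad

/-- A frame at a flag: the direction of the side at the corner, and the normal of the side which
points into the region. -/
structure IsFlagFrame (Q : Quad) (a : Fl) (v n : E3) : Prop where
  frame : IsFrame (Q.corner a.corner : E3) v n
  other : (Q.corner a.r0.corner : E3) = gc (Q.corner a.corner) v (Q.len a.side)
  openSide_eq : Q.openSide a.side = openArc (Q.corner a.corner) v (Q.len a.side)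
  inward : ∀ x ∈ Q.openSide a.side, Inward Q.region x n

variable {Q Q' : Quad} {a : Fl}

theorem IsFlagFrame.r0 {v n : E3} (h : Q.IsFlagFrame a v n) :
    Q.IsFlagFrame a.r0 (-gcVel (Q.corner a.corner) v (Q.len a.side)) n := by
  constructor
  · rw [h.other]; exact h.frame.reverse _
  · rw [Fl.r0_r0, Fl.side_r0, h.other, gc_reverse, sub_self, gc_zero]
  · rw [Fl.side_r0, h.other, openArc_reverse, h.openSide_eq]
  · rw [Fl.side_r0]; exact h.inward

variable (Q a) in
theorem exists_isFlagFrame : ∃ v n, Q.IsFlagFrame a v n := by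
  have key : ∀ a : Fl, a.corner = a.side → a.r0.corner = a.side + 1 →
      ∃ v n, Q.IsFlagFrame a v n := by
    intro a h1 h2
    obtain ⟨v, n, h⟩ := Q.exists_isSideFrame a.side
    refine ⟨v, n, ?_, ?_, ?_, h.inward⟩
    · rw [h1]; exact h.frame
    · rw [h1, h2]; exact h.corner_eq
    · rw [h1]; exact h.openSide_eq
  rcases a.corner_cases with ⟨h1, h2⟩ | ⟨h1, h2⟩
  · exact key a h1 h2
  · obtain ⟨v, n, h⟩ := key a.r0 (by rw [h2, Fl.side_r0]) (by rw [Fl.r0_r0, Fl.side_r0, h1])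
    have := h.r0
    rw [Fl.r0_r0] at this
    exact ⟨_, _, this⟩

theorem exists_frame_of_openArc {p v n : E3} (h : IsFrame p v n) {l : ℝ} {x : S2}
    (hx : x ∈ openArc p v l) : ∃ w, IsFrame (x : E3) w n := by
  obtain ⟨t, -, hx⟩ := hx
  rw [hx]
  exact ⟨_, h.transport t⟩

theorem IsFlagFrame.exists_frame_at {v n : E3} (h : Q.IsFlagFrame a v n) {x : S2}
    (hx : x ∈ Q.openSide a.side) : ∃ w, IsFrame (x : E3) w n :=
  exists_frame_of_openArc h.frame (h.openSide_eq ▸ hx)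

theorem IsFlagFrame.unique {v n v' n' : E3} (h : Q.IsFlagFrame a v n)
    (h' : Q.IsFlagFrame a v' n') : v = v' ∧ n = n' := by
  have hv := (h.frame.arc_unique h'.frame (Q.len_pos _) (Q.len_lt _) (Q.len_pos _) (Q.len_lt _)
    (by rw [← h.openSide_eq, ← h'.openSide_eq]) (by rw [← h.other, ← h'.other])).1
  subst hv
  refine ⟨rfl, ?_⟩
  rcases h.frame.normal_unique h'.frame with h1 | h1
  · exact h1.symm
  · exfalso
    obtain ⟨x, hx⟩ := Q.openSide_nonempty a.side
    obtain ⟨w, hw⟩ := h.exists_frame_at hx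
    exact hw.not_inward_neg (h.inward x hx) (h1 ▸ h'.inward x hx)

theorem IsFlagFrame.map {g : O3} (hg : Quad.Maps g Q Q') {v n : E3} (h : Q.IsFlagFrame a v n) :
    Q'.IsFlagFrame a (g v) (g n) := by
  have e1 : ∀ k, g (Q.corner k : E3) = Q'.corner k := fun k => congrArg Subtype.val (hg.2 k)
  constructor
  · rw [← e1]; exact h.frame.map g
  · rw [← e1, ← e1, h.other, gc_map, hg.len_eq]
  · rw [← e1, ← openArc_map, ← hg.len_eq, ← h.openSide_eq, hg.image_openSide]
  · intro x hx
    rw [← hg.image_openSide] at hx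
    obtain ⟨y, hy, rfl⟩ := hx
    rw [← hg.1]
    exact (h.inward y hy).map g

end Quad

/-! ### Neighbouring tiles -/

/-- Two half-planes of the tangent plane at `x` which are not opposite have common points. -/
theorem IsFrame.exists_pos_pos {x : S2} {w n w' n' : E3} (h : IsFrame (x : E3) w n)
    (h' : IsFrame (x : E3) w' n') (hne : n' ≠ -n) {P : S2 → Prop} (hP : ∀ᶠ y in 𝓝 x, P y) :
    ∃ y, P y ∧ 0 < inner ℝ n (y : E3) ∧ 0 < inner ℝ n' (y : E3) := by
  have hs : n + n' ≠ 0 := fun h0 => hne (by rw [eq_neg_iff_add_eq_zero, add_comm]; exact h0)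
  have hpos : 0 < ‖n + n'‖ := norm_pos_iff.mpr hs
  have h1 : 0 < 1 + inner ℝ n n' := by
    have : ‖n + n'‖ ^ 2 = 2 + 2 * inner ℝ n n' := by
      rw [norm_add_sq_real, h.norm_n, h'.norm_n]; ring
    nlinarith [sq_pos_of_pos hpos]
  set u := ‖n + n'‖⁻¹ • (n + n') with hu
  have hu1 : ‖u‖ = 1 := by
    rw [hu, norm_smul, norm_inv, norm_norm, inv_mul_cancel₀ hpos.ne']
  have hxu : inner ℝ (x : E3) u = 0 := by
    rw [hu, inner_smul_right, inner_add_right, h.pn, h'.pn]; simp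
  obtain ⟨m, hm⟩ := SphereTiling.exists_frame (norm_coe_S2 x) hu1 hxu
  obtain ⟨c, -, hc1, hc⟩ := exists_cap_subset hP
  obtain ⟨t, ht0, ht1, ht2, -⟩ := hm.exists_pt_mem hc1 one_pos
  have hsin : 0 < Real.sin t := Real.sin_pos_of_pos_of_lt_pi ht0 (by linarith [Real.pi_gt_three])
  refine ⟨hm.pt t, hc ht2, ?_, ?_⟩
  · change 0 < inner ℝ n (gc x u t)
    rw [gc, inner_add_right, inner_smul_right, inner_smul_right, real_inner_comm, h.pn, hu,
      inner_smul_right, inner_add_right, inner_self_of_norm_one h.norm_n]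
    simp; positivity
  · change 0 < inner ℝ n' (gc x u t)
    rw [gc, inner_add_right, inner_smul_right, inner_smul_right, real_inner_comm, h'.pn, hu,
      inner_smul_right, inner_add_right, inner_self_of_norm_one h'.norm_n, real_inner_comm n n']
    rw [mul_zero, zero_add]
    exact mul_pos hsin (mul_pos (inv_pos.mpr hpos) (by linarith))

namespace Tiling

variable {f : ℕ} (T : Tiling f)

theorem ne_corner_of_mem_openSide {i : Fin f} {k : Fin 4} {x : S2} (hx : x ∈ (T.tile i).openSide k)
    (j : Fin f) (m : Fin 4) : x ≠ (T.tile j).corner m := by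
  rintro rfl
  obtain ⟨l, hl⟩ := T.edge_to_edge j i m ((T.tile i).side_subset_region k hx.1)
  rw [hl] at hx
  exact (T.tile i).corner_notMem_openSide l k hx

theorem eq_of_mem_interior {i j : Fin f} {x : S2} (hx : x ∈ interior (T.tile i).region)
    (hj : x ∈ (T.tile j).region) : i = j := by
  by_contra hne
  have h1 := (T.tile j).region_subset_closure_interior hj
  obtain ⟨y, hy1, hy2⟩ := mem_closure_iff.mp h1 _ isOpen_interior hx
  exact disjoint_left.mp (T.disjoint_interior i j hne) hy1 hy2

theorem mem_openSide_of_mem_region {i j : Fin f} {k : Fin 4} {x : S2}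
    (hx : x ∈ (T.tile i).openSide k) (hj : x ∈ (T.tile j).region) :
    ∃ m, x ∈ (T.tile j).openSide m := by
  rcases (T.tile j).mem_region_cases hj with h | ⟨m, h⟩ | h
  · exfalso
    have h1 := T.eq_of_mem_interior h ((T.tile i).side_subset_region k hx.1)
    subst h1
    exact ((T.tile j).side_subset_frontier k hx.1).2 h
  · exact absurd h (T.ne_corner_of_mem_openSide hx j m)
  · exact h

theorem normal_eq_neg {i j : Fin f} (hij : j ≠ i) {x : S2} {w n w' n' : E3}
    (h : IsFrame (x : E3) w n) (h' : IsFrame (x : E3) w' n')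
    (hi : Inward (T.tile i).region x n) (hj : Inward (T.tile j).region x n') : n' = -n := by
  by_contra hne
  obtain ⟨y, ⟨hy1, hy2⟩, h1, h2⟩ := h.exists_pos_pos h' hne (hi.and hj)
  exact disjoint_left.mp (T.disjoint_interior i j hij.symm) (hy1.1 h1) (hy2.1 h2)

theorem exists_frame_inward {i : Fin f} {k : Fin 4} {x : S2} (hx : x ∈ (T.tile i).openSide k) :
    ∃ w n, IsFrame (x : E3) w n ∧ Inward (T.tile i).region x n := by
  obtain ⟨v, n, h⟩ := (T.tile i).exists_isSideFrame k
  obtain ⟨w, hw⟩ := h.exists_frame_at hx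
  exact ⟨w, n, hw, h.inward x hx⟩

/-- At most two tiles meet at an inner point of a side. -/
theorem eq_of_mem_openSide {i j j' : Fin f} {k : Fin 4} {x : S2} (hx : x ∈ (T.tile i).openSide k)
    (hj : x ∈ (T.tile j).region) (hj' : x ∈ (T.tile j').region) (hji : j ≠ i) (hji' : j' ≠ i) :
    j = j' := by
  by_contra hne
  obtain ⟨m, hm⟩ := T.mem_openSide_of_mem_region hx hj
  obtain ⟨m', hm'⟩ := T.mem_openSide_of_mem_region hx hj'
  obtain ⟨w, n, h1, h2⟩ := T.exists_frame_inward hx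
  obtain ⟨w1, n1, h3, h4⟩ := T.exists_frame_inward hm
  obtain ⟨w2, n2, h5, h6⟩ := T.exists_frame_inward hm'
  have e1 := T.normal_eq_neg hji h1 h3 h2 h4
  have e2 := T.normal_eq_neg hji' h1 h5 h2 h6
  have e3 := T.normal_eq_neg hne h5 h3 h6 h4
  rw [e1, e2, neg_neg] at e3
  have : n = 0 := by
    have h7 : (2 : ℝ) • n = 0 := by rw [two_smul]; nth_rw 1 [← e3]; simp
    simpa using h7
  have h8 := h1.norm_n
  rw [this, norm_zero] at h8
  exact zero_ne_one h8

theorem eventually_mem_region (x : S2) : ∀ᶠ y in 𝓝 x, ∀ j, y ∈ (T.tile j).region →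
    x ∈ (T.tile j).region := by
  rw [eventually_all]
  intro j
  by_cases hx : x ∈ (T.tile j).region
  · exact Eventually.of_forall fun y _ => hx
  · filter_upwards [(T.tile j).isClosed_region.isOpen_compl.mem_nhds hx] with y hy hy'
    exact absurd hy' hy

theorem exists_mem_region (x : S2) : ∃ i, x ∈ (T.tile i).region := by
  have : x ∈ ⋃ i, (T.tile i).region := by rw [T.cover]; trivial
  exact mem_iUnion.mp this

theorem exists_other {i : Fin f} {k : Fin 4} {x : S2} (hx : x ∈ (T.tile i).openSide k) :
    ∃ j, j ≠ i ∧ x ∈ (T.tile j).region := by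
  obtain ⟨w, n, h1, h2⟩ := T.exists_frame_inward hx
  obtain ⟨y, ⟨hy1, hy2⟩, hy⟩ := h1.neg.exists_pos (h2.and (T.eventually_mem_region x))
  obtain ⟨j, hj⟩ := T.exists_mem_region y
  refine ⟨j, ?_, hy2 j hj⟩
  rintro rfl
  rw [inner_neg_left] at hy
  exact hy1.2 (by linarith) hj

/-- An open side of a tile is contained in an open side of one other tile: by connectedness, since
at each of its points there is exactly one other tile. -/
theorem exists_openSide_subset (i : Fin f) (k : Fin 4) :
    ∃ j m, j ≠ i ∧ (T.tile i).openSide k ⊆ (T.tile j).openSide m := by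
  have hmem : ∀ x ∈ (T.tile i).openSide k, ∃ j m, j ≠ i ∧ x ∈ (T.tile j).openSide m := by
    intro x hx
    obtain ⟨j, hji, hj⟩ := T.exists_other hx
    obtain ⟨m, hm⟩ := T.mem_openSide_of_mem_region hx hj
    exact ⟨j, m, hji, hm⟩
  have huniq : ∀ x ∈ (T.tile i).openSide k, ∀ j m j' m', j ≠ i → x ∈ (T.tile j).openSide m →
      j' ≠ i → x ∈ (T.tile j').side m' → j' = j ∧ m' = m := by
    intro x hx j m j' m' hj hm hj' hm'
    have h1 := T.eq_of_mem_openSide hx ((T.tile j').side_subset_region _ hm')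
      ((T.tile j).side_subset_region _ hm.1) hj' hj
    subst h1
    refine ⟨rfl, ?_⟩
    by_contra hne
    exact (T.tile j').notMem_side_of_mem_openSide hne hm hm'
  obtain ⟨⟨⟨j, m⟩, hji⟩, hm⟩ := ((T.tile i).isPreconnected_openSide k).subset_of_finite_closed_cover
    ((T.tile i).openSide_nonempty k)
    (fun p : {p : Fin f × Fin 4 // p.1 ≠ i} => (T.tile p.1.1).side p.1.2)
    (fun p => (T.tile p.1.1).isClosed_side p.1.2)
    (fun x hx => by
      obtain ⟨j, m, hji, hm⟩ := hmem x hx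
      exact mem_iUnion.mpr ⟨⟨(j, m), hji⟩, hm.1⟩)
    (fun p q hpq x hx hp hq => by
      obtain ⟨j, m, hji, hm⟩ := hmem x hx
      have h1 := huniq x hx j m _ _ hji hm p.2 hp
      have h2 := huniq x hx j m _ _ hji hm q.2 hq
      exact hpq (Subtype.ext (Prod.ext (h1.1.trans h2.1.symm) (h1.2.trans h2.2.symm))))
  refine ⟨j, m, hji, fun x hx => ?_⟩
  obtain ⟨j', m', hji', hm'⟩ := hmem x hx
  obtain ⟨rfl, rfl⟩ := huniq x hx j' m' j m hji' hm' hji (hm hx)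
  exact hm'

theorem exists_openSide_eq (i : Fin f) (k : Fin 4) :
    ∃ j m, j ≠ i ∧ (T.tile i).openSide k = (T.tile j).openSide m := by
  obtain ⟨j, m, hji, h1⟩ := T.exists_openSide_subset i k
  obtain ⟨i', k', hij, h2⟩ := T.exists_openSide_subset j m
  obtain ⟨x, hx⟩ := (T.tile i).openSide_nonempty k
  have h3 : i' = i := T.eq_of_mem_openSide (h1 hx) ((T.tile i').side_subset_region _ (h2 (h1 hx)).1)
    ((T.tile i).side_subset_region _ hx.1) hij hji.symm
  subst h3
  have h4 : k' = k := by
    by_contra hne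
    exact (T.tile i').notMem_side_of_mem_openSide hne hx (h2 (h1 hx)).1
  subst h4
  exact ⟨j, m, hji, h1.antisymm h2⟩

/-- The flag `y` lies across the side of the flag `x`, at the same vertex. -/
structure IsNbr (x y : Fin f × Fl) : Prop where
  ne : y.1 ≠ x.1
  openSide_eq : (T.tile x.1).openSide x.2.side = (T.tile y.1).openSide y.2.side
  corner_eq : (T.tile x.1).corner x.2.corner = (T.tile y.1).corner y.2.corner
  corner_r0_eq : (T.tile x.1).corner x.2.r0.corner = (T.tile y.1).corner y.2.r0.corner

theorem _root_.SphereTiling.Quad.side_diff_openSide (Q : Quad) (k : Fin 4) :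
    Q.side k \ Q.openSide k = {Q.corner k, Q.corner (k + 1)} := by
  rw [Quad.openSide, sdiff_sdiff_right_self]
  refine inter_eq_right.mpr ?_
  rintro x (rfl | rfl)
  · exact Q.corner_mem_side k
  · exact Q.corner_succ_mem_side k

theorem _root_.SphereTiling.Quad.flag_ends (Q : Quad) (a : Fl) :
    Q.side a.side \ Q.openSide a.side = {Q.corner a.corner, Q.corner a.r0.corner} := by
  rw [Q.side_diff_openSide]
  rcases a.corner_cases with ⟨h1, h2⟩ | ⟨h1, h2⟩
  · rw [h1, h2]
  · rw [h1, h2, pair_comm]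

theorem exists_isNbr (x : Fin f × Fl) : ∃ y, T.IsNbr x y := by
  obtain ⟨i, a⟩ := x
  obtain ⟨j, m, hji, h1⟩ := T.exists_openSide_eq i a.side
  obtain ⟨b, rfl, -⟩ := Fl.exists_of_side_corner m m (Or.inl rfl)
  have h2 : ({(T.tile i).corner a.corner, (T.tile i).corner a.r0.corner} : Set S2) =
      {(T.tile j).corner b.corner, (T.tile j).corner b.r0.corner} := by
    rw [← Quad.flag_ends, ← Quad.flag_ends, ← Quad.closure_openSide, h1, Quad.closure_openSide]
  rcases pair_eq_pair_iff.mp h2 with ⟨h3, h4⟩ | ⟨h3, h4⟩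
  · exact ⟨(j, b), hji, h1, h3, h4⟩
  · exact ⟨(j, b.r0), hji, by rw [Fl.side_r0]; exact h1, h3, by rw [Fl.r0_r0]; exact h4⟩

variable {T}

theorem IsNbr.symm {x y : Fin f × Fl} (h : T.IsNbr x y) : T.IsNbr y x :=
  ⟨h.ne.symm, h.openSide_eq.symm, h.corner_eq.symm, h.corner_r0_eq.symm⟩

theorem IsNbr.unique {x y z : Fin f × Fl} (h : T.IsNbr x y) (h' : T.IsNbr x z) : y = z := by
  obtain ⟨p, hp⟩ := (T.tile x.1).openSide_nonempty x.2.side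
  have hy := h.openSide_eq ▸ hp
  have hz := h'.openSide_eq ▸ hp
  have h1 : y.1 = z.1 := T.eq_of_mem_openSide hp ((T.tile _).side_subset_region _ hy.1)
    ((T.tile _).side_subset_region _ hz.1) h.ne h'.ne
  obtain ⟨j, b⟩ := y
  obtain ⟨j', c⟩ := z
  obtain rfl : j = j' := h1
  have h2 : b.side = c.side := by
    by_contra hne
    exact (T.tile j).notMem_side_of_mem_openSide hne hz hy.1
  have h3 : b.corner = c.corner :=
    (T.tile j).corner_injective (h.corner_eq.symm.trans h'.corner_eq)
  rw [Fl.eq_of_corner_side b c h3 h2]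

variable (T)

/-- The flag across the side of a flag, at the same vertex. -/
noncomputable def nbr (x : Fin f × Fl) : Fin f × Fl := (T.exists_isNbr x).choose

theorem isNbr_nbr (x : Fin f × Fl) : T.IsNbr x (T.nbr x) := (T.exists_isNbr x).choose_spec

theorem nbr_eq {x y : Fin f × Fl} (h : T.IsNbr x y) : T.nbr x = y := (T.isNbr_nbr x).unique h

@[simp] theorem nbr_nbr (x : Fin f × Fl) : T.nbr (T.nbr x) = x := T.nbr_eq (T.isNbr_nbr x).symm

theorem nbr_r0 (i : Fin f) (a : Fl) :
    T.nbr (i, a.r0) = ((T.nbr (i, a)).1, (T.nbr (i, a)).2.r0) := by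
  apply T.nbr_eq
  obtain ⟨h1, h2, h3, h4⟩ := T.isNbr_nbr (i, a)
  refine ⟨h1, ?_, h4, ?_⟩
  · simpa using h2
  · simpa using h3

theorem nbr_fst_ne (x : Fin f × Fl) : (T.nbr x).1 ≠ x.1 := (T.isNbr_nbr x).ne

/-- The vertex of a flag. -/
def vtx (x : Fin f × Fl) : S2 := (T.tile x.1).corner x.2.corner

@[simp] theorem vtx_nbr (x : Fin f × Fl) : T.vtx (T.nbr x) = T.vtx x :=
  (T.isNbr_nbr x).corner_eq.symm

/-- Neighbouring tiles lie on opposite sides of their common side. -/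
theorem frame_nbr {x : Fin f × Fl} {v n : E3} (h : (T.tile x.1).IsFlagFrame x.2 v n) :
    (T.tile (T.nbr x).1).IsFlagFrame (T.nbr x).2 v (-n) ∧
      (T.tile x.1).len x.2.side = (T.tile (T.nbr x).1).len (T.nbr x).2.side := by
  obtain ⟨h1, h2, h3, h4⟩ := T.isNbr_nbr x
  obtain ⟨v', n', h'⟩ := (T.tile (T.nbr x).1).exists_isFlagFrame (T.nbr x).2
  have hF := h'.frame
  have hot := h'.other
  have hop := h'.openSide_eq
  rw [← h3] at hF hot hop
  rw [← h4] at hot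
  rw [← h2] at hop
  obtain ⟨e1, e2⟩ := h.frame.arc_unique hF ((T.tile _).len_pos _) ((T.tile _).len_lt _)
    ((T.tile _).len_pos _) ((T.tile _).len_lt _) (by rw [← h.openSide_eq, ← hop])
    (by rw [← h.other, ← hot])
  subst e1
  refine ⟨?_, e2⟩
  obtain ⟨p, hp⟩ := (T.tile x.1).openSide_nonempty x.2.side
  have hp' := h2 ▸ hp
  obtain ⟨w, hw⟩ := h.exists_frame_at hp
  obtain ⟨w', hw'⟩ := h'.exists_frame_at hp'
  have := T.normal_eq_neg h1 hw hw' (h.inward p hp) (h'.inward p hp')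
  rwa [← this]

end Tiling

namespace Tiling

variable {f : ℕ} (T : Tiling f)

/-! ### Connectedness -/

/-- The other flag of the same tile at the same vertex. -/
def fl1 (x : Fin f × Fl) : Fin f × Fl := (x.1, x.2.r1)

@[simp] theorem fl1_fl1 (x : Fin f × Fl) : fl1 (fl1 x) = x := by simp [fl1]

theorem fl1_ne (x : Fin f × Fl) : fl1 x ≠ x := fun h => x.2.r1_ne (congrArg Prod.snd h)

@[simp] theorem vtx_fl1 (x : Fin f × Fl) : T.vtx (fl1 x) = T.vtx x := by simp [vtx, fl1]

theorem exists_mem_interior_near (i : Fin f) (k : Fin 4) {P : S2 → Prop}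
    (hP : ∀ᶠ y in 𝓝 ((T.tile i).corner k), P y) :
    ∃ y, P y ∧ y ∈ interior (T.tile i).region ∧ y ≠ (T.tile i).corner k := by
  have h1 := (T.tile i).region_subset_closure_interior ((T.tile i).corner_mem_region k)
  obtain ⟨y, hy1, hy2⟩ := mem_closure_iff_nhds.mp h1 _ hP
  refine ⟨y, hy1, hy2, ?_⟩
  rintro rfl
  exact ((T.tile i).side_subset_frontier k ((T.tile i).corner_mem_side k)).2 hy2

/-- If the tiles of the family `J` include all the tiles through `x`, then their union is a
neighbourhood of `x`. -/
theorem iUnion_mem_nhds {J : Set (Fin f)} {x : S2} (h : ∀ j, x ∈ (T.tile j).region → j ∈ J) :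
    (⋃ j ∈ J, (T.tile j).region) ∈ 𝓝 x := by
  filter_upwards [T.eventually_mem_region x] with y hy
  obtain ⟨j, hj⟩ := T.exists_mem_region y
  exact mem_biUnion (h j (hy j hj)) hj

theorem isClosed_iUnion (J : Set (Fin f)) : IsClosed (⋃ j ∈ J, (T.tile j).region) :=
  (Set.toFinite J).isClosed_biUnion fun j _ => (T.tile j).isClosed_region

theorem mem_of_mem_openSide {J : Set (Fin f)} {j : Fin f} (hj : j ∈ J) {k : Fin 4} {x : S2}
    (hx : x ∈ (T.tile j).openSide k) {a : Fl} (ha : a.side = k) (hn : (T.nbr (j, a)).1 ∈ J)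
    (m : Fin f) (hm : x ∈ (T.tile m).region) : m ∈ J := by
  by_cases hmj : m = j
  · rwa [hmj]
  · have h1 := (T.isNbr_nbr (j, a)).openSide_eq
    have h2 : x ∈ (T.tile (T.nbr (j, a)).1).region := by
      apply (T.tile _).side_subset_region (T.nbr (j, a)).2.side
      have : x ∈ (T.tile (j, a).1).openSide (j, a).2.side := by rw [ha]; exact hx
      rw [h1] at this
      exact this.1
    have := T.eq_of_mem_openSide hx hm h2 hmj (T.nbr_fst_ne _)
    rwa [this]

/-- The flags at a vertex form one orbit under the passages to the other side of the same tile and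
to the other tile at the same side: a small punctured cap around the vertex is connected, and the
part covered by the tiles of one orbit is open and closed in it. -/
theorem mem_of_vtx_eq {O : Set (Fin f × Fl)} (h1 : ∀ x ∈ O, fl1 x ∈ O) (h2 : ∀ x ∈ O, T.nbr x ∈ O)
    {x y : Fin f × Fl} (hx : x ∈ O) (hxy : T.vtx y = T.vtx x) : y ∈ O := by
  set q := T.vtx x with hq
  let J : Set (Fin f) := {j | ∃ a, (j, a) ∈ O ∧ T.vtx (j, a) = q}
  have hJ : ∀ j ∈ J, ∀ a, T.vtx (j, a) = q → (j, a) ∈ O := by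
    rintro j ⟨a, ha, hv⟩ b hb
    have hc : a.corner = b.corner := (T.tile j).corner_injective (hv.trans hb.symm)
    rcases Fl.eq_or_r1_of_corner a b hc with rfl | rfl
    · exact ha
    · exact h1 _ ha
  -- near `q` only those sides and corners occur that contain `q`
  have hev : ∀ᶠ z in 𝓝 q, ∀ j k, (z ∈ (T.tile j).side k → q ∈ (T.tile j).side k) ∧
      (z = (T.tile j).corner k → q = (T.tile j).corner k) := by
    rw [eventually_all]; intro j
    rw [eventually_all]; intro k
    refine Eventually.and ?_ ?_
    · by_cases hc : q ∈ (T.tile j).side k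
      · exact Eventually.of_forall fun z _ => hc
      · filter_upwards [((T.tile j).isClosed_side k).isOpen_compl.mem_nhds hc] with z hz hz'
        exact absurd hz' hz
    · by_cases hc : q = (T.tile j).corner k
      · exact Eventually.of_forall fun z _ => hc
      · filter_upwards [isOpen_ne.mem_nhds hc] with z hz hz'
        exact absurd hz' hz
  obtain ⟨c, hc0, hc1, hc⟩ := exists_cap_subset hev
  obtain ⟨v, n, hfr⟩ := (T.tile x.1).exists_isFlagFrame x.2
  have hpre : IsPreconnected (cap (q : E3) c \ {z | (z : E3) = q}) :=
    hfr.frame.isPreconnected_puncturedCap hc0.le hc1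
  have hcapq : ∀ᶠ z in 𝓝 q, z ∈ cap (q : E3) c := (isOpen_cap _ _).mem_nhds (mem_cap_self q hc1)
  have hsub : cap (q : E3) c \ {z | (z : E3) = q} ⊆ ⋃ j ∈ J, (T.tile j).region := by
    refine hpre.subset_of_mem_nhds ?_ (T.isClosed_iUnion J) ?_
    · obtain ⟨z, hz1, hz2, hz3⟩ := T.exists_mem_interior_near x.1 x.2.corner hcapq
      refine ⟨z, ⟨hz1, fun h => hz3 (Subtype.ext h)⟩, ?_⟩
      exact mem_biUnion (show x.1 ∈ J from ⟨x.2, hx, rfl⟩) (interior_subset hz2)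
    · rintro z ⟨hz1, hz2⟩ hz3
      simp only [mem_iUnion] at hz3
      obtain ⟨j, hj, hzj⟩ := hz3
      rcases (T.tile j).mem_region_cases hzj with h | ⟨k, hk⟩ | ⟨k, hk⟩
      · refine mem_of_superset (mem_interior_iff_mem_nhds.mp h) ?_
        exact subset_biUnion_of_mem (u := fun j => (T.tile j).region) hj
      · exact absurd (congrArg Subtype.val (hk.trans ((hc hz1 j k).2 hk).symm)) hz2
      · have h3 := (hc hz1 j k).1 hk.1
        obtain ⟨b, hb, hvb⟩ := hj
        have hcb : q = (T.tile j).corner b.corner := hvb.symm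
        rw [hcb, (T.tile j).corner_mem_side_iff] at h3
        obtain ⟨a, ha1, ha2⟩ := Fl.exists_of_side_corner k b.corner h3
        have hva : T.vtx (j, a) = q := by rw [hcb, ← ha2]; rfl
        have ha := hJ j ⟨b, hb, hvb⟩ a hva
        have hn : (T.nbr (j, a)).1 ∈ J := ⟨(T.nbr (j, a)).2, h2 _ ha, by
          change T.vtx (T.nbr (j, a)) = q
          rw [vtx_nbr, hva]⟩
        apply T.iUnion_mem_nhds
        exact T.mem_of_mem_openSide (show j ∈ J from ⟨b, hb, hvb⟩) hk ha1 hn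
  obtain ⟨z, hz1, hz2, hz3⟩ := T.exists_mem_interior_near y.1 y.2.corner (P := (· ∈ cap (q : E3) c))
    (by change ∀ᶠ z in 𝓝 (T.vtx y), _; rw [hxy]; exact hcapq)
  have hzq : z ≠ q := by rw [← hxy]; exact hz3
  have h3 := hsub ⟨hz1, fun h => hzq (Subtype.ext h)⟩
  simp only [mem_iUnion] at h3
  obtain ⟨j, hj, hzj⟩ := h3
  have := T.eq_of_mem_interior hz2 hzj
  exact hJ y.1 (this ▸ hj) y.2 hxy

/-- A nonempty family of tiles that contains all the neighbours of its members contains all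
tiles. -/
theorem eq_univ_of_nbr {J : Set (Fin f)} (hne : J.Nonempty)
    (h : ∀ j ∈ J, ∀ a, (T.nbr (j, a)).1 ∈ J) (i : Fin f) : i ∈ J := by
  have hsub : (univ : Set S2) ⊆ ⋃ j ∈ J, (T.tile j).region := by
    refine isPreconnected_univ_S2.subset_of_mem_nhds ?_ (T.isClosed_iUnion J) ?_
    · obtain ⟨j, hj⟩ := hne
      exact ⟨_, mem_univ _, mem_biUnion hj ((T.tile j).corner_mem_region 0)⟩
    · rintro z - hz
      simp only [mem_iUnion] at hz
      obtain ⟨j, hj, hzj⟩ := hz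
      rcases (T.tile j).mem_region_cases hzj with h3 | ⟨k, hk⟩ | ⟨k, hk⟩
      · refine mem_of_superset (mem_interior_iff_mem_nhds.mp h3) ?_
        exact subset_biUnion_of_mem (u := fun j => (T.tile j).region) hj
      · apply T.iUnion_mem_nhds
        intro m hm
        rw [hk] at hm
        obtain ⟨l, hl⟩ := T.edge_to_edge j m k hm
        obtain ⟨a, rfl⟩ := Fl.exists_corner k
        obtain ⟨b, rfl⟩ := Fl.exists_corner l
        exact T.mem_of_vtx_eq (O := {x | x.1 ∈ J}) (fun x hx => hx) (fun x hx => h x.1 hx x.2)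
          (x := (j, a)) (y := (m, b)) hj hl.symm
      · apply T.iUnion_mem_nhds
        obtain ⟨a, ha, -⟩ := Fl.exists_of_side_corner k k (Or.inl rfl)
        exact T.mem_of_mem_openSide hj hk ha (h j hj a)
  obtain ⟨z, hz⟩ := (T.tile i).isConnected_interior.nonempty
  have h3 := hsub (mem_univ z)
  simp only [mem_iUnion] at h3
  obtain ⟨j, hj, hzj⟩ := h3
  rwa [T.eq_of_mem_interior hz hzj]

/-! ### The tiles around a vertex -/

/-- The passage to the next tile around the vertex of a flag. -/
noncomputable def turn (x : Fin f × Fl) : Fin f × Fl := fl1 (T.nbr x)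

theorem nbr_eq_fl1_turn (x : Fin f × Fl) : T.nbr x = fl1 (T.turn x) := by simp [turn]

theorem nbr_fl1_turn (x : Fin f × Fl) : T.nbr (fl1 (T.turn x)) = x := by simp [turn]

theorem turn_injective : Function.Injective T.turn := by
  intro x y h
  rw [← T.nbr_fl1_turn x, h, T.nbr_fl1_turn]

@[simp] theorem vtx_turn (x : Fin f × Fl) : T.vtx (T.turn x) = T.vtx x := by simp [turn]

theorem vtx_iterate_turn (x : Fin f × Fl) (m : ℕ) : T.vtx (T.turn^[m] x) = T.vtx x := by
  induction m with
  | zero => rfl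
  | succ m ih => rw [Function.iterate_succ_apply', vtx_turn, ih]

/-- Going around a vertex never reverses the sense of rotation. -/
theorem iterate_turn_ne_fl1 (m : ℕ) : ∀ x, T.turn^[m] x ≠ fl1 x := by
  induction m using Nat.twoStepInduction with
  | zero => intro x h; exact fl1_ne x h.symm
  | one =>
    intro x h
    have h1 : T.nbr x = x := by
      have := congrArg fl1 h
      simpa [turn] using this
    exact T.nbr_fst_ne x (congrArg Prod.fst h1)
  | more m ih _ =>
    intro x h
    rw [Function.iterate_succ_apply, Function.iterate_succ_apply'] at h
    have h1 : T.turn^[m] (T.turn x) = T.nbr x := by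
      rw [← T.nbr_fl1_turn (T.turn^[m] (T.turn x)), h, fl1_fl1]
    rw [T.nbr_eq_fl1_turn] at h1
    exact ih _ h1

/-- The degree of the vertex of a flag. -/
noncomputable def deg (x : Fin f × Fl) : ℕ := Function.minimalPeriod T.turn x

theorem deg_pos (x : Fin f × Fl) : 0 < T.deg x := by
  apply Function.minimalPeriod_pos_of_mem_periodicPts
  have := (Finite.injective_iff_bijective.mp T.turn_injective)
  exact T.turn_injective.mem_periodicPts x

theorem iterate_turn_deg (x : Fin f × Fl) : T.turn^[T.deg x] x = x :=
  Function.iterate_minimalPeriod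

theorem iterate_turn_inj {x : Fin f × Fl} {m m' : ℕ} (hm : m < T.deg x) (hm' : m' < T.deg x)
    (h1 : (T.turn^[m] x).1 = (T.turn^[m'] x).1) : m = m' := by
  have h2 : (T.turn^[m] x).2.corner = (T.turn^[m'] x).2.corner := by
    have h3 : T.vtx (T.turn^[m] x) = T.vtx (T.turn^[m'] x) := by
      rw [vtx_iterate_turn, vtx_iterate_turn]
    simp only [vtx, h1] at h3
    exact (T.tile _).corner_injective h3
  rcases Fl.eq_or_r1_of_corner _ _ h2 with h3 | h3
  · have h4 : T.turn^[m] x = T.turn^[m'] x := Prod.ext h1 h3.symm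
    exact (Function.iterate_injOn_Iio_minimalPeriod (f := T.turn) hm hm' h4)
  · exfalso
    have h4 : T.turn^[m'] x = fl1 (T.turn^[m] x) := Prod.ext h1.symm h3
    rcases le_total m m' with h5 | h5
    · obtain ⟨s, rfl⟩ := Nat.exists_eq_add_of_le h5
      rw [add_comm, Function.iterate_add_apply] at h4
      exact T.iterate_turn_ne_fl1 s _ h4
    · obtain ⟨s, rfl⟩ := Nat.exists_eq_add_of_le h5
      rw [add_comm, Function.iterate_add_apply] at h4
      have h6 := congrArg fl1 h4
      rw [fl1_fl1] at h6
      exact T.iterate_turn_ne_fl1 s _ h6.symm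

theorem exists_iterate_turn {x y : Fin f × Fl} (h : T.vtx y = T.vtx x) :
    ∃ m < T.deg x, T.turn^[m] x = y ∨ T.turn^[m] x = fl1 y := by
  have hmod : ∀ m, T.turn^[m] x = T.turn^[m % T.deg x] x := fun m =>
    (Function.iterate_mod_minimalPeriod_eq).symm
  have key : y ∈ {z | ∃ m, T.turn^[m] x = z ∨ T.turn^[m] x = fl1 z} := by
    refine T.mem_of_vtx_eq (x := x) ?_ ?_ (show ∃ m, _ from ⟨0, Or.inl rfl⟩) h
    · rintro z ⟨m, hz | hz⟩
      · exact ⟨m, Or.inr (by rw [fl1_fl1, hz])⟩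
      · exact ⟨m, Or.inl hz⟩
    · rintro z ⟨m, hz | hz⟩
      · refine ⟨m + 1, Or.inr ?_⟩
        rw [Function.iterate_succ_apply', hz]; rfl
      · -- one step backwards, through the last step of the full turn if `m = 0`
        have h1 : ∃ s, T.turn^[s + 1] x = fl1 z := by
          cases m with
          | zero =>
            refine ⟨T.deg x - 1, ?_⟩
            rw [Nat.sub_add_cancel (T.deg_pos x), iterate_turn_deg]; exact hz
          | succ m => exact ⟨m, hz⟩
        obtain ⟨s, hs⟩ := h1
        rw [Function.iterate_succ_apply'] at hs
        refine ⟨s, Or.inl ?_⟩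
        rw [← T.nbr_fl1_turn (T.turn^[s] x), hs, fl1_fl1]
  obtain ⟨m, hm⟩ := key
  exact ⟨m % T.deg x, Nat.mod_lt _ (T.deg_pos x), by rwa [← hmod]⟩

/-- Each corner at a vertex is met exactly once on going around the vertex. -/
theorem card_filter_corner (x : Fin f × Fl) (k : Fin 4) :
    ((Finset.range (T.deg x)).filter fun m => (T.turn^[m] x).2.corner = k).card =
      T.vertexType (T.vtx x) k := by
  rw [vertexType, ← Set.ncard_coe_finset]
  refine Set.ncard_congr (fun m _ => (T.turn^[m] x).1) ?_ ?_ ?_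
  · intro m hm
    simp only [Finset.coe_filter, Finset.mem_range, mem_ofPred_eq] at hm
    change (T.tile (T.turn^[m] x).1).corner k = T.vtx x
    rw [← hm.2]
    exact T.vtx_iterate_turn x m
  · intro m m' hm hm' h
    simp only [Finset.coe_filter, Finset.mem_range, mem_ofPred_eq] at hm hm'
    exact T.iterate_turn_inj hm.1 hm'.1 h
  · intro i hi
    obtain ⟨a, rfl⟩ := Fl.exists_corner k
    obtain ⟨m, hm, h⟩ := T.exists_iterate_turn (x := x) (y := (i, a)) hi
    refine ⟨m, ?_, ?_⟩
    · simp only [Finset.coe_filter, Finset.mem_range, mem_ofPred_eq]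
      refine ⟨hm, ?_⟩
      rcases h with h | h <;> simp [h, fl1]
    · rcases h with h | h <;> simp [h, fl1]

theorem deg_eq (x : Fin f × Fl) : T.deg x = ∑ k, T.vertexType (T.vtx x) k := by
  simp_rw [← card_filter_corner]
  rw [← Finset.card_eq_sum_card_fiberwise (fun _ _ => Finset.mem_coe.mpr (Finset.mem_univ _)),
    Finset.card_range]

theorem three_le_deg (x : Fin f × Fl) : 3 ≤ T.deg x := by
  refine (T.three_le_degree x.1 x.2.corner).trans ?_
  rw [← Finset.card_range (T.deg x), ← Set.ncard_coe_finset]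
  have hsub : {p : Fin f × Fin 4 | (T.tile p.1).corner p.2 = (T.tile x.1).corner x.2.corner} ⊆
      (fun m => ((T.turn^[m] x).1, (T.turn^[m] x).2.corner)) ''
        (Finset.range (T.deg x) : Set ℕ) := by
    rintro ⟨i, k⟩ hi
    obtain ⟨a, rfl⟩ := Fl.exists_corner k
    obtain ⟨m, hm, h⟩ := T.exists_iterate_turn (x := x) (y := (i, a)) hi
    refine ⟨m, by simpa using hm, ?_⟩
    rcases h with h | h <;> simp [h, fl1]
  exact (Set.ncard_le_ncard hsub (Set.toFinite _)).trans (Set.ncard_image_le (Set.toFinite _))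

theorem vertexType_mem_avc (x : Fin f × Fl) : T.vertexType (T.vtx x) ∈ T.avc :=
  ⟨_, ⟨x.1, x.2.corner, rfl⟩, rfl⟩

theorem exists_flag_of_mem_avc {t : Fin 4 → ℕ} (h : t ∈ T.avc) :
    ∃ x : Fin f × Fl, T.vertexType (T.vtx x) = t := by
  obtain ⟨_, ⟨i, k, rfl⟩, rfl⟩ := h
  obtain ⟨a, rfl⟩ := Fl.exists_corner k
  exact ⟨(i, a), rfl⟩

theorem exists_flag_corner {x : Fin f × Fl} (a : Fl) (h : 0 < T.vertexType (T.vtx x) a.corner) :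
    ∃ i, T.vtx (i, a) = T.vtx x := by
  obtain ⟨i, hi⟩ := Set.nonempty_of_ncard_ne_zero (h.ne')
  exact ⟨i, hi⟩

theorem vertexType_pos (x : Fin f × Fl) : 0 < T.vertexType (T.vtx x) x.2.corner := by
  rw [vertexType, Set.ncard_pos]
  exact ⟨x.1, rfl⟩

theorem cls_nbr (x : Fin f × Fl) : (T.nbr x).2.cls = x.2.cls := by
  obtain ⟨v, n, h⟩ := (T.tile x.1).exists_isFlagFrame x.2
  have h1 := (T.frame_nbr h).2
  rw [T.len_eq, T.len_eq] at h1
  have hab := T.a_ne_b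
  have hac := T.a_ne_c
  have hbc := T.b_ne_c
  revert h1
  generalize (T.nbr x).2 = b
  generalize x.2 = a
  cases a <;> cases b <;>
    simp [Fl.side, Fl.cls, hab, hac, hbc, hab.symm, hac.symm, hbc.symm]

/-! ### Symmetries -/

/-- The isometry `g` maps the tile `i` to the tile `j`, with marked corners. -/
def Maps (g : O3) (i j : Fin f) : Prop := Quad.Maps g (T.tile i) (T.tile j)

theorem exists_maps (i j : Fin f) : ∃ g, T.Maps g i j := T.congruent i j

variable {T}

theorem Maps.unique {g h : O3} {i j : Fin f} (hg : T.Maps g i j) (hh : T.Maps h i j) : g = h := by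
  obtain ⟨v, n, hF⟩ := (T.tile i).exists_isFlagFrame Fl.a0
  obtain ⟨h1, h2⟩ := (hF.map hg).unique (hF.map hh)
  refine hF.frame.ext_iso ?_ h1 h2
  exact congrArg Subtype.val ((hg.2 _).trans (hh.2 _).symm)

theorem Maps.mul {g h : O3} {i j k : Fin f} (hg : T.Maps g j k) (hh : T.Maps h i j) :
    T.Maps (g * h) i k := Quad.Maps.mul hg hh

theorem Maps.inv {g : O3} {i j : Fin f} (hg : T.Maps g i j) : T.Maps g⁻¹ j i := Quad.Maps.inv hg

theorem maps_one (i : Fin f) : T.Maps 1 i i := Quad.maps_one _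

theorem Maps.eq_one {g : O3} {i : Fin f} (hg : T.Maps g i i) : g = 1 := hg.unique (maps_one i)

theorem Maps.target_unique {g : O3} {i j j' : Fin f} (hg : T.Maps g i j) (hg' : T.Maps g i j') :
    j = j' := by
  obtain ⟨z, hz⟩ := (T.tile j).isConnected_interior.nonempty
  refine T.eq_of_mem_interior hz ?_
  rw [← hg'.1, hg.1]
  exact interior_subset hz

theorem Maps.source_unique {g : O3} {i i' j : Fin f} (hg : T.Maps g i j) (hg' : T.Maps g i' j) :
    i = i' := hg.inv.target_unique hg'.inv

/-- If an isometry maps the tile `i` to the tile `j`, and the tiles across the corresponding sides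
are attached in the same way, then it also maps the first of these to the second. -/
theorem Maps.nbr {g : O3} {i j : Fin f} (hg : T.Maps g i j) {a : Fl}
    (h : (T.nbr (i, a)).2 = (T.nbr (j, a)).2) : T.Maps g (T.nbr (i, a)).1 (T.nbr (j, a)).1 := by
  obtain ⟨k, hk⟩ := T.exists_maps (T.nbr (i, a)).1 (T.nbr (j, a)).1
  obtain ⟨v, n, hF⟩ := (T.tile i).exists_isFlagFrame a
  have h1 := (T.frame_nbr (x := (i, a)) hF).1
  have h2 := (T.frame_nbr (x := (j, a)) (hF.map hg)).1
  have h3 := h1.map hk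
  rw [h] at h3
  obtain ⟨e1, e2⟩ := h3.unique h2
  rw [map_neg, neg_inj] at e2
  have e3 : k ((T.tile i).corner a.corner : E3) = g ((T.tile i).corner a.corner : E3) := by
    have c1 : T.vtx (i, a) = T.vtx (T.nbr (i, a)) := (T.vtx_nbr _).symm
    have c2 : T.vtx (j, a) = T.vtx (T.nbr (j, a)) := (T.vtx_nbr _).symm
    have c3 : act k (T.vtx (T.nbr (i, a))) = T.vtx (T.nbr (j, a)) := by
      rw [vtx, vtx, ← h]; exact hk.2 _
    have c4 : act g (T.vtx (i, a)) = T.vtx (j, a) := hg.2 _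
    rw [← c1, ← c2, ← c4] at c3
    exact congrArg Subtype.val c3
  have : k = g := hF.frame.ext_iso e3 e1 e2
  rwa [← this]

theorem mem_symmetryGroup_of_maps {g : O3} (h : ∀ i, ∃ j, T.Maps g i j) : g ∈ T.symmetryGroup := by
  choose φ hφ using h
  have hinj : Function.Injective φ := fun i i' h => (hφ i).source_unique (h ▸ hφ i')
  have hsurj : Function.Surjective φ := Finite.surjective_of_injective hinj
  change _ '' T.cells = T.cells
  rw [cells, ← range_comp]
  have : (Prod.map (image (act g)) (image (act g)) ∘ fun i =>
      ((T.tile i).region, range (T.tile i).corner)) =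
      (fun i => ((T.tile i).region, range (T.tile i).corner)) ∘ φ := by
    funext i
    refine Prod.ext (hφ i).1 ?_
    change act g '' range (T.tile i).corner = range (T.tile (φ i)).corner
    rw [← range_comp]
    congr 1
    funext k
    exact (hφ i).2 k
  rw [this, hsurj.range_comp]

/-- A symmetry of the tiling respects the marking of the tiles, since the lengths `a, b, c` are
distinct. -/
theorem exists_maps_of_mem {g : O3} (h : g ∈ T.symmetryGroup) (i : Fin f) : ∃ j, T.Maps g i j := by
  have h1 : Prod.map (image (act g)) (image (act g)) '' T.cells = T.cells := h
  have h2 : Prod.map (image (act g)) (image (act g))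
      ((T.tile i).region, range (T.tile i).corner) ∈ T.cells := by
    rw [← h1]; exact mem_image_of_mem _ ⟨i, rfl⟩
  obtain ⟨j, hj⟩ := h2
  have hR : act g '' (T.tile i).region = (T.tile j).region := (congrArg Prod.fst hj).symm
  have hC : act g '' range (T.tile i).corner = range (T.tile j).corner :=
    (congrArg Prod.snd hj).symm
  have hex : ∀ k, ∃ m, act g ((T.tile i).corner k) = (T.tile j).corner m := by
    intro k
    have : act g ((T.tile i).corner k) ∈ range (T.tile j).corner := by
      rw [← hC]; exact mem_image_of_mem _ (mem_range_self k)
    obtain ⟨m, hm⟩ := this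
    exact ⟨m, hm.symm⟩
  choose σ hσ using hex
  have hinj : Function.Injective σ := by
    intro k k' hk
    apply (T.tile i).corner_injective
    apply act_injective g
    rw [hσ, hσ, hk]
  have hbij : Function.Bijective σ := Finite.injective_iff_bijective.mp hinj
  have key : ∀ k, ∃ m, (T.tile i).len k = (T.tile j).len m ∧
      ((σ k = m ∧ σ (k + 1) = m + 1) ∨ (σ k = m + 1 ∧ σ (k + 1) = m)) := by
    intro k
    obtain ⟨m, hm, hor⟩ := Quad.image_openSide hR hbij hσ k
    obtain ⟨v, n, hd⟩ := (T.tile i).exists_isSideDir k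
    obtain ⟨v', n', hd'⟩ := (T.tile j).exists_isSideDir m
    refine ⟨m, ?_, hor⟩
    rcases hor with ⟨e1, e2⟩ | ⟨e1, e2⟩
    · exact (arc_eq_of_map hm hd hd' (by rw [hσ, e1]) (by rw [hσ, e2])).2
    · exact (arc_eq_of_map_reverse hm hd hd' (by rw [hσ, e1]) (by rw [hσ, e2])).2
  have hab := T.a_ne_b
  have hac := T.a_ne_c
  have hbc := T.b_ne_c
  obtain ⟨m1, hl1, ho1⟩ := key 1
  obtain ⟨m2, hl2, ho2⟩ := key 2
  rw [T.len_eq, T.len_eq] at hl1 hl2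
  have hm1 : m1 = 1 := by
    fin_cases m1 <;> simp [hbc, hab.symm] at hl1 ⊢
  have hm2 : m2 = 2 := by
    fin_cases m2 <;> simp [hac.symm, hbc.symm] at hl2 ⊢
  subst hm1 hm2
  have hfin : ∀ s0 s1 s2 s3 : Fin 4, s0 ≠ s1 → s0 ≠ s2 → s0 ≠ s3 →
      ((s1 = 1 ∧ s2 = 1 + 1) ∨ (s1 = 1 + 1 ∧ s2 = 1)) →
      ((s2 = 2 ∧ s3 = 2 + 1) ∨ (s2 = 2 + 1 ∧ s3 = 2)) →
      s0 = 0 ∧ s1 = 1 ∧ s2 = 2 ∧ s3 = 3 := by decide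
  obtain ⟨e0, e1, e2, e3⟩ := hfin (σ 0) (σ 1) (σ 2) (σ 3) (hinj.ne (by decide))
    (hinj.ne (by decide)) (hinj.ne (by decide)) ho1 ho2
  refine ⟨j, hR, fun k => ?_⟩
  rw [hσ]
  congr 1
  fin_cases k
  · exact e0
  · exact e1
  · exact e2
  · exact e3

/-- Symmetries preserve the way in which tiles are attached. -/
theorem nbr_of_mem {g : O3} (h : g ∈ T.symmetryGroup) {i j : Fin f} (hg : T.Maps g i j) (a : Fl) :
    (T.nbr (j, a)).2 = (T.nbr (i, a)).2 ∧ T.Maps g (T.nbr (i, a)).1 (T.nbr (j, a)).1 := by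
  obtain ⟨j', hj'⟩ := exists_maps_of_mem h (T.nbr (i, a)).1
  obtain ⟨h1, h2, h3, h4⟩ := T.isNbr_nbr (i, a)
  have : T.IsNbr (j, a) (j', (T.nbr (i, a)).2) := by
    refine ⟨?_, ?_, ?_, ?_⟩
    · rintro rfl
      exact h1 (hj'.source_unique hg)
    · change (T.tile j).openSide a.side = (T.tile j').openSide _
      rw [← hg.image_openSide, ← hj'.image_openSide]
      exact congrArg _ h2
    · change (T.tile j).corner _ = (T.tile j').corner _
      rw [← hg.2, ← hj'.2]
      exact congrArg _ h3
    · change (T.tile j).corner _ = (T.tile j').corner _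
      rw [← hg.2, ← hj'.2]
      exact congrArg _ h4
  rw [T.nbr_eq this]
  exact ⟨rfl, hj'⟩

/-- If a relation between tiles is passed on to corresponding neighbours, and corresponding
neighbours of related tiles are attached in the same way, then the isometry between two related
tiles is a symmetry. -/
theorem mem_symmetryGroup_of_rel {R : Fin f → Fin f → Prop}
    (hR : ∀ i j, R i j → ∀ a, (T.nbr (i, a)).2 = (T.nbr (j, a)).2 ∧
      R (T.nbr (i, a)).1 (T.nbr (j, a)).1) {g : O3} {i j : Fin f} (hij : R i j)
    (hg : T.Maps g i j) : g ∈ T.symmetryGroup := by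
  apply mem_symmetryGroup_of_maps
  intro k
  obtain ⟨k', -, hk'⟩ := T.eq_univ_of_nbr (J := {k | ∃ k', R k k' ∧ T.Maps g k k'}) ⟨i, j, hij, hg⟩
    (by
      rintro k ⟨k', h1, h2⟩ a
      obtain ⟨h3, h4⟩ := hR k k' h1 a
      exact ⟨_, h4, h2.nbr h3⟩) k
  exact ⟨k', hk'⟩

theorem vertexType_act {g : O3} (h : g ∈ T.symmetryGroup) (v : S2) :
    T.vertexType (act g v) = T.vertexType v := by
  choose φ hφ using exists_maps_of_mem h
  have hinj : Function.Injective φ := fun i i' h => (hφ i).source_unique (h ▸ hφ i')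
  have hsurj : Function.Surjective φ := Finite.surjective_of_injective hinj
  funext k
  rw [vertexType, vertexType]
  conv_rhs => rw [← Set.ncard_image_of_injective _ hinj]
  congr 1
  ext j
  constructor
  · intro hj
    obtain ⟨i, rfl⟩ := hsurj j
    refine ⟨i, ?_, rfl⟩
    apply act_injective g
    rw [(hφ i).2]; exact hj
  · rintro ⟨i, hi, rfl⟩
    change (T.tile (φ i)).corner k = _
    rw [← (hφ i).2, hi]

/-- If the tile across a side is attached with the ends of the side exchanged, then the isometry to
this tile is the half-turn about the midpoint of the side. -/
theorem Maps.half_turn {g : O3} {i j : Fin f} (hg : T.Maps g i j) {a : Fl}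
    (h : T.nbr (i, a) = (j, a.r0)) :
    ∃ m ∈ (T.tile i).openSide a.side, ∀ x : E3,
      g x = (2 * inner ℝ (m : E3) x : ℝ) • (m : E3) - x := by
  obtain ⟨v, n, hF⟩ := (T.tile i).exists_isFlagFrame a
  have h1 := (T.frame_nbr (x := (i, a)) hF).1
  rw [h] at h1
  have h2 := h1.r0
  rw [Fl.r0_r0] at h2
  obtain ⟨e1, e2⟩ := (hF.map hg).unique h2
  have hlen : (T.tile j).len a.r0.side = (T.tile i).len a.side := by
    rw [T.len_eq, T.len_eq, Fl.side_r0]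
  have hc0 : T.vtx (T.nbr (i, a)) = T.vtx (i, a) := T.vtx_nbr _
  have hc1 : T.vtx (T.nbr (i, a.r0)) = T.vtx (i, a.r0) := T.vtx_nbr _
  rw [T.nbr_r0, h] at hc1
  rw [h] at hc0
  simp only [vtx, Fl.r0_r0] at hc0 hc1
  rw [hlen, hc0] at e1
  have e0 : g ((T.tile i).corner a.corner : E3) = (T.tile j).corner a.corner :=
    congrArg Subtype.val (hg.2 _)
  rw [hc1, hF.other] at e0
  set l := (T.tile i).len a.side
  set p : E3 := ((T.tile i).corner a.corner : E3)
  have hl := (T.tile i).len_pos a.side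
  refine ⟨hF.frame.pt (l / 2), ?_, ?_⟩
  · rw [hF.openSide_eq]
    exact ⟨l / 2, ⟨by linarith, by linarith⟩, rfl⟩
  · intro x
    change g x = (2 * inner ℝ (gc p v (l / 2)) x) • gc p v (l / 2) - x
    have hx : x = (inner ℝ p x : ℝ) • p + (inner ℝ v x : ℝ) • v + (inner ℝ n x : ℝ) • n :=
      hF.frame.expand x
    have hin : inner ℝ (gc p v (l / 2)) x =
        Real.cos (l / 2) * inner ℝ p x + Real.sin (l / 2) * inner ℝ v x := by
      rw [gc, inner_add_left, inner_smul_left, inner_smul_left]; simp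
    obtain ⟨A, hA⟩ : ∃ A, A = (inner ℝ p x : ℝ) := ⟨_, rfl⟩
    obtain ⟨B, hB⟩ : ∃ B, B = (inner ℝ v x : ℝ) := ⟨_, rfl⟩
    obtain ⟨C, hC⟩ : ∃ C, C = (inner ℝ n x : ℝ) := ⟨_, rfl⟩
    rw [← hA, ← hB] at hx hin
    rw [← hC] at hx
    have hgx : g x = A • gc p v l + B • (-gcVel p v l) + C • (-n) := by
      rw [hx]
      simp only [map_add, map_smul, e0, e1, e2]
    have hcos : Real.cos l = 2 * Real.cos (l / 2) ^ 2 - 1 := by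
      rw [← Real.cos_two_mul]; congr 1; ring
    have hsin : Real.sin l = 2 * Real.sin (l / 2) * Real.cos (l / 2) := by
      rw [← Real.sin_two_mul]; congr 1; ring
    have hsq := Real.sin_sq_add_cos_sq (l / 2)
    have hcos' : Real.cos l = 1 - 2 * Real.sin (l / 2) ^ 2 := by rw [hcos]; linarith
    rw [hgx, hin]
    conv_rhs => rw [hx]
    simp only [gc, gcVel]
    have s1 : A * Real.cos l + B * Real.sin l =
        2 * (Real.cos (l / 2) * A + Real.sin (l / 2) * B) * Real.cos (l / 2) - A := by
      rw [hcos, hsin]; ring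
    have s2 : A * Real.sin l - B * Real.cos l =
        2 * (Real.cos (l / 2) * A + Real.sin (l / 2) * B) * Real.sin (l / 2) - B := by
      rw [hcos', hsin]; ring
    have : A • (Real.cos l • p + Real.sin l • v) + B • -(-Real.sin l • p + Real.cos l • v) + C • -n
        = (A * Real.cos l + B * Real.sin l) • p + (A * Real.sin l - B * Real.cos l) • v -
          C • n := by
      module
    rw [this, s1, s2]
    module

/-- If the tile across a side is the mirror image, then the isometry to this tile is a
reflection. -/
theorem Maps.reflection {g : O3} {i j : Fin f} (hg : T.Maps g i j) {a : Fl}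
    (h : T.nbr (i, a) = (j, a)) :
    ∃ n : E3, ‖n‖ = 1 ∧ ∀ x : E3, g x = x - (2 * inner ℝ n x : ℝ) • n := by
  obtain ⟨v, n, hF⟩ := (T.tile i).exists_isFlagFrame a
  have h1 := (T.frame_nbr (x := (i, a)) hF).1
  rw [h] at h1
  obtain ⟨e1, e2⟩ := (hF.map hg).unique h1
  have hc0 : T.vtx (T.nbr (i, a)) = T.vtx (i, a) := T.vtx_nbr _
  rw [h] at hc0
  have e0 : g ((T.tile i).corner a.corner : E3) = (T.tile i).corner a.corner := by
    refine (congrArg Subtype.val (hg.2 a.corner)).trans (congrArg Subtype.val hc0)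
  refine ⟨n, hF.frame.norm_n, fun x => ?_⟩
  have hgx : g x = g ((inner ℝ ((T.tile i).corner a.corner : E3) x : ℝ) •
      ((T.tile i).corner a.corner : E3) + (inner ℝ v x : ℝ) • v + (inner ℝ n x : ℝ) • n) :=
    congrArg g (hF.frame.expand x)
  have hx := hF.frame.expand x
  simp only [map_add, map_smul, e0, e1, e2] at hgx
  rw [hgx]
  generalize inner ℝ n x = C at *
  conv_rhs => rw [hx]
  module

end Tiling

end SphereTiling

namespace SphereTiling

open Set

/-! ### Point groups -/

/-- `g` is the half-turn about the axis through the unit vector `m`. -/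
structure IsHalfTurn (g : O3) (m : E3) : Prop where
  norm : ‖m‖ = 1
  apply : ∀ x : E3, g x = (2 * inner ℝ m x : ℝ) • m - x

/-- `g` is the reflection in the plane orthogonal to the unit vector `n`. -/
structure IsReflection (g : O3) (n : E3) : Prop where
  norm : ‖n‖ = 1
  apply : ∀ x : E3, g x = x - (2 * inner ℝ n x : ℝ) • n

theorem IsHalfTurn.mul_self {g : O3} {m : E3} (h : IsHalfTurn g m) : g * g = 1 := by
  ext1 x
  change g (g x) = x
  rw [h.apply, h.apply, inner_sub_right, inner_smul_right, inner_self_of_norm_one h.norm]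
  module

theorem IsHalfTurn.inv_eq {g : O3} {m : E3} (h : IsHalfTurn g m) : g⁻¹ = g :=
  inv_eq_of_mul_eq_one_left h.mul_self

theorem IsHalfTurn.apply_self {g : O3} {m : E3} (h : IsHalfTurn g m) : g m = m := by
  rw [h.apply, inner_self_of_norm_one h.norm]; module

/-- The fixed points of a half-turn on the sphere are the two ends of its axis. -/
theorem IsHalfTurn.eq_or_eq_neg {g : O3} {m x : E3} (h : IsHalfTurn g m) (hx : ‖x‖ = 1)
    (hg : g x = x) : x = m ∨ x = -m := by
  rw [h.apply] at hg
  have h1 : x = (inner ℝ m x : ℝ) • m := by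
    have h2 : (2 : ℝ) • x = (2 : ℝ) • ((inner ℝ m x : ℝ) • m) := by
      rw [smul_smul, two_smul]
      nth_rw 1 [← hg]
      abel
    exact smul_right_injective _ two_ne_zero h2
  have h2 : ‖x‖ = |(inner ℝ m x : ℝ)| := by
    nth_rw 1 [h1]; rw [norm_smul, h.norm, mul_one, Real.norm_eq_abs]
  rw [hx] at h2
  rcases eq_or_eq_neg_of_abs_eq h2.symm with h3 | h3
  · left; rw [h1, h3, one_smul]
  · right; rw [h1, h3, neg_smul, one_smul]

theorem exists_frame_of_norm {m : E3} (hm : ‖m‖ = 1) : ∃ v n, IsFrame m v n := by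
  obtain ⟨w, hw⟩ : ∃ w : E3, w ≠ 0 ∧ inner ℝ m w = 0 := by
    have h2 : (Submodule.span ℝ {m})ᗮ ≠ ⊥ := by
      intro h3
      have h4 := Submodule.finrank_add_finrank_orthogonal (Submodule.span ℝ {m})
      have h5 := finrank_span_le_card (R := ℝ) ({m} : Set E3)
      rw [h3] at h4
      simp at h4 h5
      omega
    obtain ⟨w, hw, hw0⟩ := Submodule.exists_mem_ne_zero_of_ne_bot h2
    exact ⟨w, hw0, Submodule.mem_orthogonal_singleton_iff_inner_right.mp hw⟩
  have h0 : 0 < ‖w‖ := norm_pos_iff.mpr hw.1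
  obtain ⟨n, hn⟩ := exists_frame (v := ‖w‖⁻¹ • w) hm
    (by rw [norm_smul, norm_inv, norm_norm, inv_mul_cancel₀ h0.ne'])
    (by rw [inner_smul_right, hw.2, mul_zero])
  exact ⟨_, n, hn⟩

theorem IsHalfTurn.ne_one {g : O3} {m : E3} (h : IsHalfTurn g m) : g ≠ 1 := by
  rintro rfl
  obtain ⟨v, n, hF⟩ := exists_frame_of_norm h.norm
  have h1 := h.apply v
  rw [hF.pv] at h1
  have h2 : v = 0 := by
    have h3 : (2 : ℝ) • v = 0 := by
      rw [two_smul]; nth_rw 1 [show v = (1 : O3) v from rfl, h1]; simp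
    simpa using h3
  have h3 := hF.norm_v
  rw [h2, norm_zero] at h3
  exact zero_ne_one h3

/-- Two unit vectors lie on a great circle. -/
theorem exists_frame_gc {m m' : E3} (hm : ‖m‖ = 1) (hm' : ‖m'‖ = 1) :
    ∃ u z φ, IsFrame m u z ∧ m' = gc m u φ := by
  set w := m' - (inner ℝ m m' : ℝ) • m with hw
  have hmw : inner ℝ m w = 0 := by
    rw [hw, inner_sub_right, inner_smul_right, inner_self_of_norm_one hm]; ring
  by_cases h0 : w = 0
  · obtain ⟨u, z, hF⟩ := exists_frame_of_norm hm
    have hz : inner ℝ z m' = 0 := by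
      have hzm : inner ℝ z m = 0 := (real_inner_comm _ _).trans hF.pn
      rw [sub_eq_zero.mp (hw.symm.trans h0), inner_smul_right, hzm, mul_zero]
    obtain ⟨φ, hφ, -⟩ := hF.exists_gc hm' hz
    exact ⟨u, z, φ, hF, hφ⟩
  · have hpos : 0 < ‖w‖ := norm_pos_iff.mpr h0
    obtain ⟨z, hF⟩ := exists_frame (v := ‖w‖⁻¹ • w) hm
      (by rw [norm_smul, norm_inv, norm_norm, inv_mul_cancel₀ hpos.ne'])
      (by rw [inner_smul_right, hmw, mul_zero])
    have hz : inner ℝ z m' = 0 := by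
      have h1 : m' = w + (inner ℝ m m' : ℝ) • m := by rw [hw]; abel
      have h2 : inner ℝ z w = 0 := by
        have h3 := hF.vn
        rw [inner_smul_left, real_inner_comm] at h3
        simpa [hpos.ne'] using h3
      have hzm : inner ℝ z m = 0 := (real_inner_comm _ _).trans hF.pn
      rw [h1, inner_add_right, inner_smul_right, h2, hzm]; ring
    obtain ⟨φ, hφ, -⟩ := hF.exists_gc hm' hz
    exact ⟨_, z, φ, hF, hφ⟩

/-- The isometry that maps the standard basis to a frame. -/
noncomputable def IsFrame.iso {p v n : E3} (h : IsFrame p v n) : O3 := h.basis.repr.symm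

theorem IsFrame.iso_apply {p v n : E3} (h : IsFrame p v n) (x : E3) :
    h.iso x = x 0 • p + x 1 • v + x 2 • n := by
  change h.basis.repr.symm x = _
  rw [← h.basis.sum_repr (h.basis.repr.symm x), Fin.sum_univ_three]
  simp [h.basis_apply]

/-- The conjugate of `k` by the isometry of a frame is computed in coordinates. -/
theorem IsFrame.conj_eq {p v n : E3} (h : IsFrame p v n) {k g : O3}
    (hk : ∀ x, g (h.iso x) = h.iso (k x)) : MulAut.conj h.iso k = g := by
  rw [MulAut.conj_apply]
  apply mul_right_cancel (b := h.iso)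
  rw [inv_mul_cancel_right]
  ext1 x
  exact (hk x).symm

theorem rotZ_apply (θ : ℝ) (x : E3) : rotZ θ x =
    !₂[Real.cos θ * x 0 - Real.sin θ * x 1, Real.sin θ * x 0 + Real.cos θ * x 1, x 2] := by
  rw [rotZ, ofMatrix_apply]
  ext i
  fin_cases i <;> simp [Matrix.mulVec, dotProduct, Fin.sum_univ_three]
  ring

theorem halfTurnX_apply (x : E3) : halfTurnX x = !₂[x 0, -x 1, -x 2] := by
  rw [halfTurnX, ofMatrix_apply]
  ext i
  fin_cases i <;> simp [Matrix.mulVec, dotProduct, Fin.sum_univ_three]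

theorem mirror_apply (φ : ℝ) (x : E3) : mirror φ x =
    !₂[Real.cos (2 * φ) * x 0 + Real.sin (2 * φ) * x 1,
      Real.sin (2 * φ) * x 0 - Real.cos (2 * φ) * x 1, x 2] := by
  rw [mirror, ofMatrix_apply]
  ext i
  fin_cases i <;> simp [Matrix.mulVec, dotProduct, Fin.sum_univ_three]
  ring

theorem cyclicTurn_apply (x : E3) : cyclicTurn x = !₂[x 2, x 0, x 1] := by
  rw [cyclicTurn, ofMatrix_apply]
  ext i
  fin_cases i <;> simp [Matrix.mulVec, dotProduct, Fin.sum_univ_three]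

theorem rotZ_mul (a b : ℝ) : rotZ a * rotZ b = rotZ (a + b) := by
  ext x i
  change rotZ a (rotZ b x) i = _
  rw [rotZ_apply, rotZ_apply, rotZ_apply, Real.cos_add, Real.sin_add]
  fin_cases i <;> simp <;> ring

theorem rotZ_zero : rotZ 0 = 1 := by
  ext x i
  rw [rotZ_apply]
  fin_cases i <;> simp

theorem rotZ_inv (a : ℝ) : (rotZ a)⁻¹ = rotZ (-a) := by
  apply inv_eq_of_mul_eq_one_left
  rw [rotZ_mul, neg_add_cancel, rotZ_zero]

theorem rotZ_pow (a : ℝ) (k : ℕ) : rotZ a ^ k = rotZ (k * a) := by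
  induction k with
  | zero => simp [rotZ_zero]
  | succ k ih => rw [pow_succ, ih, rotZ_mul]; congr 1; push_cast; ring

theorem rotZ_zpow (a : ℝ) (k : ℤ) : rotZ a ^ k = rotZ (k * a) := by
  cases k with
  | ofNat k => simpa using rotZ_pow a k
  | negSucc k =>
    rw [zpow_negSucc, rotZ_pow, rotZ_inv]; congr 1; push_cast; ring

theorem rotZ_two_pi_mul (k : ℤ) : rotZ (k * (2 * Real.pi)) = 1 := by
  ext x i
  rw [rotZ_apply]
  have h1 : Real.cos (k * (2 * Real.pi)) = 1 := Real.cos_int_mul_two_pi k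
  have h2 : Real.sin (k * (2 * Real.pi)) = 0 := by
    have := Real.sin_int_mul_pi (2 * k)
    rw [← this]; congr 1; push_cast; ring
  rw [h1, h2]
  fin_cases i <;> simp

theorem exists_of_rotZ_eq_one {a : ℝ} (h : rotZ a = 1) : ∃ k : ℤ, a = k * (2 * Real.pi) := by
  have h1 : rotZ a (!₂[1, 0, 0] : E3) 0 = 1 := by rw [h]; simp
  rw [rotZ_apply] at h1
  simp at h1
  obtain ⟨k, hk⟩ := (Real.cos_eq_one_iff a).mp h1
  exact ⟨k, hk.symm⟩

/-- A rotation of order `n` about the third axis is a power of the one by `2 π / n`. -/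
theorem exists_angle_of_orderOf {a : ℝ} {n : ℕ} (hn : 0 < n) (h : orderOf (rotZ a) = n) :
    ∃ k : ℤ, a = k * (2 * Real.pi / n) := by
  have h1 : rotZ (n * a) = 1 := by rw [← rotZ_pow, ← h, pow_orderOf_eq_one]
  obtain ⟨k, hk⟩ := exists_of_rotZ_eq_one h1
  have hn' : (n : ℝ) ≠ 0 := by positivity
  refine ⟨k, ?_⟩
  field_simp
  linarith

theorem zpowers_rotZ {a : ℝ} {n : ℕ} (hn : 0 < n) (h : orderOf (rotZ a) = n) :
    Subgroup.zpowers (rotZ a) = Subgroup.zpowers (rotZ (2 * Real.pi / n)) := by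
  obtain ⟨k, hk⟩ := exists_angle_of_orderOf hn h
  have hn' : (n : ℝ) ≠ 0 := by positivity
  have hle : Subgroup.zpowers (rotZ a) ≤ Subgroup.zpowers (rotZ (2 * Real.pi / n)) := by
    rw [Subgroup.zpowers_le]
    exact ⟨k, by rw [hk]; exact rotZ_zpow _ _⟩
  have hpow : rotZ (2 * Real.pi / n) ^ n = 1 := by
    rw [rotZ_pow, show (n : ℝ) * (2 * Real.pi / n) = ((1 : ℤ) : ℝ) * (2 * Real.pi) by
      push_cast; field_simp]
    exact rotZ_two_pi_mul 1
  have hfin : Finite (Subgroup.zpowers (rotZ (2 * Real.pi / n))) :=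
    (isOfFinOrder_iff_pow_eq_one.mpr ⟨n, hn, hpow⟩).finite_zpowers
  refine Subgroup.eq_of_le_of_card_ge hle ?_
  rw [Nat.card_zpowers, Nat.card_zpowers, h]
  exact Nat.le_of_dvd hn (orderOf_dvd_of_pow_eq_one hpow)

theorem halfTurnX_mul_self : halfTurnX * halfTurnX = 1 := by
  ext x i
  change halfTurnX (halfTurnX x) i = x i
  rw [halfTurnX_apply, halfTurnX_apply]
  fin_cases i <;> simp

theorem halfTurnX_rotZ (a : ℝ) : halfTurnX * rotZ a * halfTurnX = rotZ (-a) := by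
  ext x i
  change halfTurnX (rotZ a (halfTurnX x)) i = _
  rw [halfTurnX_apply, halfTurnX_apply, rotZ_apply, rotZ_apply, Real.cos_neg, Real.sin_neg]
  fin_cases i <;> simp
  ring

theorem halfTurnX_mirror (a : ℝ) : halfTurnX * mirror a * halfTurnX = mirror (-a) := by
  ext x i
  change halfTurnX (mirror a (halfTurnX x)) i = _
  rw [halfTurnX_apply, halfTurnX_apply, mirror_apply, mirror_apply, mul_neg, Real.cos_neg,
    Real.sin_neg]
  fin_cases i <;> simp
  ring

theorem rotZ_mul_mirror (a b : ℝ) : rotZ (2 * a) * mirror b = mirror (a + b) := by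
  ext x i
  change rotZ (2 * a) (mirror b x) i = _
  rw [rotZ_apply, mirror_apply, mirror_apply, mul_add, Real.cos_add, Real.sin_add]
  fin_cases i <;> simp <;> ring

theorem mirror_mul_mirror (a b : ℝ) : mirror a * mirror b = rotZ (2 * (a - b)) := by
  ext x i
  change mirror a (mirror b x) i = _
  rw [rotZ_apply, mirror_apply, mirror_apply, mul_sub, Real.cos_sub, Real.sin_sub]
  fin_cases i <;> simp <;> ring

theorem conjugate_of_closure {S : Set O3} {H : Subgroup O3} (g : O3) {S' : Set O3}
    (hS : S = MulAut.conj g '' S') (hH : Subgroup.closure S' = H) :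
    Conjugate (Subgroup.closure S) H := by
  refine ⟨g, ?_⟩
  rw [hS, ← hH, MonoidHom.map_closure]
  rfl

/-- Two half-turns whose product has order `n` generate `D_n`. -/
theorem conjugate_groupD {η κ : O3} {m m' : E3} (hη : IsHalfTurn η m) (hκ : IsHalfTurn κ m')
    {n : ℕ} (hn : 0 < n) (ho : orderOf (η * κ) = n) :
    Conjugate (Subgroup.closure {η, κ}) (groupD n) := by
  obtain ⟨u, z, φ, hF, hm'⟩ := exists_frame_gc hη.norm hκ.norm
  have hmm := inner_self_of_norm_one hF.norm_p
  have huu := inner_self_of_norm_one hF.norm_v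
  have hum : inner ℝ u m = 0 := (real_inner_comm _ _).trans hF.pv
  have e1 : MulAut.conj hF.iso halfTurnX = η := by
    apply hF.conj_eq
    intro x
    rw [hη.apply, hF.iso_apply, hF.iso_apply, halfTurnX_apply]
    simp only [inner_add_right, inner_smul_right, hmm, hF.pv, hF.pn]
    simp
    module
  have e2 : MulAut.conj hF.iso (rotZ (2 * φ) * halfTurnX) = κ := by
    apply hF.conj_eq
    intro x
    change κ _ = hF.iso (rotZ (2 * φ) (halfTurnX x))
    rw [hκ.apply, hF.iso_apply, hF.iso_apply, rotZ_apply, halfTurnX_apply, hm', gc]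
    simp only [inner_add_right, inner_smul_right, inner_add_left, inner_smul_left, hmm, huu, hum,
      hF.pv, hF.pn, hF.vn]
    have hc : Real.cos (2 * φ) = 1 - 2 * Real.sin φ ^ 2 := by
      rw [Real.cos_two_mul]; linarith [Real.sin_sq_add_cos_sq φ]
    simp
    match_scalars
    · rw [Real.cos_two_mul, Real.sin_two_mul]; ring
    · rw [hc, Real.sin_two_mul]; ring
    · ring
  have ho' : orderOf (rotZ (2 * φ)) = n := by
    rw [← e1, ← e2, ← map_mul, MulEquiv.orderOf_eq, ← mul_assoc, halfTurnX_rotZ, ← rotZ_inv,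
      orderOf_inv] at ho
    exact ho
  refine conjugate_of_closure hF.iso (S' := {halfTurnX, rotZ (2 * φ) * halfTurnX}) ?_ ?_
  · rw [image_pair, e1, e2]
  · have hz := zpowers_rotZ hn ho'
    apply le_antisymm
    · rw [groupD, Subgroup.closure_le]
      have hX : halfTurnX ∈ Subgroup.closure {rotZ (2 * Real.pi / n), halfTurnX} :=
        Subgroup.subset_closure (by simp)
      rintro _ (rfl | rfl)
      · exact hX
      · refine mul_mem ?_ hX
        have : rotZ (2 * φ) ∈ Subgroup.zpowers (rotZ (2 * Real.pi / n)) := by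
          rw [← hz]; exact Subgroup.mem_zpowers _
        refine (Subgroup.zpowers_le.mpr (Subgroup.subset_closure ?_)) this
        simp
    · rw [groupD, Subgroup.closure_le]
      have hX : halfTurnX ∈ Subgroup.closure {halfTurnX, rotZ (2 * φ) * halfTurnX} :=
        Subgroup.subset_closure (by simp)
      have hR : rotZ (2 * φ) ∈ Subgroup.closure {halfTurnX, rotZ (2 * φ) * halfTurnX} := by
        have h1 : rotZ (2 * φ) * halfTurnX ∈
          Subgroup.closure {halfTurnX, rotZ (2 * φ) * halfTurnX} :=
          Subgroup.subset_closure (by simp)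
        have := mul_mem h1 hX
        rwa [mul_assoc, halfTurnX_mul_self, mul_one] at this
      rintro _ (rfl | rfl)
      · have : rotZ (2 * Real.pi / n) ∈ Subgroup.zpowers (rotZ (2 * φ)) := by
          rw [hz]; exact Subgroup.mem_zpowers _
        exact (Subgroup.zpowers_le.mpr hR) this
      · exact hX

theorem conjugate_groupC_two {η : O3} {m : E3} (hη : IsHalfTurn η m) :
    Conjugate (Subgroup.closure {η}) (groupC 2) := by
  obtain ⟨u, w, hF⟩ := exists_frame_of_norm hη.norm
  have hF' : IsFrame u w m := ⟨hF.norm_v, hF.norm_n, hF.norm_p, hF.vn,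
    (real_inner_comm _ _).trans hF.pv, (real_inner_comm _ _).trans hF.pn⟩
  refine conjugate_of_closure hF'.iso (S' := {rotZ (2 * Real.pi / (2 : ℕ))}) ?_ rfl
  rw [image_singleton]
  congr 1
  symm
  apply hF'.conj_eq
  intro x
  have : 2 * Real.pi / (2 : ℕ) = Real.pi := by push_cast; ring
  rw [hη.apply, hF'.iso_apply, hF'.iso_apply, rotZ_apply, this]
  simp only [inner_add_right, inner_smul_right, inner_self_of_norm_one hη.norm, hF.pv, hF.pn]
  simp
  module

/-- A half-turn `η` and a reflection `r`, such that `r` and `η r η` have a product of order `n`,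
generate `D_{nv}` if only `1` and `η` fix the axis of `η` pointwise. The last condition excludes the
case that the group contains a reflection in a plane through this axis. -/
theorem conjugate_groupDv {η r : O3} {m ν : E3} (hη : IsHalfTurn η m) (hr : IsReflection r ν)
    {n : ℕ} (hn : 0 < n) (ho : orderOf (r * (η * r * η)) = n)
    (hstab : ∀ g ∈ Subgroup.closure {η, r}, g m = m → g = 1 ∨ g = η) :
    Conjugate (Subgroup.closure {η, r}) (groupDv n) := by
  obtain ⟨u, z, ψ, hF, hν⟩ := exists_frame_gc hη.norm hr.norm
  have hmm := inner_self_of_norm_one hF.norm_p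
  have huu := inner_self_of_norm_one hF.norm_v
  have hum : inner ℝ u m = 0 := (real_inner_comm _ _).trans hF.pv
  -- the plane of `r` makes the angle `φ` with the axis of `η`, its normal the angle `ψ`
  obtain ⟨φ, hφ⟩ : ∃ φ, ψ = φ + Real.pi / 2 := ⟨ψ - Real.pi / 2, by ring⟩
  have e1 : MulAut.conj hF.iso halfTurnX = η := by
    apply hF.conj_eq
    intro x
    rw [hη.apply, hF.iso_apply, hF.iso_apply, halfTurnX_apply]
    simp only [inner_add_right, inner_smul_right, hmm, hF.pv, hF.pn]
    simp
    module
  have e2 : MulAut.conj hF.iso (mirror φ) = r := by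
    apply hF.conj_eq
    intro x
    rw [hr.apply, hF.iso_apply, hF.iso_apply, mirror_apply, hν, gc, hφ, Real.cos_add_pi_div_two,
      Real.sin_add_pi_div_two]
    simp only [inner_add_right, inner_smul_right, inner_add_left, inner_smul_left, hmm, huu, hum,
      hF.pv, hF.pn, hF.vn]
    have hc : Real.cos (2 * φ) = 1 - 2 * Real.sin φ ^ 2 := by
      rw [Real.cos_two_mul]; linarith [Real.sin_sq_add_cos_sq φ]
    simp
    match_scalars
    · rw [hc, Real.sin_two_mul]; ring
    · rw [Real.cos_two_mul, Real.sin_two_mul]; ring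
    · ring
  have ho' : orderOf (rotZ (4 * φ)) = n := by
    rw [← e1, ← e2, ← map_mul, ← map_mul, ← map_mul, MulEquiv.orderOf_eq, halfTurnX_mirror,
      mirror_mul_mirror] at ho
    rw [← ho]; congr 2; ring
  have hz := zpowers_rotZ hn ho'
  obtain ⟨j, hj⟩ := exists_angle_of_orderOf hn ho'
  have hn' : (n : ℝ) ≠ 0 := by positivity
  set K := Subgroup.closure {halfTurnX, mirror φ} with hK
  have hXK : halfTurnX ∈ K := Subgroup.subset_closure (by simp)
  have hMK : mirror φ ∈ K := Subgroup.subset_closure (by simp)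
  have hRK : rotZ (2 * Real.pi / n) ∈ K := by
    have h1 : rotZ (4 * φ) ∈ K := by
      have : rotZ (4 * φ) = mirror φ * (halfTurnX * mirror φ * halfTurnX) := by
        rw [halfTurnX_mirror, mirror_mul_mirror]; congr 1; ring
      rw [this]
      exact mul_mem hMK (mul_mem (mul_mem hXK hMK) hXK)
    have h2 : rotZ (2 * Real.pi / n) ∈ Subgroup.zpowers (rotZ (4 * φ)) := by
      rw [hz]; exact Subgroup.mem_zpowers _
    exact (Subgroup.zpowers_le.mpr h1) h2
  have himg : MulAut.conj hF.iso '' {halfTurnX, mirror φ} = {η, r} := by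
    rw [image_pair, e1, e2]
  -- the plane of `r` bisects the angle between two adjacent two-fold axes
  have hodd : Odd j := by
    by_contra hcon
    rw [Int.not_odd_iff_even] at hcon
    obtain ⟨s, hs⟩ := hcon
    -- otherwise the reflection in the plane of the first and third axes is in the group
    have h0 : mirror 0 ∈ K := by
      have h1 : rotZ (2 * Real.pi / n) ^ (-s) * mirror φ = mirror 0 := by
        have h2 : ((-s : ℤ) : ℝ) * (2 * Real.pi / n) = 2 * (-φ) := by
          rw [hs] at hj; push_cast at hj ⊢; linarith
        rw [rotZ_zpow, h2, rotZ_mul_mirror, neg_add_cancel]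
      rw [← h1]
      exact mul_mem (zpow_mem hRK _) hMK
    have h1 : MulAut.conj hF.iso (mirror 0) ∈ Subgroup.closure {η, r} := by
      have h2 : MulAut.conj hF.iso (mirror 0) ∈ K.map (MulAut.conj hF.iso).toMonoidHom :=
        Subgroup.mem_map_of_mem _ h0
      rw [hK, MonoidHom.map_closure] at h2
      convert h2
      exact himg.symm
    have h3 : (MulAut.conj hF.iso (mirror 0)) m = m := by
      have hm : hF.iso (!₂[1, 0, 0] : E3) = m := by rw [hF.iso_apply]; simp
      have hm' : hF.iso.symm m = !₂[1, 0, 0] := by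
        rw [LinearIsometryEquiv.symm_apply_eq, hm]
      change hF.iso (mirror 0 (hF.iso.symm m)) = m
      rw [hm', mirror_apply]
      simpa using hm
    rcases hstab _ h1 h3 with h4 | h4
    · have h5 : mirror 0 = 1 := (MulAut.conj hF.iso).injective (h4.trans (map_one _).symm)
      have h6 : mirror 0 (!₂[0, 1, 0] : E3) 1 = 1 := by rw [h5]; simp
      rw [mirror_apply] at h6
      simp at h6
      linarith
    · have h5 : mirror 0 = halfTurnX := (MulAut.conj hF.iso).injective (h4.trans e1.symm)
      have h6 : mirror 0 (!₂[0, 0, 1] : E3) 2 = halfTurnX (!₂[0, 0, 1] : E3) 2 := by rw [h5]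
      rw [mirror_apply, halfTurnX_apply] at h6
      simp at h6
      linarith
  obtain ⟨s, hs⟩ := hodd
  have hang : φ = s * (Real.pi / n) + Real.pi / (2 * n) := by
    rw [hs] at hj; push_cast at hj
    field_simp at hj ⊢
    linarith
  have hrel : rotZ (2 * Real.pi / n) ^ s * mirror (Real.pi / (2 * n)) = mirror φ := by
    rw [rotZ_zpow, show (s : ℝ) * (2 * Real.pi / n) = 2 * (s * (Real.pi / n)) by ring,
      rotZ_mul_mirror, hang]
  refine conjugate_of_closure hF.iso (S' := {halfTurnX, mirror φ}) himg.symm ?_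
  apply le_antisymm
  · rw [groupDv, Subgroup.closure_le]
    rintro _ (rfl | rfl)
    · exact Subgroup.subset_closure (by simp)
    · rw [← hrel]
      exact mul_mem (zpow_mem (Subgroup.subset_closure (by simp)) _)
        (Subgroup.subset_closure (by simp))
  · rw [groupDv, Subgroup.closure_le]
    rintro _ (rfl | rfl | rfl)
    · exact hRK
    · exact hXK
    · have : mirror (Real.pi / (2 * n)) = (rotZ (2 * Real.pi / n) ^ s)⁻¹ * mirror φ := by
        rw [← hrel, inv_mul_cancel_left]
      rw [this]
      exact mul_mem (inv_mem (zpow_mem hRK _)) hMK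

/-- Two distinct commuting reflections that correspond under a rotation of order three generate,
together with this rotation, the group `T_h`. -/
theorem conjugate_groupTh {ρ r r' : O3} {ν : E3} (hr : IsReflection r ν) (hρ : ρ ^ 3 = 1)
    (hr' : ρ * r * ρ⁻¹ = r') (hcomm : r * r' = r' * r) (hne : r ≠ r') :
    Conjugate (Subgroup.closure {ρ, r}) groupTh := by
  have h3 : ∀ x : E3, ρ (ρ (ρ x)) = x := by
    intro x
    have : (ρ ^ 3) x = x := by rw [hρ]; rfl
    exact this
  have hrr' : IsReflection r' (ρ ν) := by
    refine ⟨by rw [ρ.norm_map, hr.norm], fun x => ?_⟩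
    rw [← hr']
    change ρ (r (ρ.symm x)) = _
    rw [hr.apply, map_sub, map_smul, ρ.apply_symm_apply, ← ρ.inner_map_map, ρ.apply_symm_apply]
  -- the normals of two distinct commuting reflections are orthogonal
  have h01 : inner ℝ ν (ρ ν) = 0 := by
    set s : ℝ := inner ℝ ν (ρ ν) with hs
    have h1 : r (r' ν) = r' (r ν) := congrArg (fun g : O3 => g ν) hcomm
    rw [hr.apply ν, hr.apply (r' ν), hrr'.apply, map_sub, map_smul, hrr'.apply,
      inner_sub_right, inner_smul_right, inner_self_of_norm_one hr.norm,
      real_inner_comm ν (ρ ν), ← hs] at h1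
    have h2 : (4 * s * s) • ν = (4 * s) • ρ ν := by
      have h3 : (ν - (2 * s) • ρ ν - (2 * (1 - 2 * s * s)) • ν) -
          (ν - (2 * s) • ρ ν - (2 * 1 : ℝ) • (ν - (2 * s) • ρ ν)) = 0 := sub_eq_zero.mpr h1
      have h4 : (4 * s * s) • ν - (4 * s) • ρ ν = 0 := by
        rw [← h3]; module
      exact sub_eq_zero.mp h4
    by_contra hs0
    have h4 : ρ ν = s • ν := by
      have h5 : (4 * s) • (s • ν) = (4 * s) • ρ ν := by rw [smul_smul]; exact h2
      exact (smul_right_injective _ (by simpa using hs0 : (4 * s : ℝ) ≠ 0) h5).symm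
    have h5 : |s| = 1 := by
      have h6 : ‖ρ ν‖ = 1 := hrr'.norm
      rwa [h4, norm_smul, hr.norm, mul_one, Real.norm_eq_abs] at h6
    apply hne
    ext1 x
    rw [hr.apply, hrr'.apply, h4, inner_smul_left, smul_smul]
    have h6 : s * s = 1 := by rw [← abs_mul_abs_self, h5]; ring
    congr 2
    simp
    linear_combination (-2 * inner ℝ ν x) * h6
  have h12 : inner ℝ (ρ ν) (ρ (ρ ν)) = 0 := by rw [ρ.inner_map_map]; exact h01
  have h02 : inner ℝ ν (ρ (ρ ν)) = 0 := by
    rw [← ρ.inner_map_map, h3, real_inner_comm]; exact h01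
  have hF : IsFrame ν (ρ ν) (ρ (ρ ν)) :=
    ⟨hr.norm, by rw [ρ.norm_map, hr.norm], by rw [ρ.norm_map, ρ.norm_map, hr.norm], h01, h02, h12⟩
  have e1 : MulAut.conj hF.iso cyclicTurn = ρ := by
    apply hF.conj_eq
    intro x
    rw [hF.iso_apply, hF.iso_apply, cyclicTurn_apply]
    simp only [map_add, map_smul, h3]
    simp
    module
  have hnx : ∀ x : E3, ((LinearIsometryEquiv.neg ℝ : O3) * halfTurnX) x = !₂[-x 0, x 1, x 2] := by
    intro x
    change -(halfTurnX x) = _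
    rw [halfTurnX_apply]
    ext i
    fin_cases i <;> simp
  have e2 : MulAut.conj hF.iso ((LinearIsometryEquiv.neg ℝ : O3) * halfTurnX) = r := by
    apply hF.conj_eq
    intro x
    rw [hnx, hF.iso_apply, hF.iso_apply, hr.apply]
    simp only [inner_add_right, inner_smul_right, inner_self_of_norm_one hr.norm, h01, h02]
    simp
    module
  refine conjugate_of_closure hF.iso
    (S' := {cyclicTurn, (LinearIsometryEquiv.neg ℝ : O3) * halfTurnX}) ?_ ?_
  · rw [image_pair, e1, e2]
  · apply le_antisymm
    · rw [groupTh, Subgroup.closure_le]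
      rintro _ (rfl | rfl)
      · exact Subgroup.subset_closure (by simp)
      · exact mul_mem (Subgroup.subset_closure (by simp)) (Subgroup.subset_closure (by simp))
    · set K := Subgroup.closure {cyclicTurn, (LinearIsometryEquiv.neg ℝ : O3) * halfTurnX}
      have hc : cyclicTurn ∈ K := Subgroup.subset_closure (by simp)
      have hq : (LinearIsometryEquiv.neg ℝ : O3) * halfTurnX ∈ K :=
        Subgroup.subset_closure (by simp)
      -- the inversion is the product of the reflections in the three coordinate planes
      have hneg : (LinearIsometryEquiv.neg ℝ : O3) ∈ K := by
        set q := (LinearIsometryEquiv.neg ℝ : O3) * halfTurnX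
        have : (LinearIsometryEquiv.neg ℝ : O3) =
            cyclicTurn * q * cyclicTurn * q * cyclicTurn * q := by
          ext x i
          change -x.ofLp i = cyclicTurn (q (cyclicTurn (q (cyclicTurn (q x))))) i
          rw [hnx, cyclicTurn_apply, hnx, cyclicTurn_apply, hnx, cyclicTurn_apply]
          fin_cases i <;> simp
        rw [this]
        exact mul_mem (mul_mem (mul_mem (mul_mem (mul_mem hc hq) hc) hq) hc) hq
      rw [groupTh, Subgroup.closure_le]
      rintro _ (rfl | rfl | rfl)
      · have : halfTurnX = (LinearIsometryEquiv.neg ℝ : O3)⁻¹ *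
            ((LinearIsometryEquiv.neg ℝ : O3) * halfTurnX) := by rw [inv_mul_cancel_left]
        rw [this]
        exact mul_mem (inv_mem hneg) hq
      · exact hc
      · exact hneg

/-- A group of at most four isometries that contains two different half-turns is `D_2`. -/
theorem conjugate_groupD_two {G : Subgroup O3} {η κ : O3} {m m' : E3} (hη : IsHalfTurn η m)
    (hκ : IsHalfTurn κ m') (hηG : η ∈ G) (hκG : κ ∈ G) (hne : η ≠ κ) (hfin : Finite G)
    (hcard : Nat.card G ≤ 4) : Conjugate G (groupD 2) := by
  have h1 : η * κ ≠ 1 := fun h => hne (by rw [eq_inv_of_mul_eq_one_left h, hκ.inv_eq])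
  have hηκ : η * κ ≠ η := fun h => hκ.ne_one (by simpa using h)
  have hκη : η * κ ≠ κ := fun h => hη.ne_one (by simpa using h)
  have key : ∀ H : Subgroup O3, η ∈ H → κ ∈ H → H ≤ G → ∀ g ∈ G, g ∈ ({1, η, κ, η * κ} : Set O3) ∧
      g ∈ H := by
    intro H hη' hκ' hHG g hg
    have hsub : ({1, η, κ, η * κ} : Set O3) ⊆ (G : Set O3) := by
      rintro _ (rfl | rfl | rfl | rfl)
      · exact one_mem _
      · exact hηG
      · exact hκG
      · exact mul_mem hηG hκG
    have hc4 : ({1, η, κ, η * κ} : Set O3).ncard = 4 := by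
      rw [ncard_insert_of_notMem, ncard_insert_of_notMem, ncard_pair hκη.symm]
      · simp [hne, hηκ.symm]
      · simp [hη.ne_one.symm, hκ.ne_one.symm, h1.symm]
    have hfin' : (G : Set O3).Finite := hfin
    have heq : ({1, η, κ, η * κ} : Set O3) = (G : Set O3) := by
      apply eq_of_subset_of_ncard_le hsub _ hfin'
      rw [hc4]; exact hcard
    have hg' : g ∈ ({1, η, κ, η * κ} : Set O3) := by rw [heq]; exact hg
    refine ⟨hg', ?_⟩
    rcases hg' with rfl | rfl | rfl | rfl
    · exact one_mem _
    · exact hη'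
    · exact hκ'
    · exact mul_mem hη' hκ'
  have hcl : Subgroup.closure {η, κ} ≤ G := by
    rw [Subgroup.closure_le]; rintro _ (rfl | rfl) <;> assumption
  have hG : G = Subgroup.closure {η, κ} := le_antisymm (fun g hg => (key _
    (Subgroup.subset_closure (by simp)) (Subgroup.subset_closure (by simp)) hcl g hg).2) hcl
  have hsq : (η * κ) ^ 2 = 1 := by
    have h2 := (key G hηG hκG le_rfl (κ * η) (mul_mem hκG hηG)).1
    have h3 : κ * η = η * κ := by
      rcases h2 with h | h | h | h
      · exfalso; exact hne.symm (by rw [eq_inv_of_mul_eq_one_left h, hη.inv_eq])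
      · exact absurd h (fun h => hκ.ne_one (by simpa using h))
      · exact absurd h (fun h => hη.ne_one (by simpa using h))
      · exact h
    rw [pow_two, mul_assoc, ← mul_assoc κ, h3, mul_assoc, hκ.mul_self, mul_one, hη.mul_self]
  rw [hG]
  exact conjugate_groupD hη hκ two_pos (orderOf_eq_prime hsq h1)

namespace Tiling

variable {f : ℕ} (T : Tiling f)

/-! ### Vertices of small degree -/

/-- The vertex type at a flag. -/
noncomputable def vt (x : Fin f × Fl) : Fin 4 → ℕ := T.vertexType (T.vtx x)

@[simp] theorem vt_nbr (x : Fin f × Fl) : T.vt (T.nbr x) = T.vt x := by simp [vt]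

theorem vt_iterate_turn (x : Fin f × Fl) (m : ℕ) : T.vt (T.turn^[m] x) = T.vt x := by
  rw [vt, vtx_iterate_turn, vt]

theorem vt_pos (x : Fin f × Fl) : 0 < T.vt x x.2.corner := T.vertexType_pos x

theorem vt_nbr_pos (x : Fin f × Fl) : 0 < T.vt x (T.nbr x).2.corner := by
  have := T.vt_pos (T.nbr x)
  rwa [vt_nbr] at this

theorem vt_mem_avc (x : Fin f × Fl) : T.vt x ∈ T.avc := T.vertexType_mem_avc x

variable {T}

theorem nbr_symm {x y : Fin f × Fl} (h : T.nbr x = y) : T.nbr y = x := by rw [← h, nbr_nbr]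

theorem nbr_r0_of_eq {i j : Fin f} {a b : Fl} (h : T.nbr (i, a) = (j, b)) :
    T.nbr (i, a.r0) = (j, b.r0) := by rw [nbr_r0, h]

theorem cls_of_nbr {i j : Fin f} {a b : Fl} (h : T.nbr (i, a) = (j, b)) : b.cls = a.cls := by
  have := T.cls_nbr (i, a)
  rwa [h] at this

theorem deg_of_vt {x : Fin f × Fl} {t : Fin 4 → ℕ} (h : T.vt x = t) : T.deg x = ∑ k, t k := by
  rw [deg_eq, ← h]; rfl

theorem sum_corner (x : Fin f × Fl) (k : Fin 4) :
    ∑ m ∈ Finset.range (T.deg x), (if (T.turn^[m] x).2.corner = k then 1 else 0) = T.vt x k := by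
  rw [vt, ← T.card_filter_corner x k, Finset.card_filter]

theorem turn_cube {x : Fin f × Fl} (h : T.deg x = 3) : T.turn (T.turn (T.turn x)) = x := by
  have := T.iterate_turn_deg x
  rwa [h] at this

theorem turn_fourth {x : Fin f × Fl} (h : T.deg x = 4) :
    T.turn (T.turn (T.turn (T.turn x))) = x := by
  have := T.iterate_turn_deg x
  rwa [h] at this

theorem sum_corner_three {x : Fin f × Fl} (h : T.deg x = 3) (k : Fin 4) :
    (if x.2.corner = k then 1 else 0) + (if (T.turn x).2.corner = k then 1 else 0) +
      (if (T.turn (T.turn x)).2.corner = k then 1 else 0) = T.vt x k := by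
  rw [← sum_corner, h]
  simp only [Finset.sum_range_succ, Finset.sum_range_zero, zero_add]
  rfl

theorem sum_corner_four {x : Fin f × Fl} (h : T.deg x = 4) (k : Fin 4) :
    (if x.2.corner = k then 1 else 0) + (if (T.turn x).2.corner = k then 1 else 0) +
      (if (T.turn (T.turn x)).2.corner = k then 1 else 0) +
      (if (T.turn (T.turn (T.turn x))).2.corner = k then 1 else 0) = T.vt x k := by
  rw [← sum_corner, h]
  simp only [Finset.sum_range_succ, Finset.sum_range_zero, zero_add]
  rfl

/-- Three angles of one kind in succession around a vertex. -/
theorem three_le_of_corner {x : Fin f × Fl} {k : Fin 4} (h0 : x.2.corner = k)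
    (h1 : (T.turn x).2.corner = k) (h2 : (T.turn (T.turn x)).2.corner = k) : 3 ≤ T.vt x k := by
  rw [← sum_corner]
  obtain ⟨s, hs⟩ := Nat.exists_eq_add_of_le (T.three_le_deg x)
  rw [hs, Finset.sum_range_add]
  refine le_trans ?_ (Nat.le_add_right _ _)
  simp only [Finset.sum_range_succ, Finset.sum_range_zero, zero_add]
  change 3 ≤ (if x.2.corner = k then 1 else 0) + (if (T.turn x).2.corner = k then 1 else 0) +
    (if (T.turn (T.turn x)).2.corner = k then 1 else 0)
  rw [if_pos h0, if_pos h1, if_pos h2]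

variable (T)

/-! ### Tilings in which the angle `γ` occurs only in `γ⁴` -/

/-- The tile across the side `BC`. -/
noncomputable def sb (i : Fin f) : Fin f := (T.nbr (i, .c1)).1

/-- The tile across the side `CD`. -/
noncomputable def sc (i : Fin f) : Fin f := (T.nbr (i, .c2)).1

/-- The tile across the side `AB`. -/
noncomputable def lk (i : Fin f) : Fin f := (T.nbr (i, .a0)).1

/-- The angle `γ` occurs only at vertices `γ⁴`. -/
def GammaFour : Prop := ∀ x, 0 < T.vt x 2 → T.vt x = ![0, 0, 4, 0]

/-- The vertices at which both `α` and `β` occur are of type `αβ²`. -/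
def AlphaBeta : Prop := ∀ x, 0 < T.vt x 0 → 0 < T.vt x 1 → T.vt x = ![1, 2, 0, 0]

variable {T}

theorem turn_of_nbr {x : Fin f × Fl} {j : Fin f} {b : Fl} (h : T.nbr x = (j, b)) :
    T.turn x = (j, b.r1) := by rw [turn, h]; rfl

namespace GammaFour

theorem nbr_c1 (hC : T.GammaFour) (i : Fin f) : T.nbr (i, .c1) = (T.sb i, .c1) := by
  have h1 := hC (i, .c1) (T.vt_pos _)
  have h2 := T.vt_nbr_pos (i, .c1)
  rw [h1] at h2
  rcases e : T.nbr (i, .c1) with ⟨j, b⟩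
  have h3 := cls_of_nbr e
  rw [e] at h2
  rw [sb, e]
  cases b <;> simp [Fl.cls, Fl.corner] at h3 h2 ⊢

theorem nbr_c2 (hC : T.GammaFour) (i : Fin f) : T.nbr (i, .c2) = (T.sc i, .c2) := by
  have h1 := hC (i, .c2) (T.vt_pos _)
  have h2 := T.vt_nbr_pos (i, .c2)
  rw [h1] at h2
  rcases e : T.nbr (i, .c2) with ⟨j, b⟩
  have h3 := cls_of_nbr e
  rw [e] at h2
  rw [sc, e]
  cases b <;> simp [Fl.cls, Fl.corner] at h3 h2 ⊢

theorem nbr_b1 (hC : T.GammaFour) (i : Fin f) : T.nbr (i, .b1) = (T.sb i, .b1) :=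
  nbr_r0_of_eq (hC.nbr_c1 i)

theorem nbr_d2 (hC : T.GammaFour) (i : Fin f) : T.nbr (i, .d2) = (T.sc i, .d2) :=
  nbr_r0_of_eq (hC.nbr_c2 i)

theorem sb_sb (hC : T.GammaFour) (i : Fin f) : T.sb (T.sb i) = i :=
  congrArg Prod.fst ((hC.nbr_c1 _).symm.trans (nbr_symm (hC.nbr_c1 i)))

theorem sc_sc (hC : T.GammaFour) (i : Fin f) : T.sc (T.sc i) = i :=
  congrArg Prod.fst ((hC.nbr_c2 _).symm.trans (nbr_symm (hC.nbr_c2 i)))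

theorem turn_c1 (hC : T.GammaFour) (i : Fin f) : T.turn (i, .c1) = (T.sb i, .c2) :=
  turn_of_nbr (hC.nbr_c1 i)

theorem turn_c2 (hC : T.GammaFour) (i : Fin f) : T.turn (i, .c2) = (T.sc i, .c1) :=
  turn_of_nbr (hC.nbr_c2 i)

theorem turn_b1 (hC : T.GammaFour) (i : Fin f) : T.turn (i, .b1) = (T.sb i, .b0) :=
  turn_of_nbr (hC.nbr_b1 i)

theorem turn_d2 (hC : T.GammaFour) (i : Fin f) : T.turn (i, .d2) = (T.sc i, .d3) :=
  turn_of_nbr (hC.nbr_d2 i)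

theorem deg_c1 (hC : T.GammaFour) (i : Fin f) : T.deg (i, .c1) = 4 := by
  rw [deg_of_vt (hC (i, .c1) (T.vt_pos _))]
  simp [Fin.sum_univ_four]

/-- The four tiles at a vertex `γ⁴` are `i`, `sb i`, `sc (sb i)` and `sc i`. -/
theorem sb_sc (hC : T.GammaFour) (i : Fin f) : T.sb (T.sc i) = T.sc (T.sb i) := by
  have h := turn_fourth (hC.deg_c1 i)
  rw [hC.turn_c1, hC.turn_c2, hC.turn_c1, hC.turn_c2] at h
  have h1 : T.sc (T.sb (T.sc (T.sb i))) = i := congrArg Prod.fst h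
  have h2 := congrArg T.sc h1
  rw [hC.sc_sc] at h2
  rw [← h2, hC.sb_sb]

theorem sb_ne (hC : T.GammaFour) (i : Fin f) : T.sb i ≠ i := by
  have := T.nbr_fst_ne (i, .c1)
  rwa [hC.nbr_c1] at this

theorem sb_ne_sc (hC : T.GammaFour) (i : Fin f) : T.sb i ≠ T.sc i := by
  intro h
  have h3 : T.turn (T.turn (T.turn (i, .c1))) = (T.sc i, .c2) := by
    rw [hC.turn_c1, hC.turn_c2, hC.turn_c1, hC.sb_sc, hC.sb_sb]
  have hd := hC.deg_c1 i
  have := T.iterate_turn_inj (x := (i, .c1)) (m := 1) (m' := 3) (by omega) (by omega)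
    (by change (T.turn _).1 = (T.turn (T.turn (T.turn _))).1; rw [h3, hC.turn_c1]; exact h)
  omega

/-- Three angles `β` meet at a vertex if two tiles share an edge `AB` with the same end `B`. -/
theorem three_le_beta (hC : T.GammaFour) {i j : Fin f} (h : T.nbr (i, .b0) = (j, .b0)) :
    3 ≤ T.vt (i, .b0) 1 := by
  apply three_le_of_corner <;> simp only [turn_of_nbr h, Fl.r1, hC.turn_b1] <;> rfl

/-- Three angles `δ` meet at a vertex if two tiles share an edge `AD` with the same end `D`. -/
theorem three_le_delta (hC : T.GammaFour) {i j : Fin f} (h : T.nbr (i, .d3) = (j, .d3)) :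
    3 ≤ T.vt (i, .d3) 3 := by
  apply three_le_of_corner <;> simp only [turn_of_nbr h, Fl.r1, hC.turn_d2] <;> rfl

/-- The tiles at a vertex `αβ²`. -/
theorem alpha_beta_beta (hC : T.GammaFour) {x : Fin f × Fl} (hx : x.2.corner = 0)
    (hv : T.vt x = ![1, 2, 0, 0]) : ∃ j, T.nbr x = (j, .b0) ∧ T.nbr (fl1 x) = (T.sb j, .b0) := by
  have hd : T.deg x = 3 := by rw [deg_of_vt hv]; simp [Fin.sum_univ_four]
  have h0 := sum_corner_three hd 0
  have h3 := T.vt_nbr_pos x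
  have hc := T.cls_nbr x
  have ht := turn_cube hd
  rcases e : T.nbr x with ⟨j, b⟩
  rw [hv] at h0 h3
  rw [e] at h3 hc
  rw [hx, turn_of_nbr e] at h0
  replace h0 := Nat.le.intro h0
  have hb : b = .b0 := by
    obtain ⟨i, a⟩ := x
    cases a <;> simp [Fl.corner] at hx <;> cases b <;>
      simp [Fl.cls, Fl.corner, Fl.r1] at hc h0 h3 ⊢
  subst hb
  refine ⟨j, rfl, ?_⟩
  rw [turn_of_nbr e, Fl.r1, hC.turn_b1] at ht
  have h4 := congrArg fl1 ht
  rw [turn, fl1_fl1] at h4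
  exact nbr_symm h4

/-- The tiles at a vertex `α²δ²`, seen from an edge between `α` and `δ`. -/
theorem alpha_delta (hC : T.GammaFour) {x : Fin f × Fl} {k : Fin f} (hx : x.2.corner = 0)
    (hv : T.vt x = ![2, 0, 0, 2]) (h : T.nbr x = (k, .d3)) :
    (T.nbr (T.sc k, .d3)).2.corner = 0 ∧ T.nbr (fl1 x) = fl1 (T.nbr (T.sc k, .d3)) := by
  have hd : T.deg x = 4 := by rw [deg_of_vt hv]; simp [Fin.sum_univ_four]
  have h3 := sum_corner_four hd 3
  have h4 := T.vt_pos (T.turn (T.turn (T.turn x)))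
  have h5 : T.vt (T.turn (T.turn (T.turn x))) = T.vt x := T.vt_iterate_turn x 3
  have ht := turn_fourth hd
  rw [h5, hv] at h4
  rw [hv, hx] at h3
  have h7 : T.turn (T.turn (T.turn x)) = fl1 (T.nbr (T.sc k, .d3)) := by
    rw [turn_of_nbr h, Fl.r1, hC.turn_d2, turn]
  rw [h7] at h3 h4 ht
  rw [turn_of_nbr h, Fl.r1, hC.turn_d2] at h3
  have hc := T.cls_nbr (T.sc k, .d3)
  rcases e : T.nbr (T.sc k, .d3) with ⟨j, b⟩
  rw [e] at h3 h4 hc ht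
  refine ⟨?_, ?_⟩
  · cases b <;> simp [Fl.cls, Fl.corner, fl1, Fl.r1] at hc h3 h4 ⊢
  · have h6 := congrArg fl1 ht
    rw [turn, fl1_fl1] at h6
    exact nbr_symm h6

/-- The tiles at a vertex `α²δ²`, seen from an edge between the two angles `α`. -/
theorem alpha_alpha (hC : T.GammaFour) {x : Fin f × Fl} (hx : x.2.corner = 0)
    (hv : T.vt x = ![2, 0, 0, 2]) (h : (T.nbr x).2.corner = 0) :
    ∃ k, T.nbr (fl1 x) = (k, .d3) ∧ T.nbr (fl1 (T.nbr x)) = (T.sc k, .d3) := by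
  have hd : T.deg x = 4 := by rw [deg_of_vt hv]; simp [Fin.sum_univ_four]
  have h0 := sum_corner_four hd 0
  have ht := turn_fourth hd
  have h4 := T.vt_nbr_pos (T.turn x)
  have h5 : T.vt (T.turn x) = T.vt x := T.vt_iterate_turn x 1
  have h6 : (T.turn x).2.corner = 0 := by rw [turn, fl1, Fl.corner_r1]; exact h
  have hc := T.cls_nbr (T.turn x)
  rcases e : T.nbr (T.turn x) with ⟨k, b⟩
  rw [h5, hv, e] at h4
  rw [hv, hx, h6, turn_of_nbr e] at h0
  replace h0 := Nat.le.intro h0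
  rw [e] at hc
  have hb : b = .d3 := by
    generalize T.turn x = y at *
    obtain ⟨i, a⟩ := y
    cases a <;> simp [Fl.corner] at h6 <;> cases b <;>
      simp [Fl.cls, Fl.corner, Fl.r1] at hc h0 h4 ⊢
  subst hb
  rw [turn_of_nbr e, Fl.r1, hC.turn_d2] at ht
  have h7 := congrArg fl1 ht
  rw [turn, fl1_fl1] at h7
  have h8 := hC.sc_sc k
  refine ⟨T.sc k, nbr_symm h7, ?_⟩
  rw [hC.sc_sc]
  exact e

/-- The tiles at a vertex `β²δ²`. -/
theorem beta_delta (hC : T.GammaFour) {i j : Fin f} (hv : T.vt (i, .b0) = ![0, 2, 0, 2])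
    (h : T.nbr (i, .b0) = (j, .d3)) : T.nbr (T.sb i, .b0) = (T.sc j, .d3) := by
  have hd : T.deg (i, .b0) = 4 := by rw [deg_of_vt hv]; simp [Fin.sum_univ_four]
  have ht := turn_fourth hd
  have h2 := hC.turn_b1 (T.sb i)
  rw [hC.sb_sb] at h2
  rw [turn_of_nbr h, Fl.r1, hC.turn_d2, ← h2] at ht
  have h1 := congrArg fl1 (T.turn_injective ht)
  rw [turn, fl1_fl1] at h1
  exact nbr_symm h1

/-! ### Links -/

theorem nbr_a3_of_nbr_a0 (hC : T.GammaFour) (hAB : T.AlphaBeta) {i j : Fin f}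
    (h : T.nbr (i, .a0) = (j, .b0)) : T.nbr (i, .a3) = (T.sb j, .b0) := by
  have h1 := T.vt_nbr_pos (i, .a0)
  rw [h] at h1
  obtain ⟨j', h2, h3⟩ := hC.alpha_beta_beta (x := (i, .a0)) rfl (hAB _ (T.vt_pos (i, .a0)) h1)
  rw [h] at h2
  obtain rfl : j = j' := congrArg Prod.fst h2
  exact h3

/-- Two tiles are linked if the side `AB` of each is the side `BA` of the other. -/
theorem link_symm {i j : Fin f} (h : T.nbr (i, .a0) = (j, .b0)) : T.nbr (j, .a0) = (i, .b0) :=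
  nbr_symm (nbr_r0_of_eq h)

/-- The tile across `BC` from a linked tile has its side `AB` on the side `DA` of the other tile. -/
theorem link_sb (hC : T.GammaFour) (hAB : T.AlphaBeta) {i j : Fin f}
    (h : T.nbr (i, .a0) = (j, .b0)) : T.nbr (T.sb i, .a0) = (j, .d3) :=
  nbr_r0_of_eq (nbr_symm (hC.nbr_a3_of_nbr_a0 hAB (link_symm h)))

theorem link_of_sb (hC : T.GammaFour) (hAB : T.AlphaBeta) {i j : Fin f}
    (h : T.nbr (i, .a0) = (j, .d3)) : T.nbr (T.sb i, .a0) = (j, .b0) := by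
  have h0 : T.nbr (j, .a3) = (i, .b0) := nbr_symm (nbr_r0_of_eq h)
  have h1 := T.vt_nbr_pos (j, .a3)
  rw [h0] at h1
  obtain ⟨j', h2, h3⟩ := hC.alpha_beta_beta (x := (j, .a3)) rfl (hAB _ (T.vt_pos (j, .a3)) h1)
  rw [h0] at h2
  obtain rfl : i = j' := congrArg Prod.fst h2
  exact link_symm h3

end GammaFour

end Tiling
end SphereTiling

namespace SphereTiling

open Set

namespace Tiling

variable {f : ℕ} {T : Tiling f}

/-! ### Generators of the symmetry group -/

theorem exists_tile (T : Tiling f) : Nonempty (Fin f) := by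
  obtain ⟨x⟩ : Nonempty S2 := ⟨⟨EuclideanSpace.single 0 1, by simp⟩⟩
  obtain ⟨i, -⟩ := T.exists_mem_region x
  exact ⟨i⟩

theorem nbr_eq_of_mem {g : O3} (h : g ∈ T.symmetryGroup) {i j k : Fin f} {a b : Fl}
    (hg : T.Maps g i j) (hn : T.nbr (i, a) = (k, b)) :
    ∃ l, T.nbr (j, a) = (l, b) ∧ T.Maps g k l := by
  obtain ⟨h1, h2⟩ := nbr_of_mem h hg a
  rw [hn] at h1 h2
  exact ⟨_, Prod.ext rfl h1, h2⟩

theorem nbr_inv_of_mem {g : O3} (h : g ∈ T.symmetryGroup) {d d' j : Fin f} {a b : Fl}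
    (hg : T.Maps g d' j) (hn : T.nbr (d, a) = (j, b)) :
    ∃ j', T.nbr (d', b) = (j', a) ∧ T.Maps g⁻¹ d j' :=
  nbr_eq_of_mem (inv_mem h) hg.inv (nbr_symm hn)

/-- Symmetries commute with the passage around a vertex. -/
theorem turn_of_mem {g : O3} (h : g ∈ T.symmetryGroup) {i j : Fin f} (hg : T.Maps g i j) (a : Fl)
    (m : ℕ) : (T.turn^[m] (j, a)).2 = (T.turn^[m] (i, a)).2 ∧
      T.Maps g (T.turn^[m] (i, a)).1 (T.turn^[m] (j, a)).1 := by
  induction m with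
  | zero => exact ⟨rfl, hg⟩
  | succ m ih =>
    rw [Function.iterate_succ_apply', Function.iterate_succ_apply']
    generalize T.turn^[m] (i, a) = x at *
    generalize T.turn^[m] (j, a) = y at *
    obtain ⟨i', b⟩ := x
    obtain ⟨j', b'⟩ := y
    obtain ⟨h1, h2⟩ := ih
    obtain rfl : b' = b := h1
    obtain ⟨h3, h4⟩ := nbr_of_mem h h2 b'
    exact ⟨congrArg Fl.r1 h3, h4⟩

/-- The order of a rotation about a vertex which takes each tile `p` steps further. -/
theorem orderOf_of_turn {ρ : O3} (hρ : ρ ∈ T.symmetryGroup) {o o' : Fin f} {a : Fl} {p n : ℕ}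
    (h : T.turn^[p] (o, a) = (o', a)) (hm : T.Maps ρ o o') (hd : T.deg (o, a) = p * n) :
    orderOf ρ = n := by
  have hp : 0 < p := Nat.pos_of_ne_zero fun h0 => by
    have := T.deg_pos (o, a); rw [hd, h0, zero_mul] at this; exact this.false
  have key : ∀ m, ∃ j, T.turn^[p * m] (o, a) = (j, a) ∧ T.Maps (ρ ^ m) o j := by
    intro m
    induction m with
    | zero => exact ⟨o, rfl, by rw [pow_zero]; exact maps_one o⟩
    | succ m ih =>
      obtain ⟨j, h1, h2⟩ := ih
      obtain ⟨h3, h4⟩ := turn_of_mem (pow_mem hρ m) h2 a p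
      rw [h] at h3 h4
      refine ⟨(T.turn^[p] (j, a)).1, ?_, ?_⟩
      · rw [mul_add, mul_one, add_comm, Function.iterate_add_apply, h1]
        exact Prod.ext rfl h3
      · rw [pow_succ]; exact h4.mul hm
  apply Nat.dvd_antisymm
  · rw [orderOf_dvd_iff_pow_eq_one]
    obtain ⟨j, h1, h2⟩ := key n
    rw [← hd, iterate_turn_deg] at h1
    obtain rfl : o = j := congrArg Prod.fst h1
    exact h2.eq_one
  · obtain ⟨j, h1, h2⟩ := key (orderOf ρ)
    rw [pow_orderOf_eq_one] at h2
    obtain rfl := (maps_one o).target_unique h2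
    have h3 : T.deg (o, a) ∣ p * orderOf ρ := Function.IsPeriodicPt.minimalPeriod_dvd h1
    rw [hd] at h3
    exact Nat.dvd_of_mul_dvd_mul_left hp h3

/-- If the neighbours of the tiles in `D` are images of tiles in `D` under a group `H` of
symmetries, and no other tile in `D` is equivalent to `o ∈ D`, then `H` contains all the
symmetries. -/
theorem symmetryGroup_eq {H : Subgroup O3} (hH : H ≤ T.symmetryGroup) {D : Set (Fin f)}
    (hD : ∀ d ∈ D, ∀ a : Fl, a = .a0 ∨ a = .a3 ∨ a = .b1 ∨ a = .c2 →
      ∃ h ∈ H, ∃ d' ∈ D, T.Maps h d' (T.nbr (d, a)).1)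
    {o : Fin f} (ho : o ∈ D) (hne : ∀ d ∈ D, ∀ g ∈ T.symmetryGroup, T.Maps g o d → o = d) :
    T.symmetryGroup = H := by
  refine le_antisymm (fun g hg => ?_) hH
  have hD' : ∀ d ∈ D, ∀ a : Fl, ∃ h ∈ H, ∃ d' ∈ D, T.Maps h d' (T.nbr (d, a)).1 := by
    intro d hd a
    have h1 := hD d hd .a0 (by simp)
    have h2 := hD d hd .a3 (by simp)
    have h3 := hD d hd .b1 (by simp)
    have h4 := hD d hd .c2 (by simp)
    have e : ∀ a : Fl, (T.nbr (d, a.r0)).1 = (T.nbr (d, a)).1 := fun a => by rw [T.nbr_r0]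
    have e1 : (T.nbr (d, .b0)).1 = (T.nbr (d, .a0)).1 := e .a0
    have e2 : (T.nbr (d, .d3)).1 = (T.nbr (d, .a3)).1 := e .a3
    have e3 : (T.nbr (d, .c1)).1 = (T.nbr (d, .b1)).1 := e .b1
    have e4 : (T.nbr (d, .d2)).1 = (T.nbr (d, .c2)).1 := e .c2
    cases a
    · exact h1
    · exact h2
    · rw [e1]; exact h1
    · exact h3
    · rw [e3]; exact h3
    · exact h4
    · rw [e4]; exact h4
    · rw [e2]; exact h2
  obtain ⟨j, hj⟩ := exists_maps_of_mem hg o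
  obtain ⟨h, hh, d, hd, hm⟩ := T.eq_univ_of_nbr (J := {j | ∃ h ∈ H, ∃ d ∈ D, T.Maps h d j})
    ⟨o, 1, one_mem _, o, ho, maps_one o⟩ (by
      rintro j ⟨h, hh, d, hd, hm⟩ a
      obtain ⟨h', hh', d', hd', hm'⟩ := hD' d hd a
      exact ⟨h * h', mul_mem hh hh', d', hd', (nbr_of_mem (hH hh) hm a).2.mul hm'⟩) j
  obtain rfl := hne d hd _ (mul_mem (inv_mem (hH hh)) hg) (hm.inv.mul hj)
  rwa [hj.unique hm]

theorem symmetryGroup_eq_of_generators {S : Set O3} (hS : S ⊆ T.symmetryGroup) {D : Set (Fin f)}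
    (hD : ∀ d ∈ D, ∀ a : Fl, a = .a0 ∨ a = .a3 ∨ a = .b1 ∨ a = .c2 →
      ∃ h ∈ Subgroup.closure S, ∃ d' ∈ D, T.Maps h d' (T.nbr (d, a)).1)
    {o : Fin f} (ho : o ∈ D) (hne : ∀ d ∈ D, ∀ g ∈ T.symmetryGroup, T.Maps g o d → o = d) :
    T.symmetryGroup = Subgroup.closure S :=
  symmetryGroup_eq ((Subgroup.closure_le _).mpr hS) hD ho hne

/-- If the tiles of a tiling with `γ⁴` can be labelled in such a way that the label of a tile
determines the labels of its neighbours and the way in which they are attached, then the isometry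
between two tiles with the same label is a symmetry. -/
theorem GammaFour.mem_symmetryGroup_of_label (hC : T.GammaFour) {Λ : Type*} (L : Λ → Fin f → Prop)
    (hL : ∀ l, ∃ (t0 t3 : Fl) (l0 l3 lb lc : Λ), ∀ i, L l i →
      (∃ j, T.nbr (i, .a0) = (j, t0) ∧ L l0 j) ∧ (∃ j, T.nbr (i, .a3) = (j, t3) ∧ L l3 j) ∧
      L lb (T.sb i) ∧ L lc (T.sc i))
    {l : Λ} {i j : Fin f} (hi : L l i) (hj : L l j) {g : O3} (hg : T.Maps g i j) :
    g ∈ T.symmetryGroup := by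
  refine mem_symmetryGroup_of_rel (R := fun i j => ∃ l, L l i ∧ L l j) ?_ ⟨l, hi, hj⟩ hg
  rintro i j ⟨l, hi, hj⟩ a
  obtain ⟨t0, t3, l0, l3, lb, lc, h⟩ := hL l
  obtain ⟨⟨i0, hi0, hi0'⟩, ⟨i3, hi3, hi3'⟩, hib, hic⟩ := h i hi
  obtain ⟨⟨j0, hj0, hj0'⟩, ⟨j3, hj3, hj3'⟩, hjb, hjc⟩ := h j hj
  have hi0r := nbr_r0_of_eq hi0
  have hi3r := nbr_r0_of_eq hi3
  have hj0r := nbr_r0_of_eq hj0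
  have hj3r := nbr_r0_of_eq hj3
  cases a <;> simp only [Fl.r0] at hi0r hi3r hj0r hj3r
  · rw [hi0, hj0]; exact ⟨rfl, _, hi0', hj0'⟩
  · rw [hi3, hj3]; exact ⟨rfl, _, hi3', hj3'⟩
  · rw [hi0r, hj0r]; exact ⟨rfl, _, hi0', hj0'⟩
  · rw [hC.nbr_b1, hC.nbr_b1]; exact ⟨rfl, _, hib, hjb⟩
  · rw [hC.nbr_c1, hC.nbr_c1]; exact ⟨rfl, _, hib, hjb⟩
  · rw [hC.nbr_c2, hC.nbr_c2]; exact ⟨rfl, _, hic, hjc⟩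
  · rw [hC.nbr_d2, hC.nbr_d2]; exact ⟨rfl, _, hic, hjc⟩
  · rw [hi3r, hj3r]; exact ⟨rfl, _, hi3', hj3'⟩

theorem GammaFour.sb_of_mem (hC : T.GammaFour) {g : O3} (h : g ∈ T.symmetryGroup) {i j : Fin f}
    (hg : T.Maps g i j) : T.Maps g (T.sb i) (T.sb j) := by
  obtain ⟨l, h1, h2⟩ := nbr_eq_of_mem h hg (hC.nbr_c1 i)
  rw [hC.nbr_c1] at h1
  rwa [show T.sb j = l from congrArg Prod.fst h1]

theorem GammaFour.sc_of_mem (hC : T.GammaFour) {g : O3} (h : g ∈ T.symmetryGroup) {i j : Fin f}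
    (hg : T.Maps g i j) : T.Maps g (T.sc i) (T.sc j) := by
  obtain ⟨l, h1, h2⟩ := nbr_eq_of_mem h hg (hC.nbr_c2 i)
  rw [hC.nbr_c2] at h1
  rwa [show T.sc j = l from congrArg Prod.fst h1]

theorem Maps.isHalfTurn {g : O3} {i j : Fin f} (hg : T.Maps g i j) {a : Fl}
    (h : T.nbr (i, a) = (j, a.r0)) : ∃ m ∈ (T.tile i).openSide a.side, IsHalfTurn g m := by
  obtain ⟨m, hm, h1⟩ := hg.half_turn h
  exact ⟨m, hm, norm_coe_S2 m, h1⟩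

theorem Maps.isReflection {g : O3} {i j : Fin f} (hg : T.Maps g i j) {a : Fl}
    (h : T.nbr (i, a) = (j, a)) : ∃ n, IsReflection g n := by
  obtain ⟨n, hn, h1⟩ := hg.reflection h
  exact ⟨n, hn, h1⟩

/-! ### Counting vertices -/

theorem finite_vertices (T : Tiling f) : T.vertices.Finite := by
  apply (Set.finite_range fun p : Fin f × Fin 4 => (T.tile p.1).corner p.2).subset
  rintro _ ⟨i, k, rfl⟩
  exact ⟨(i, k), rfl⟩

theorem sum_vertexType (T : Tiling f) (k : Fin 4) :
    ∑ v ∈ T.finite_vertices.toFinset, T.vertexType v k = f := by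
  classical
  have h := Finset.card_eq_sum_card_fiberwise (s := (Finset.univ : Finset (Fin f)))
    (t := T.finite_vertices.toFinset) (f := fun i => (T.tile i).corner k)
    (fun i _ => by simpa using ⟨i, k, rfl⟩)
  rw [Finset.card_univ, Fintype.card_fin] at h
  refine Eq.trans ?_ h.symm
  refine Finset.sum_congr rfl fun v _ => ?_
  rw [vertexType, ← Set.ncard_coe_finset]
  congr 1
  ext i
  simp

/-- If a linear function of the angles at a vertex vanishes at all vertices except those of
certain types, where it has the value `s`, then the number of these vertices is determined. -/
theorem mul_ncard_vertices (T : Tiling f) (w : Fin 4 → ℤ) (s : ℤ) (P : (Fin 4 → ℕ) → Prop)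
    (h1 : ∀ x, P (T.vt x) → ∑ k, w k * T.vt x k = s)
    (h0 : ∀ x, ¬ P (T.vt x) → ∑ k, w k * T.vt x k = 0) :
    s * ({v | v ∈ T.vertices ∧ P (T.vertexType v)}.ncard : ℤ) = f * ∑ k, w k := by
  classical
  have e1 : ∑ v ∈ T.finite_vertices.toFinset, ∑ k, w k * (T.vertexType v k : ℤ) = f * ∑ k, w k := by
    rw [Finset.sum_comm, Finset.mul_sum]
    refine Finset.sum_congr rfl fun k _ => ?_
    rw [← Finset.mul_sum, ← Nat.cast_sum, sum_vertexType, mul_comm]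
  rw [← e1]
  have e2 : ∀ v ∈ T.finite_vertices.toFinset, ∑ k, w k * (T.vertexType v k : ℤ) =
      if P (T.vertexType v) then s else 0 := by
    intro v hv
    obtain ⟨i, k, rfl⟩ := T.finite_vertices.mem_toFinset.mp hv
    obtain ⟨a, rfl⟩ := Fl.exists_corner k
    split_ifs with hP
    · exact h1 (i, a) hP
    · exact h0 (i, a) hP
  rw [Finset.sum_congr rfl e2, ← Finset.sum_filter, Finset.sum_const, nsmul_eq_mul, mul_comm,
    ← Set.ncard_coe_finset]
  congr 3
  ext v
  simp

/-- The symmetry group acts freely on the vertices at which there is a single angle `α`. -/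
theorem card_symmetryGroup_le (T : Tiling f) {t : Fin 4 → ℕ} (ht : t 0 = 1) (hmem : t ∈ T.avc) :
    Finite T.symmetryGroup ∧
      Nat.card T.symmetryGroup ≤ {v | v ∈ T.vertices ∧ T.vertexType v = t}.ncard := by
  obtain ⟨x, hx⟩ := T.exists_flag_of_mem_avc hmem
  obtain ⟨i, hi⟩ := T.exists_flag_corner .a0 (x := x) (by rw [hx]; change 0 < t 0; omega)
  have hi' : T.vertexType ((T.tile i).corner 0) = t := by rw [← hx, ← hi]; rfl
  have hfin : {v | v ∈ T.vertices ∧ T.vertexType v = t}.Finite :=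
    T.finite_vertices.subset fun v hv => hv.1
  let φ : T.symmetryGroup → {v | v ∈ T.vertices ∧ T.vertexType v = t} := fun g =>
    ⟨act g.1 ((T.tile i).corner 0), by
      obtain ⟨j, hj⟩ := exists_maps_of_mem g.2 i
      exact ⟨j, 0, hj.2 0⟩, by rw [vertexType_act g.2, hi']⟩
  have hφ : Function.Injective φ := by
    intro g g' h
    obtain ⟨j, hj⟩ := exists_maps_of_mem g.2 i
    obtain ⟨j', hj'⟩ := exists_maps_of_mem g'.2 i
    have h1 : (T.tile j).corner 0 = (T.tile j').corner 0 := by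
      rw [← hj.2, ← hj'.2]; exact congrArg Subtype.val h
    have h2 : T.vertexType ((T.tile j).corner 0) = t := by
      rw [← hj.2, vertexType_act g.2, hi']
    have h3 : {i : Fin f | (T.tile i).corner 0 = (T.tile j).corner 0}.ncard = 1 := by
      rw [← ht, ← h2]; rfl
    obtain ⟨q, hq⟩ := Set.ncard_eq_one.mp h3
    have h4 : j ∈ ({q} : Set (Fin f)) := by rw [← hq]; exact rfl
    have h5 : j' ∈ ({q} : Set (Fin f)) := by rw [← hq]; exact h1.symm
    rw [mem_singleton_iff] at h4 h5
    subst h4 h5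
    exact Subtype.ext (hj.unique hj')
  have : Finite {v | v ∈ T.vertices ∧ T.vertexType v = t} := hfin
  exact ⟨Finite.of_injective φ hφ, Nat.card_le_card_of_injective φ hφ⟩

/-! ### Earth map tilings -/

/-- Around a vertex the corners of two consecutive tiles are different if the first corner occurs
only once. -/
theorem corner_nbr_ne {x : Fin f × Fl} (h : T.vt x x.2.corner = 1) :
    (T.nbr x).2.corner ≠ x.2.corner := by
  intro h1
  have h2 : (T.turn x).2.corner = x.2.corner := by rw [turn, fl1, Fl.corner_r1, h1]
  have h3 := sum_corner (T := T) x x.2.corner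
  obtain ⟨s, hs⟩ := Nat.exists_eq_add_of_le (T.three_le_deg x)
  rw [h, hs, add_comm 3 s, Finset.sum_range_succ', Finset.sum_range_succ'] at h3
  simp only [zero_add, Function.iterate_succ_apply', Function.iterate_zero_apply, h2, if_true] at h3
  omega

/-- All tiles are attached to their neighbours in the same way, so the symmetry group acts simply
transitively on them. It is generated by the half-turns about the midpoints of the sides `BC` and
`CD` of a tile, whose product is the rotation to the next tile around a vertex `α^(f / 2)`. -/
theorem two_dvd_and_conjugate_groupD
    (h : T.avc = {![0, 1, 1, 1], ![f / 2, 0, 0, 0]}) :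
    2 ∣ f ∧ Conjugate T.symmetryGroup (groupD (f / 2)) := by
  obtain ⟨n, hn⟩ : ∃ n, n = f / 2 := ⟨_, rfl⟩
  rw [← hn] at h ⊢
  have hv : ∀ x, T.vt x = ![0, 1, 1, 1] ∨ T.vt x = ![n, 0, 0, 0] := by
    intro x
    have := T.vt_mem_avc x
    rwa [h] at this
  have hA : ∀ x : Fin f × Fl, x.2.corner = 0 → T.vt x = ![n, 0, 0, 0] := by
    intro x hx
    refine (hv x).resolve_left fun h1 => ?_
    have h2 := T.vt_pos x
    rw [hx, h1] at h2
    exact absurd h2 (by simp)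
  have hBCD : ∀ x : Fin f × Fl, x.2.corner ≠ 0 → T.vt x = ![0, 1, 1, 1] := by
    intro x hx
    refine (hv x).resolve_right fun h1 => ?_
    have h2 := T.vt_pos x
    rw [h1] at h2
    revert h2 hx
    generalize x.2.corner = k
    fin_cases k <;> simp
  have hn3 : 3 ≤ n := by
    obtain ⟨i⟩ := T.exists_tile
    have h1 := T.three_le_deg (i, .a0)
    rw [deg_of_vt (hA (i, .a0) rfl)] at h1
    simpa [Fin.sum_univ_four] using h1
  -- each vertex `αⁿ` takes up `n` tiles; an odd `f` would leave the remainder `1 < n`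
  have hf : 2 ∣ f := by
    have h1 := T.mul_ncard_vertices ![1, 0, 0, 0] n (· = ![n, 0, 0, 0])
      (fun x hx => by rw [hx]; simp [Fin.sum_univ_four])
      (fun x hx => by rw [(hv x).resolve_right hx]; simp [Fin.sum_univ_four])
    simp only [Fin.sum_univ_four] at h1
    simp at h1
    norm_cast at h1
    have h2 : n ∣ f := ⟨_, h1.symm⟩
    have h3 : n ∣ f % 2 := by
      have h4 : f % 2 = f - n * 2 := by omega
      rw [h4]
      exact Nat.dvd_sub h2 (dvd_mul_right n 2)
    have h5 : f % 2 = 0 := by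
      by_contra h6
      have := Nat.le_of_dvd (Nat.pos_of_ne_zero h6) h3
      omega
    exact Nat.dvd_of_mod_eq_zero h5
  refine ⟨hf, ?_⟩
  -- all tiles are attached in the same way
  have hne : ∀ (i : Fin f) (a : Fl), a.corner ≠ 0 →
      0 < (![0, 1, 1, 1] : Fin 4 → ℕ) (T.nbr (i, a)).2.corner ∧
      (T.nbr (i, a)).2.corner ≠ a.corner ∧ (T.nbr (i, a)).2.cls = a.cls := by
    intro i a ha
    have h1 := hBCD (i, a) ha
    have h2 := T.vt_nbr_pos (i, a)
    rw [h1] at h2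
    refine ⟨h2, corner_nbr_ne (x := (i, a)) ?_, T.cls_nbr (i, a)⟩
    rw [h1]
    revert ha
    cases a <;> simp [Fl.corner]
  have hb0 : ∀ i, ∃ j, T.nbr (i, .b0) = (j, .d3) := by
    intro i
    have := hne i .b0 (by decide)
    rcases e : T.nbr (i, .b0) with ⟨j, b⟩
    rw [e] at this
    exact ⟨j, by cases b <;> simp [Fl.corner, Fl.cls] at this ⊢⟩
  have hd3 : ∀ i, ∃ j, T.nbr (i, .d3) = (j, .b0) := by
    intro i
    have := hne i .d3 (by decide)
    rcases e : T.nbr (i, .d3) with ⟨j, b⟩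
    rw [e] at this
    exact ⟨j, by cases b <;> simp [Fl.corner, Fl.cls] at this ⊢⟩
  have hb1 : ∀ i, ∃ j, T.nbr (i, .b1) = (j, .c1) := by
    intro i
    have := hne i .b1 (by decide)
    rcases e : T.nbr (i, .b1) with ⟨j, b⟩
    rw [e] at this
    exact ⟨j, by cases b <;> simp [Fl.corner, Fl.cls] at this ⊢⟩
  have hc2 : ∀ i, ∃ j, T.nbr (i, .c2) = (j, .d2) := by
    intro i
    have := hne i .c2 (by decide)
    rcases e : T.nbr (i, .c2) with ⟨j, b⟩
    rw [e] at this
    exact ⟨j, by cases b <;> simp [Fl.corner, Fl.cls] at this ⊢⟩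
  have hsame : ∀ i j a, (T.nbr (i, a)).2 = (T.nbr (j, a)).2 := by
    have key : ∀ a b, (∀ i, ∃ j, T.nbr (i, a) = (j, b)) → ∀ i, (T.nbr (i, a)).2 = b ∧
        (T.nbr (i, a.r0)).2 = b.r0 := by
      intro a b hab i
      obtain ⟨j, hj⟩ := hab i
      exact ⟨by rw [hj], by rw [nbr_r0_of_eq hj]⟩
    have k1 := key _ _ hb0
    have k2 := key _ _ hd3
    have k3 := key _ _ hb1
    have k4 := key _ _ hc2
    intro i j a
    cases a
    · exact (k1 i).2.trans (k1 j).2.symm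
    · exact (k2 i).2.trans (k2 j).2.symm
    · exact (k1 i).1.trans (k1 j).1.symm
    · exact (k3 i).1.trans (k3 j).1.symm
    · exact (k3 i).2.trans (k3 j).2.symm
    · exact (k4 i).1.trans (k4 j).1.symm
    · exact (k4 i).2.trans (k4 j).2.symm
    · exact (k2 i).1.trans (k2 j).1.symm
  have hmem : ∀ {g i j}, T.Maps g i j → g ∈ T.symmetryGroup := fun hg =>
    mem_symmetryGroup_of_rel (R := fun _ _ => True) (fun i j _ a => ⟨hsame i j a, trivial⟩)
      trivial hg
  obtain ⟨o⟩ := T.exists_tile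
  obtain ⟨p, hp⟩ := hb1 o
  obtain ⟨q, hq⟩ := hc2 o
  obtain ⟨η, hη⟩ := T.exists_maps o p
  obtain ⟨κ, hκ⟩ := T.exists_maps o q
  obtain ⟨m, -, hηm⟩ := hη.isHalfTurn hp
  obtain ⟨m', -, hκm⟩ := hκ.isHalfTurn hq
  -- the tiles at the vertex `βγδ`
  obtain ⟨r, hr, hηκ⟩ := nbr_eq_of_mem (hmem hη) hη hq
  replace hηκ : T.Maps (η * κ) o r := hηκ.mul hκ
  have hBC : T.nbr (o, .a0) = (r, .a3) := by
    have hd : T.deg (o, .b1) = 3 := by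
      rw [deg_of_vt (hBCD (o, .b1) (by simp [Fl.corner]))]; simp [Fin.sum_univ_four]
    have h1 := turn_cube hd
    rw [turn_of_nbr hp, Fl.r1, turn_of_nbr hr, Fl.r1] at h1
    have h2 := congrArg fl1 h1
    rw [turn, fl1_fl1] at h2
    exact nbr_r0_of_eq (nbr_symm h2)
  have hord : orderOf (η * κ) = n := by
    refine orderOf_of_turn (T := T) (o := o) (a := .a0) (p := 1) (hmem hηκ) ?_ hηκ ?_
    · exact turn_of_nbr hBC
    · rw [deg_of_vt (hA (o, .a0) rfl)]; simp [Fin.sum_univ_four]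
  have hG : T.symmetryGroup = Subgroup.closure {η, κ} := by
    have h1 : η ∈ Subgroup.closure {η, κ} := Subgroup.subset_closure (by simp)
    have h2 : κ ∈ Subgroup.closure {η, κ} := Subgroup.subset_closure (by simp)
    refine symmetryGroup_eq_of_generators (D := {o}) ?_ ?_ (mem_singleton o) ?_
    · rintro _ (rfl | rfl)
      · exact hmem hη
      · exact hmem hκ
    · rintro d rfl a ha
      rcases ha with rfl | rfl | rfl | rfl
      · exact ⟨_, mul_mem h1 h2, d, rfl, by rw [hBC]; exact hηκ⟩
      · obtain ⟨j, hj, hj'⟩ := nbr_inv_of_mem (hmem hηκ) hηκ hBC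
        exact ⟨_, inv_mem (mul_mem h1 h2), d, rfl, by rw [hj]; exact hj'⟩
      · exact ⟨_, h1, d, rfl, by rw [hp]; exact hη⟩
      · exact ⟨_, h2, d, rfl, by rw [hq]; exact hκ⟩
    · rintro d rfl - - -; rfl
  rw [hG]
  exact conjugate_groupD hηm hκm (by omega) hord

/-! ### The quadrilateral subdivision of the cube -/

/-- All tiles are attached to their neighbours in the same way, so the symmetry group acts simply
transitively on them. It is generated by a rotation `ρ` about a vertex `α³` and the reflection `r`
in a side `CD`. The vertices `β²δ²` show that `ρ` conjugates `r` to the reflection in the side `BC`,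
and the vertices `γ⁴` that these two reflections commute. -/
theorem conjugate_groupTh_of_avc
    (h : T.avc = {![3, 0, 0, 0], ![0, 2, 0, 2], ![0, 0, 4, 0]}) :
    Conjugate T.symmetryGroup groupTh := by
  have hv : ∀ x, T.vt x = ![3, 0, 0, 0] ∨ T.vt x = ![0, 2, 0, 2] ∨ T.vt x = ![0, 0, 4, 0] := by
    intro x
    have := T.vt_mem_avc x
    rwa [h] at this
  have hC : T.GammaFour := by
    intro x hx
    rcases hv x with h1 | h1 | h1 <;> rw [h1] at hx ⊢ <;> simp at hx ⊢
  have hA : ∀ x, 0 < T.vt x 0 → T.vt x = ![3, 0, 0, 0] := by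
    intro x hx
    rcases hv x with h1 | h1 | h1 <;> rw [h1] at hx ⊢ <;> simp at hx ⊢
  have hB : ∀ x, 0 < T.vt x 1 → T.vt x = ![0, 2, 0, 2] := by
    intro x hx
    rcases hv x with h1 | h1 | h1 <;> rw [h1] at hx ⊢ <;> simp at hx ⊢
  have hD : ∀ x, 0 < T.vt x 3 → T.vt x = ![0, 2, 0, 2] := by
    intro x hx
    rcases hv x with h1 | h1 | h1 <;> rw [h1] at hx ⊢ <;> simp at hx ⊢
  have h0 : ∀ i, T.nbr (i, .a0) = (T.lk i, .a3) := by
    intro i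
    have h1 := T.vt_nbr_pos (i, .a0)
    rw [hA _ (T.vt_pos (i, .a0))] at h1
    rcases e : T.nbr (i, .a0) with ⟨j, b⟩
    rw [lk, e]
    have h2 := cls_of_nbr e
    rw [e] at h1
    cases b <;> simp [Fl.corner, Fl.cls] at h1 h2 ⊢
    have h3 := hC.three_le_beta (nbr_r0_of_eq e)
    have h4 := hB _ (T.vt_pos (i, .b0))
    rw [h4] at h3
    simp at h3
  have h3 : ∀ i, ∃ j, T.nbr (i, .a3) = (j, .a0) := by
    intro i
    have h1 := T.vt_nbr_pos (i, .a3)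
    rw [hA _ (T.vt_pos (i, .a3))] at h1
    rcases e : T.nbr (i, .a3) with ⟨j, b⟩
    refine ⟨j, ?_⟩
    have h2 := cls_of_nbr e
    rw [e] at h1
    cases b <;> simp [Fl.corner, Fl.cls] at h1 h2 ⊢
    have h3 := hC.three_le_delta (nbr_r0_of_eq e)
    have h4 := hD _ (T.vt_pos (i, .d3))
    rw [h4] at h3
    simp at h3
  have hmem : ∀ {g i j}, T.Maps g i j → g ∈ T.symmetryGroup := fun hg =>
    hC.mem_symmetryGroup_of_label (fun (_ : Unit) _ => True)
      (fun _ => ⟨.a3, .a0, (), (), (), (), fun i _ => ⟨⟨_, h0 i, trivial⟩,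
        ⟨_, (h3 i).choose_spec, trivial⟩, trivial, trivial⟩⟩) (l := ()) trivial trivial hg
  obtain ⟨o⟩ := T.exists_tile
  obtain ⟨ρ, hρ⟩ := T.exists_maps o (T.lk o)
  obtain ⟨r, hr⟩ := T.exists_maps o (T.sc o)
  obtain ⟨r', hr'⟩ := T.exists_maps o (T.sb o)
  obtain ⟨ν, hν⟩ := hr.isReflection (hC.nbr_c2 o)
  have hord : orderOf ρ = 3 := by
    refine orderOf_of_turn (T := T) (o := o) (a := .a0) (p := 1) (hmem hρ) ?_ hρ ?_
    · exact turn_of_nbr (h0 o)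
    · rw [deg_of_vt (hA (o, .a0) (T.vt_pos (o, .a0)))]; simp [Fin.sum_univ_four]
  -- the relation at a vertex `β²δ²`
  have hrel : ρ * r * ρ⁻¹ = r' := by
    have e1 : T.nbr (o, .b0) = (T.lk o, .d3) := nbr_r0_of_eq (h0 o)
    have e2 := hC.beta_delta (hB _ (T.vt_pos (o, .b0))) e1
    have e3 : T.nbr (T.sb o, .b0) = (T.lk (T.sb o), .d3) := nbr_r0_of_eq (h0 _)
    have e4 : T.lk (T.sb o) = T.sc (T.lk o) := by
      rw [e3] at e2; exact (Prod.mk.inj e2).1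
    have e5 : T.Maps (r' * ρ) o (T.lk (T.sb o)) := by
      obtain ⟨l, k1, k2⟩ := nbr_eq_of_mem (hmem hr') hr' (h0 o)
      rw [h0] at k1
      rw [show T.lk (T.sb o) = l from congrArg Prod.fst k1]
      exact k2.mul hρ
    have e6 : T.Maps (ρ * r) o (T.sc (T.lk o)) := (hC.sc_of_mem (hmem hρ) hρ).mul hr
    rw [e4] at e5
    rw [e6.unique e5, mul_inv_cancel_right]
  have hcomm : r * r' = r' * r := by
    have e1 : T.Maps (r * r') o (T.sb (T.sc o)) := (hC.sb_of_mem (hmem hr) hr).mul hr'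
    have e2 : T.Maps (r' * r) o (T.sc (T.sb o)) := (hC.sc_of_mem (hmem hr') hr').mul hr
    rw [hC.sb_sc] at e1
    exact e1.unique e2
  have hne : r ≠ r' := by
    rintro rfl
    exact hC.sb_ne_sc o (hr'.target_unique hr)
  have hG : T.symmetryGroup = Subgroup.closure {ρ, r} := by
    have h1 : ρ ∈ Subgroup.closure {ρ, r} := Subgroup.subset_closure (by simp)
    have h2 : r ∈ Subgroup.closure {ρ, r} := Subgroup.subset_closure (by simp)
    refine symmetryGroup_eq_of_generators (D := {o}) ?_ ?_ (mem_singleton o) ?_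
    · rintro _ (rfl | rfl)
      · exact hmem hρ
      · exact hmem hr
    · rintro d rfl a ha
      rcases ha with rfl | rfl | rfl | rfl
      · exact ⟨_, h1, d, rfl, by rw [h0]; exact hρ⟩
      · obtain ⟨j, hj, hj'⟩ := nbr_inv_of_mem (hmem hρ) hρ (h0 d)
        exact ⟨_, inv_mem h1, d, rfl, by rw [hj]; exact hj'⟩
      · exact ⟨_, mul_mem (mul_mem h1 h2) (inv_mem h1), d, rfl, by
          rw [hC.nbr_b1, hrel]; exact hr'⟩
      · exact ⟨_, h2, d, rfl, by rw [hC.nbr_c2]; exact hr⟩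
    · rintro d rfl - - -; rfl
  rw [hG]
  refine conjugate_groupTh hν ?_ hrel hcomm hne
  have := pow_orderOf_eq_one ρ
  rwa [hord] at this

/-! ### Neighbours along the side `AB` -/

theorem fst_eq_of_nbr {x : Fin f × Fl} {i j : Fin f} {a b : Fl} (h : T.nbr x = (i, a))
    (h' : T.nbr x = (j, b)) : i = j := (Prod.mk.inj (h.symm.trans h')).1

theorem snd_eq_of_nbr {x : Fin f × Fl} {i j : Fin f} {a b : Fl} (h : T.nbr x = (i, a))
    (h' : T.nbr x = (j, b)) : a = b := (Prod.mk.inj (h.symm.trans h')).2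

theorem nbr_a0 {i : Fin f} {t : Fl} (h : (T.nbr (i, .a0)).2 = t) : T.nbr (i, .a0) = (T.lk i, t) :=
  Prod.ext rfl h

theorem snd_nbr {x : Fin f × Fl} {j : Fin f} {t : Fl} (h : T.nbr x = (j, t)) : (T.nbr x).2 = t := by
  rw [h]

/-- If all angles `β` are at vertices `αβ²`, then the side `AB` of each tile is the side `BA` or
the side `DA` of its neighbour. -/
theorem GammaFour.link_or (hC : T.GammaFour) (hB : ∀ x, 0 < T.vt x 1 → T.vt x = ![1, 2, 0, 0])
    (i : Fin f) : (T.nbr (i, .a0)).2 = .b0 ∨ (T.nbr (i, .a0)).2 = .d3 := by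
  have h1 := T.vt_nbr_pos (i, .b0)
  have h4 := hB _ (T.vt_pos (i, .b0))
  rw [h4] at h1
  rcases e : T.nbr (i, .b0) with ⟨j, b⟩
  have h2 := cls_of_nbr e
  rw [e] at h1
  have h5 : T.nbr (i, .a0) = (j, b.r0) := nbr_r0_of_eq e
  rw [h5]
  cases b <;> simp [Fl.corner, Fl.cls, Fl.r0] at h1 h2 ⊢
  have h3 := hC.three_le_beta e
  rw [h4] at h3
  simp at h3

/-- Only the tiles on both sides of an edge contain an inner point of the edge. -/
theorem eq_or_eq_nbr_of_mem_region {i j : Fin f} {a : Fl} {m : S2}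
    (hm : m ∈ (T.tile i).openSide a.side) (h1 : m ∈ (T.tile j).region) :
    j = i ∨ j = (T.nbr (i, a)).1 := by
  by_cases hj : j = i
  · exact Or.inl hj
  · right
    have h2 : m ∈ (T.tile (T.nbr (i, a)).1).region := by
      apply (T.tile _).side_subset_region (T.nbr (i, a)).2.side
      have h3 : m ∈ (T.tile (i, a).1).openSide (i, a).2.side := hm
      rw [(T.isNbr_nbr (i, a)).openSide_eq] at h3
      exact h3.1
    exact T.eq_of_mem_openSide hm h1 h2 hj (T.nbr_fst_ne _)

/-- A symmetry that fixes an inner point of an edge fixes or exchanges the tiles on both sides. -/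
theorem Maps.eq_or_eq_nbr {g : O3} {i j : Fin f} (hg : T.Maps g i j) {a : Fl} {m : S2}
    (hm : m ∈ (T.tile i).openSide a.side) (hfix : g (m : E3) = m) :
    j = i ∨ j = (T.nbr (i, a)).1 := by
  apply eq_or_eq_nbr_of_mem_region hm
  rw [← hg.1]
  exact ⟨m, (T.tile i).side_subset_region _ hm.1, Subtype.ext hfix⟩

/-! ### The `(f / 4, 4)`-earth map tilings -/

/-- The tiles are of two kinds: the side `AB` is the side `BA` or the side `DA` of the neighbour.
The kind of a tile determines the kinds of its neighbours and the way in which they are attached, so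
there are two orbits of tiles. The symmetry group is generated by the half-turn `η` about the
midpoint of an edge `AB`-`BA` and the reflection `r` in a side `CD`. Around a vertex `δ^(f / 4)` the
reflections `r` and `η r η` alternate, so `f / 4` is even, and `f / 8` is the order of their
product. -/
theorem eight_dvd_and_conjugate_groupDv (hf : 4 ∣ f)
    (h : T.avc = {![1, 2, 0, 0], ![2, 0, 0, 2], ![0, 0, 4, 0], ![0, 0, 0, f / 4]}) :
    8 ∣ f ∧ Conjugate T.symmetryGroup (groupDv (f / 8)) := by
  have hv : ∀ x, T.vt x = ![1, 2, 0, 0] ∨ T.vt x = ![2, 0, 0, 2] ∨ T.vt x = ![0, 0, 4, 0] ∨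
      T.vt x = ![0, 0, 0, f / 4] := by
    intro x
    have := T.vt_mem_avc x
    rwa [h] at this
  have hC : T.GammaFour := by
    intro x hx
    rcases hv x with h1 | h1 | h1 | h1 <;> rw [h1] at hx ⊢ <;> simp at hx ⊢
  have hB : ∀ x, 0 < T.vt x 1 → T.vt x = ![1, 2, 0, 0] := by
    intro x hx
    rcases hv x with h1 | h1 | h1 | h1 <;> rw [h1] at hx ⊢ <;> simp at hx ⊢
  have hAB : T.AlphaBeta := fun x _ hx => hB x hx
  have hAD : ∀ x, 0 < T.vt x 0 → 0 < T.vt x 3 → T.vt x = ![2, 0, 0, 2] := by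
    intro x hx hx'
    rcases hv x with h1 | h1 | h1 | h1 <;> rw [h1] at hx hx' ⊢ <;> simp at hx hx' ⊢
  -- in the names, `L` stands for tiles with `AB` on a side `BA`, and `K` for `AB` on a side `DA`
  have hLK := hC.link_or hB
  have hL : ∀ {i}, (T.nbr (i, .a0)).2 = .b0 → T.nbr (i, .a3) = (T.sb (T.lk i), .b0) := fun hi =>
    hC.nbr_a3_of_nbr_a0 hAB (nbr_a0 hi)
  have hLsb : ∀ {i}, (T.nbr (i, .a0)).2 = .b0 → T.nbr (T.sb i, .a0) = (T.lk i, .d3) := fun hi =>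
    hC.link_sb hAB (nbr_a0 hi)
  have hKsb : ∀ {i}, (T.nbr (i, .a0)).2 = .d3 → T.nbr (T.sb i, .a0) = (T.lk i, .b0) := fun hi =>
    hC.link_of_sb hAB (nbr_a0 hi)
  have hK : ∀ {i k}, T.nbr (i, .a0) = (k, .d3) → ∃ j, T.nbr (i, .a3) = (j, .a3) ∧
      T.nbr (j, .a0) = (T.sc k, .d3) := by
    intro i k hi
    have h1 := T.vt_nbr_pos (i, .a0)
    rw [hi] at h1
    obtain ⟨h2, h3⟩ := hC.alpha_delta (x := (i, .a0)) rfl (hAD _ (T.vt_pos (i, .a0)) h1) hi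
    rcases e : T.nbr (T.sc k, .d3) with ⟨j, b⟩
    have h4 := cls_of_nbr e
    rw [e] at h2 h3
    refine ⟨j, ?_⟩
    change T.nbr (i, .a3) = (j, b.r1) at h3
    cases b <;> simp [Fl.corner, Fl.cls] at h2 h4
    · exact ⟨h3, nbr_symm e⟩
    · have h5 := hLK j
      have h6 : T.nbr (j, .a0) = (i, .a3) := nbr_symm h3
      rw [h6] at h5
      simp at h5
  have hLsc : ∀ {i}, (T.nbr (i, .a0)).2 = .b0 → (T.nbr (T.sc i, .a0)).2 = .b0 := by
    intro i hi
    obtain ⟨j, -, h2⟩ := hK (nbr_symm (nbr_r0_of_eq (hL hi)))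
    refine (hLK _).resolve_right fun h3 => ?_
    obtain ⟨l, h4, -⟩ := hK (nbr_a0 h3)
    exact absurd (snd_eq_of_nbr h4 (nbr_symm (nbr_r0_of_eq h2))) (by decide)
  have hKsc : ∀ {i}, (T.nbr (i, .a0)).2 = .d3 → (T.nbr (T.sc i, .a0)).2 = .d3 := by
    intro i hi
    refine (hLK _).resolve_left fun h3 => ?_
    have h4 := hLsc h3
    rw [hC.sc_sc, hi] at h4
    simp at h4
  have hmem : ∀ {g i j} {t : Fl}, (T.nbr (i, .a0)).2 = t → (T.nbr (j, .a0)).2 = t →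
      T.Maps g i j → g ∈ T.symmetryGroup := by
    intro g i j t hi hj hg
    refine hC.mem_symmetryGroup_of_label
      (fun (l : Bool) i => (T.nbr (i, .a0)).2 = bif l then .b0 else .d3) ?_
      (l := decide (t = .b0)) ?_ ?_ hg
    · rintro (_ | _)
      · refine ⟨.d3, .a3, true, false, true, false, fun i (hi : _ = _) => ?_⟩
        obtain ⟨j, h1, h2⟩ := hK (nbr_a0 hi)
        exact ⟨⟨_, nbr_a0 hi, snd_nbr (GammaFour.link_symm (hKsb hi))⟩, ⟨j, h1, snd_nbr h2⟩,
          snd_nbr (hKsb hi), hKsc hi⟩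
      · refine ⟨.b0, .b0, true, false, false, true, fun i (hi : _ = _) => ?_⟩
        have h1 : (T.nbr (T.lk i, .a0)).2 = .b0 := snd_nbr (GammaFour.link_symm (nbr_a0 hi))
        exact ⟨⟨_, nbr_a0 hi, h1⟩, ⟨_, hL hi, snd_nbr (hLsb h1)⟩, snd_nbr (hLsb hi), hLsc hi⟩
    · have := hLK i
      rw [hi] at this ⊢
      rcases this with rfl | rfl <;> rfl
    · have := hLK j
      rw [hj] at this ⊢
      rcases this with rfl | rfl <;> rfl
  obtain ⟨o, ho⟩ : ∃ o, (T.nbr (o, .a0)).2 = .b0 := by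
    obtain ⟨i⟩ := T.exists_tile
    rcases hLK i with hi | hi
    · exact ⟨i, hi⟩
    · exact ⟨_, snd_nbr (hKsb hi)⟩
  have ho' := hLsb ho
  obtain ⟨η, hη⟩ := T.exists_maps o (T.lk o)
  obtain ⟨r, hr⟩ := T.exists_maps o (T.sc o)
  obtain ⟨m, hm, hηm⟩ := hη.isHalfTurn (nbr_a0 ho)
  obtain ⟨ν, hν⟩ := hr.isReflection (hC.nbr_c2 o)
  have hηS : η ∈ T.symmetryGroup :=
    hmem ho (snd_nbr (GammaFour.link_symm (nbr_a0 ho))) hη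
  have hrS : r ∈ T.symmetryGroup := hmem ho (hLsc ho) hr
  have hη' : T.Maps η (T.lk o) o := by rw [← hηm.inv_eq]; exact hη.inv
  have hηr : T.Maps (η * r * η) (T.lk o) (T.sc (T.lk o)) :=
    ((hC.sc_of_mem hηS hη).mul hr).mul hη'
  have hηrS : η * r * η ∈ T.symmetryGroup := mul_mem (mul_mem hηS hrS) hηS
  -- the second reflection
  obtain ⟨p, hp, hpm⟩ : ∃ p, T.nbr (T.sb o, .a3) = (p, .a3) ∧ T.Maps (η * r * η) (T.sb o) p := by
    obtain ⟨j, h1, h2⟩ := hK ho'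
    obtain ⟨l, h3, h4⟩ := nbr_eq_of_mem hηrS hηr (nbr_symm ho')
    obtain rfl := fst_eq_of_nbr (nbr_symm h2) h3
    exact ⟨j, h1, h4⟩
  have hpole : T.vt (T.sb o, .d3) = ![0, 0, 0, f / 4] := by
    have h1 := hC.three_le_delta (nbr_r0_of_eq hp)
    change 3 ≤ T.vt (T.sb o, .d3) 3 at h1
    rcases hv (T.sb o, .d3) with h2 | h2 | h2 | h2 <;> rw [h2] at h1 ⊢ <;> simp at h1 ⊢
  have hdeg : T.deg (T.sb o, .d3) = f / 4 := by
    rw [deg_of_vt hpole]; simp [Fin.sum_univ_four]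
  -- around a vertex `δ^(f / 4)`, passages across `AD` and across `CD` alternate
  have hturn : ∀ {i}, (T.nbr (i, .a0)).2 = .d3 → ∃ j, (T.nbr (j, .a0)).2 = .d3 ∧
      T.turn (i, .d3) = (j, .d2) := by
    intro i hi
    obtain ⟨j, h1, h2⟩ := hK (nbr_a0 hi)
    exact ⟨j, snd_nbr h2, turn_of_nbr (nbr_r0_of_eq h1)⟩
  have heven : 2 ∣ f / 4 := by
    have h1 : ∀ m, ∃ j, (T.nbr (j, .a0)).2 = .d3 ∧ T.turn^[2 * m] (T.sb o, .d3) = (j, .d3) := by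
      intro m
      induction m with
      | zero => exact ⟨_, snd_nbr ho', rfl⟩
      | succ m ih =>
        obtain ⟨j, h1, h2⟩ := ih
        obtain ⟨k, h3, h4⟩ := hturn h1
        refine ⟨T.sc k, hKsc h3, ?_⟩
        rw [show 2 * (m + 1) = 2 * m + 1 + 1 by ring, Function.iterate_succ_apply',
          Function.iterate_succ_apply', h2, h4, hC.turn_d2]
    by_contra h2
    obtain ⟨j, h3, h4⟩ := h1 (f / 4 / 2)
    obtain ⟨k, -, h5⟩ := hturn h3
    have h6 := T.iterate_turn_deg (T.sb o, .d3)
    rw [hdeg, show f / 4 = 2 * (f / 4 / 2) + 1 by omega, Function.iterate_succ_apply', h4, h5] at h6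
    exact absurd (Prod.mk.inj h6).2 (by decide)
  have hpos : 3 ≤ f / 4 := by rw [← hdeg]; exact T.three_le_deg _
  refine ⟨by omega, ?_⟩
  have hord : orderOf (r * (η * r * η)) = f / 8 := by
    have h1 : orderOf (η * r * η * r) = f / 8 := by
      refine orderOf_of_turn (T := T) (o := T.sb o) (o' := T.sc p) (a := .d3) (p := 2)
        (mul_mem hηrS hrS) ?_ ?_ ?_
      · change T.turn (T.turn (T.sb o, .d3)) = _
        have h2 : T.turn (T.sb o, .d3) = (p, .d2) := turn_of_nbr (nbr_r0_of_eq hp)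
        rw [h2, hC.turn_d2]
      · have h2 := hC.sb_of_mem hrS hr
        rw [hC.sb_sc] at h2
        exact (hC.sc_of_mem hηrS hpm).mul h2
      · rw [hdeg]; omega
    have h2 : r * (η * r * η) = r * (η * r * η * r) * r⁻¹ := by group
    rw [h2, ← h1]
    exact (MulAut.conj r).orderOf_eq (η * r * η * r)
  have hG : T.symmetryGroup = Subgroup.closure {η, r} := by
    have h1 : η ∈ Subgroup.closure {η, r} := Subgroup.subset_closure (by simp)
    have h2 : r ∈ Subgroup.closure {η, r} := Subgroup.subset_closure (by simp)
    refine symmetryGroup_eq_of_generators (D := {o, T.sb o}) ?_ ?_ (mem_insert _ _) ?_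
    · rintro _ (rfl | rfl)
      · exact hηS
      · exact hrS
    · rintro d (rfl | rfl) a (rfl | rfl | rfl | rfl)
      · exact ⟨_, h1, d, by simp, hη⟩
      · exact ⟨_, h1, T.sb d, by simp, by rw [hL ho]; exact hC.sb_of_mem hηS hη⟩
      · exact ⟨_, one_mem _, T.sb d, by simp, by rw [hC.nbr_b1]; exact maps_one _⟩
      · exact ⟨_, h2, d, by simp, by rw [hC.nbr_c2]; exact hr⟩
      · exact ⟨_, h1, o, by simp, by rw [ho']; exact hη⟩
      · exact ⟨_, mul_mem (mul_mem h1 h2) h1, T.sb o, by simp, by rw [hp]; exact hpm⟩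
      · exact ⟨_, one_mem _, o, by simp, by rw [hC.nbr_b1, hC.sb_sb]; exact maps_one _⟩
      · refine ⟨_, h2, T.sb o, by simp, ?_⟩
        rw [hC.nbr_c2, ← hC.sb_sc]
        exact hC.sb_of_mem hrS hr
    · rintro d (rfl | rfl) g hg hm
      · rfl
      · exfalso
        have h3 := (nbr_of_mem hg hm .a0).1
        rw [ho, ho'] at h3
        simp at h3
  rw [hG]
  refine conjugate_groupDv hηm hν (by omega) hord ?_
  intro g hg hgm
  rw [← hG] at hg
  obtain ⟨j, hj⟩ := exists_maps_of_mem hg o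
  rcases hj.eq_or_eq_nbr hm hgm with rfl | rfl
  · exact Or.inl hj.eq_one
  · exact Or.inr (hj.unique hη)

/-! ### The quadrilateral subdivision of the triangular prism -/

/-- The tiles are of four kinds, each of which determines the kinds of the neighbours and the way in
which they are attached, so there are four orbits of tiles. The symmetry group is generated by the
half-turns `η` and `κ` about the midpoints of an edge `AB`-`BA` and of an edge `AD`-`DA`, the
product of which is a rotation about a vertex `α³`. -/
theorem conjugate_groupD_three
    (h : T.avc = {![3, 0, 0, 0], ![1, 2, 0, 0], ![2, 0, 0, 2], ![0, 2, 0, 2], ![0, 0, 4, 0]}) :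
    Conjugate T.symmetryGroup (groupD 3) := by
  have hv : ∀ x, T.vt x = ![3, 0, 0, 0] ∨ T.vt x = ![1, 2, 0, 0] ∨ T.vt x = ![2, 0, 0, 2] ∨
      T.vt x = ![0, 2, 0, 2] ∨ T.vt x = ![0, 0, 4, 0] := by
    intro x
    have := T.vt_mem_avc x
    rwa [h] at this
  have hC : T.GammaFour := by
    intro x hx
    rcases hv x with h1 | h1 | h1 | h1 | h1 <;> rw [h1] at hx ⊢ <;> simp at hx ⊢
  have hAB : T.AlphaBeta := by
    intro x hx hx'
    rcases hv x with h1 | h1 | h1 | h1 | h1 <;> rw [h1] at hx hx' ⊢ <;> simp at hx hx' ⊢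
  have hAD : ∀ x, 0 < T.vt x 0 → 0 < T.vt x 3 → T.vt x = ![2, 0, 0, 2] := by
    intro x hx hx'
    rcases hv x with h1 | h1 | h1 | h1 | h1 <;> rw [h1] at hx hx' ⊢ <;> simp at hx hx' ⊢
  have hBD : ∀ x, 0 < T.vt x 1 → 0 < T.vt x 3 → T.vt x = ![0, 2, 0, 2] := by
    intro x hx hx'
    rcases hv x with h1 | h1 | h1 | h1 | h1 <;> rw [h1] at hx hx' ⊢ <;> simp at hx hx' ⊢
  have hT : ∀ {i j}, T.nbr (i, .a0) ≠ (j, .a0) := by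
    intro i j e
    have h1 := hC.three_le_beta (nbr_r0_of_eq e)
    rcases hv (i, .b0) with h2 | h2 | h2 | h2 | h2 <;> rw [h2] at h1 <;> simp at h1
  have hP : ∀ {i j}, T.nbr (i, .a3) ≠ (j, .a3) := by
    intro i j e
    have h1 := hC.three_le_delta (nbr_r0_of_eq e)
    rcases hv (i, .d3) with h2 | h2 | h2 | h2 | h2 <;> rw [h2] at h1 <;> simp at h1
  -- the four kinds of tiles: `AB` on `BA`; `AD` on `DA`; around a vertex `α³`; `AB` on `DA`
  let K1 : Fin f → Prop := fun i => (T.nbr (i, .a0)).2 = .b0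
  let K2 : Fin f → Prop := fun i => (T.nbr (i, .a3)).2 = .d3
  let K4 : Fin f → Prop := fun i => (T.nbr (i, .a0)).2 = .d3
  let K3 : Fin f → Prop := fun i => K1 (T.sb (T.sc i))
  have hK1lk : ∀ {i}, K1 i → K1 (T.lk i) := fun hi => snd_nbr (GammaFour.link_symm (nbr_a0 hi))
  have hK1sb : ∀ {i}, K1 i → T.nbr (T.sb i, .a0) = (T.lk i, .d3) := fun hi =>
    hC.link_sb hAB (nbr_a0 hi)
  have hK1a3 : ∀ {i}, K1 i → T.nbr (i, .a3) = (T.sb (T.lk i), .b0) := fun hi =>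
    hC.nbr_a3_of_nbr_a0 hAB (nbr_a0 hi)
  have hK4sb : ∀ {q k}, T.nbr (q, .a0) = (k, .d3) → K1 (T.sb q) ∧ K1 k := fun hq =>
    have h1 := hC.link_of_sb hAB hq
    ⟨snd_nbr h1, snd_nbr (GammaFour.link_symm h1)⟩
  have hK4 : ∀ {q k}, T.nbr (q, .a0) = (k, .d3) → ∃ j, T.nbr (q, .a3) = (j, .a0) ∧
      T.nbr (j, .a3) = (T.sc k, .d3) := by
    intro q k hq
    have h1 := T.vt_nbr_pos (q, .a0)
    rw [hq] at h1
    obtain ⟨h2, h3⟩ := hC.alpha_delta (x := (q, .a0)) rfl (hAD _ (T.vt_pos (q, .a0)) h1) hq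
    rcases e : T.nbr (T.sc k, .d3) with ⟨j, b⟩
    have h4 := cls_of_nbr e
    rw [e] at h2 h3
    refine ⟨j, ?_⟩
    change T.nbr (q, .a3) = (j, b.r1) at h3
    cases b <;> simp [Fl.corner, Fl.cls] at h2 h4
    · exact absurd h3 hP
    · exact ⟨h3, nbr_symm e⟩
  have hK2 : ∀ {j k}, T.nbr (j, .a3) = (k, .d3) → ∃ q, T.nbr (j, .a0) = (q, .a3) ∧
      T.nbr (q, .a0) = (T.sc k, .d3) := by
    intro j k hj
    have h1 := T.vt_nbr_pos (j, .a3)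
    rw [hj] at h1
    obtain ⟨h2, h3⟩ := hC.alpha_delta (x := (j, .a3)) rfl (hAD _ (T.vt_pos (j, .a3)) h1) hj
    rcases e : T.nbr (T.sc k, .d3) with ⟨q, b⟩
    have h4 := cls_of_nbr e
    rw [e] at h2 h3
    refine ⟨q, ?_⟩
    change T.nbr (j, .a0) = (q, b.r1) at h3
    cases b <;> simp [Fl.corner, Fl.cls] at h2 h4
    · exact ⟨h3, nbr_symm e⟩
    · exact absurd h3 hT
  have hK1sc : ∀ {i}, K1 i → K2 (T.sc i) := by
    intro i hi
    obtain ⟨j, -, h2⟩ := hK4 (nbr_symm (nbr_r0_of_eq (hK1a3 hi)))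
    exact snd_nbr (nbr_symm (nbr_r0_of_eq h2))
  have hK2' : ∀ {j}, K2 j → ∃ k, T.nbr (j, .a3) = (k, .d3) ∧ T.nbr (k, .a3) = (j, .d3) := by
    intro j hj
    have h1 : T.nbr (j, .a3) = ((T.nbr (j, .a3)).1, .d3) := Prod.ext rfl hj
    exact ⟨_, h1, nbr_symm (nbr_r0_of_eq h1)⟩
  have hK2sc : ∀ {j}, K2 j → K1 (T.sc j) := by
    intro j hj
    obtain ⟨k, -, h2⟩ := hK2' hj
    obtain ⟨q, -, h4⟩ := hK2 h2
    exact (hK4sb h4).2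
  have hK2a0 : ∀ {j}, K2 j → ∃ q, T.nbr (j, .a0) = (q, .a3) ∧ K4 q := by
    intro j hj
    obtain ⟨k, h1, -⟩ := hK2' hj
    obtain ⟨q, h3, h4⟩ := hK2 h1
    exact ⟨q, h3, snd_nbr h4⟩
  have hK2sb : ∀ {j}, K2 j → K3 (T.sb j) := by
    intro j hj
    change K1 (T.sb (T.sc (T.sb j)))
    rw [hC.sb_sc, hC.sb_sb]
    exact hK2sc hj
  have hK4sc : ∀ {q}, K4 q → K3 (T.sc q) := by
    intro q hq
    change K1 (T.sb (T.sc (T.sc q)))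
    rw [hC.sc_sc]
    exact (hK4sb (nbr_a0 hq)).1
  have hK3sb : ∀ {i}, K3 i → K2 (T.sb i) := by
    intro i hi
    have h1 := hK1sc hi
    rwa [hC.sb_sc, hC.sc_sc] at h1
  have hK3sc : ∀ {i}, K3 i → K4 (T.sc i) := by
    intro i hi
    have h1 := snd_nbr (hK1sb hi)
    rwa [hC.sb_sb] at h1
  have hK3a0 : ∀ {i}, K3 i → T.nbr (i, .a0) = (T.lk i, .a3) := by
    intro i hi
    obtain ⟨q, h1, -⟩ := hK2a0 (hK3sb hi)
    rcases e : T.nbr (i, .a0) with ⟨j, b⟩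
    have h2 := cls_of_nbr e
    rw [lk, e]
    cases b <;> simp [Fl.cls] at h2 ⊢
    · exact hT e
    · exact absurd (snd_eq_of_nbr h1 (hC.link_sb hAB e)) (by decide)
    · exact absurd (snd_eq_of_nbr h1 (hC.link_of_sb hAB e)) (by decide)
  have hK3a3 : ∀ {i}, K3 i → ∃ j, T.nbr (i, .a3) = (j, .a0) := by
    intro i hi
    have h1 := hK3sc hi
    rcases e : T.nbr (i, .a3) with ⟨j, b⟩
    refine ⟨j, ?_⟩
    have h2 := cls_of_nbr e
    cases b <;> simp [Fl.cls] at h2 ⊢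
    · exact hP e
    · have h3 := hK4sb (nbr_symm (nbr_r0_of_eq e))
      exact absurd (snd_eq_of_nbr (hK3a0 hi) (nbr_a0 h3.2)) (by decide)
    · have h3 := hK2sc (snd_nbr e)
      exact absurd (h1.symm.trans h3) (by decide)
  -- passage across a vertex `β²δ²`
  have hβδ : ∀ {i j}, T.nbr (i, .a0) = (j, .a3) → T.nbr (T.sb i, .a0) = (T.sc j, .a3) := by
    intro i j e
    have e' : T.nbr (i, .b0) = (j, .d3) := nbr_r0_of_eq e
    have h1 := T.vt_nbr_pos (i, .b0)
    rw [e'] at h1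
    exact nbr_r0_of_eq (hC.beta_delta (hBD _ (T.vt_pos (i, .b0)) h1) e')
  have hK3lk : ∀ {i}, K3 i → K3 (T.lk i) := by
    intro i hi
    obtain ⟨q, h1, h2⟩ := hK2a0 (hK3sb hi)
    obtain rfl := fst_eq_of_nbr h1 (hβδ (hK3a0 hi))
    exact (hK4sb (nbr_a0 h2)).1
  have hK3a3' : ∀ {i j}, K3 i → T.nbr (i, .a3) = (j, .a0) → K3 j := by
    intro i j hi hj
    have h1 := hβδ (nbr_symm hj)
    obtain ⟨l, h2, h3⟩ := hK4 (nbr_a0 (hK3sc hi))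
    obtain rfl := fst_eq_of_nbr h2 (nbr_symm h1)
    have h4 := hK2sb (snd_nbr h3)
    rwa [hC.sb_sb] at h4
  have hmem : ∀ {g i j} (l : Fin 4), (![K1, K2, K3, K4] l) i → (![K1, K2, K3, K4] l) j →
      T.Maps g i j → g ∈ T.symmetryGroup := by
    intro g i j l hi hj hg
    refine hC.mem_symmetryGroup_of_label (fun l : Fin 4 => ![K1, K2, K3, K4] l) ?_ hi hj hg
    intro l
    fin_cases l
    · refine ⟨.b0, .b0, 0, 3, 3, 1, fun i (hi : K1 i) => ⟨⟨_, nbr_a0 hi, hK1lk hi⟩,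
        ⟨_, hK1a3 hi, snd_nbr (hK1sb (hK1lk hi))⟩, snd_nbr (hK1sb hi), hK1sc hi⟩⟩
    · refine ⟨.a3, .d3, 3, 1, 2, 0, fun i (hi : K2 i) => ?_⟩
      obtain ⟨k, h1, h2⟩ := hK2' hi
      exact ⟨hK2a0 hi, ⟨k, h1, snd_nbr h2⟩, hK2sb hi, hK2sc hi⟩
    · refine ⟨.a3, .a0, 2, 2, 1, 3, fun i (hi : K3 i) => ?_⟩
      obtain ⟨j, hj⟩ := hK3a3 hi
      exact ⟨⟨_, hK3a0 hi, hK3lk hi⟩, ⟨j, hj, hK3a3' hi hj⟩, hK3sb hi, hK3sc hi⟩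
    · refine ⟨.d3, .a0, 0, 1, 0, 2, fun i (hi : K4 i) => ?_⟩
      obtain ⟨j, h1, h2⟩ := hK4 (nbr_a0 hi)
      exact ⟨⟨_, nbr_a0 hi, (hK4sb (nbr_a0 hi)).2⟩, ⟨j, h1, snd_nbr h2⟩,
        (hK4sb (nbr_a0 hi)).1, hK4sc hi⟩
  obtain ⟨o, ho⟩ : ∃ o, K1 o := by
    obtain ⟨x, hx⟩ := T.exists_flag_of_mem_avc (t := ![1, 2, 0, 0]) (by rw [h]; simp)
    obtain ⟨i, hi⟩ := T.exists_flag_corner .a0 (x := x) (by rw [hx]; simp [Fl.corner])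
    obtain ⟨j, hj, -⟩ := hC.alpha_beta_beta (x := (i, .a0)) rfl (by rw [vt, hi, hx])
    exact ⟨i, snd_nbr hj⟩
  obtain ⟨η, hη⟩ := T.exists_maps o (T.lk o)
  obtain ⟨m, -, hηm⟩ := hη.isHalfTurn (nbr_a0 ho)
  have hηS : η ∈ T.symmetryGroup := hmem 0 ho (hK1lk ho) hη
  obtain ⟨k, hk, hk'⟩ := hK2' (hK1sc ho)
  obtain ⟨κ, hκ⟩ := T.exists_maps (T.sc o) k
  obtain ⟨m', -, hκm⟩ := hκ.isHalfTurn hk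
  have hκS : κ ∈ T.symmetryGroup := hmem 1 (hK1sc ho) (snd_nbr hk') hκ
  have hκo : T.Maps κ o (T.sc k) := by
    have := hC.sc_of_mem hκS hκ
    rwa [hC.sc_sc] at this
  -- the rotation about a vertex `α³`
  have hρS : κ * η ∈ T.symmetryGroup := mul_mem hκS hηS
  obtain ⟨q, hq, hq'⟩ := hK2 hk
  have hρq : T.Maps (κ * η) (T.sb o) q := by
    have e1 : T.nbr (o, .d3) = (T.sb (T.lk o), .a0) := nbr_r0_of_eq (hK1a3 ho)
    obtain ⟨l, e2, e3⟩ := nbr_eq_of_mem hκS hκo e1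
    obtain rfl := fst_eq_of_nbr e2 (nbr_symm hq')
    exact e3.mul (hC.sb_of_mem hηS hη)
  have ho5 : K3 (T.sb (T.sc o)) := hK2sb (hK1sc ho)
  have hρ5 : T.Maps (κ * η) (T.sb (T.sc o)) (T.lk (T.sb (T.sc o))) := by
    have e1 := hβδ (hK3a0 ho5)
    rw [hC.sb_sb] at e1
    obtain rfl := fst_eq_of_nbr hq e1
    have e2 := hC.sc_of_mem hρS hρq
    rwa [hC.sc_sc, ← hC.sb_sc] at e2
  have hα : T.vt (T.sb (T.sc o), .a0) = ![3, 0, 0, 0] := by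
    have e1 := T.vt_pos (T.sb (T.sc o), .a0)
    obtain ⟨j, e2⟩ := hK3a3 ho5
    rcases hv (T.sb (T.sc o), .a0) with h1 | h1 | h1 | h1 | h1
    · exact h1
    · obtain ⟨l, e3, -⟩ := hC.alpha_beta_beta (x := (T.sb (T.sc o), .a0)) rfl h1
      exact absurd (snd_eq_of_nbr e3 (hK3a0 ho5)) (by decide)
    · obtain ⟨l, e3, -⟩ := hC.alpha_alpha (x := (T.sb (T.sc o), .a0)) rfl h1
        (by rw [hK3a0 ho5]; rfl)
      exact absurd (snd_eq_of_nbr e3 e2) (by decide)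
    · rw [h1] at e1; simp [Fl.corner] at e1
    · rw [h1] at e1; simp [Fl.corner] at e1
  have hord : orderOf (κ * η) = 3 := by
    refine orderOf_of_turn (T := T) (a := .a0) (p := 1) hρS (turn_of_nbr (hK3a0 ho5)) hρ5 ?_
    rw [deg_of_vt hα]; simp [Fin.sum_univ_four]
  have hG : T.symmetryGroup = Subgroup.closure {κ, η} := by
    have h1 : κ ∈ Subgroup.closure {κ, η} := Subgroup.subset_closure (by simp)
    have h2 : η ∈ Subgroup.closure {κ, η} := Subgroup.subset_closure (by simp)
    have h3 := mul_mem h1 h2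
    refine symmetryGroup_eq_of_generators (D := {o, T.sc o, T.sb (T.sc o), T.sb o}) ?_ ?_
      (mem_insert _ _) ?_
    · rintro _ (rfl | rfl)
      · exact hκS
      · exact hηS
    · rintro d (rfl | rfl | rfl | rfl) a (rfl | rfl | rfl | rfl)
      · exact ⟨_, h2, d, by simp, hη⟩
      · exact ⟨_, h2, T.sb d, by simp, by rw [hK1a3 ho]; exact hC.sb_of_mem hηS hη⟩
      · exact ⟨_, one_mem _, T.sb d, by simp, by rw [hC.nbr_b1]; exact maps_one _⟩
      · exact ⟨_, one_mem _, T.sc d, by simp, by rw [hC.nbr_c2]; exact maps_one _⟩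
      · exact ⟨_, h3, T.sb o, by simp, by rw [hq]; exact hρq⟩
      · exact ⟨_, h1, T.sc o, by simp, by rw [hk]; exact hκ⟩
      · exact ⟨_, one_mem _, T.sb (T.sc o), by simp, by rw [hC.nbr_b1]; exact maps_one _⟩
      · exact ⟨_, one_mem _, o, by simp, by rw [hC.nbr_c2, hC.sc_sc]; exact maps_one _⟩
      · exact ⟨_, h3, T.sb (T.sc o), by simp, hρ5⟩
      · obtain ⟨j, e1, e2⟩ := nbr_inv_of_mem hρS hρ5 (hK3a0 ho5)
        exact ⟨_, inv_mem h3, T.sb (T.sc o), by simp, by rw [e1]; exact e2⟩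
      · exact ⟨_, one_mem _, T.sc o, by simp, by rw [hC.nbr_b1, hC.sb_sb]; exact maps_one _⟩
      · refine ⟨_, one_mem _, T.sb o, by simp, ?_⟩
        rw [hC.nbr_c2, hC.sb_sc, hC.sc_sc]; exact maps_one _
      · exact ⟨_, h2, o, by simp, by rw [hK1sb ho]; exact hη⟩
      · obtain ⟨j, e1, e2⟩ := nbr_inv_of_mem hρS hρq hq
        exact ⟨_, inv_mem h3, T.sc o, by simp, by rw [e1]; exact e2⟩
      · exact ⟨_, one_mem _, o, by simp, by rw [hC.nbr_b1, hC.sb_sb]; exact maps_one _⟩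
      · exact ⟨_, one_mem _, T.sb (T.sc o), by simp, by
          rw [hC.nbr_c2, ← hC.sb_sc]; exact maps_one _⟩
    · have key : ∀ {d t} {g}, g ∈ T.symmetryGroup → T.Maps g o d → T.nbr (d, .a0) = (T.lk d, t) →
          t = .b0 := by
        intro d t g hg hm hd
        have h4 := (nbr_of_mem hg hm .a0).1
        rw [hd] at h4
        exact h4.trans ho
      rintro d (rfl | rfl | rfl | rfl) g hg hm
      · rfl
      · exact absurd (key hg hm (nbr_a0 (snd_nbr hq))) (by decide)
      · exact absurd (key hg hm (hK3a0 ho5)) (by decide)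
      · exact absurd (key hg hm (nbr_a0 (snd_nbr (hK1sb ho)))) (by decide)
  rw [hG]
  exact conjugate_groupD hκm hηm (by omega) hord

/-! ### Fans of angles `δ` -/

variable (T) in
/-- The `m`-th tile that is met on going around the vertex of the flag `x`. -/
noncomputable def fan (x : Fin f × Fl) (m : ℕ) : Fin f := (T.turn^[m] x).1

variable (T) in
/-- The `N` tiles that follow the flag `x` around its vertex have the corner `D` there. They are
joined alternately along sides `CD` and `AD`. -/
structure IsFan (x : Fin f × Fl) (N : ℕ) : Prop where
  even : N % 2 = 0
  first : 0 < N → T.nbr x = (T.fan x 1, .d3)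
  step_odd : ∀ m, m % 2 = 1 → m < N → T.fan x (m + 1) = T.sc (T.fan x m)
  step_even : ∀ m, m % 2 = 0 → 0 < m → m < N →
    T.nbr (T.fan x m, .a3) = (T.fan x (m + 1), .a3)
  last : 0 < N → T.nbr (T.fan x N, .d3) = fl1 (T.turn^[N + 1] x)

/-- The sides at a vertex with several successive angles `δ`: the sides `CD` of two tiles always
match, so sides `CD` and `AD` alternate, and the number of these angles is even. -/
theorem GammaFour.isFan (hC : T.GammaFour) {x : Fin f × Fl} {N : ℕ} (hx : x.2.cls = 0)
    (hD : ∀ m, 0 < m → m ≤ N → (T.turn^[m] x).2.corner = 3)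
    (hlast : (T.turn^[N + 1] x).2.corner ≠ 3) : T.IsFan x N := by
  have key : ∀ y : Fin f × Fl, y.2.cls = 0 → (T.turn y).2.corner = 3 →
      T.nbr y = ((T.turn y).1, .d3) ∧ T.turn y = ((T.turn y).1, .d2) := by
    intro y hy h
    have h1 := T.cls_nbr y
    rw [turn] at h ⊢
    rcases e : T.nbr y with ⟨j, b⟩
    rw [e] at h h1
    rw [hy] at h1
    cases b <;> simp [fl1, Fl.corner, Fl.cls, Fl.r1] at h h1 ⊢
  have h1 : ∀ k, (2 * k + 1 ≤ N → T.turn^[2 * k + 1] x = (T.fan x (2 * k + 1), .d2)) ∧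
      (2 * k + 2 ≤ N → T.turn^[2 * k + 2] x = (T.fan x (2 * k + 2), .d3)) ∧
      (2 * k + 1 ≤ N → T.turn^[2 * k + 2] x = (T.sc (T.fan x (2 * k + 1)), .d3)) := by
    have odd : ∀ m, (T.turn^[m] x).2 = .d2 → T.turn^[m + 1] x = (T.sc (T.fan x m), .d3) := by
      intro m hm
      have e : T.turn^[m] x = (T.fan x m, .d2) := Prod.ext rfl hm
      rw [Function.iterate_succ_apply', e, hC.turn_d2]
    intro k
    induction k with
    | zero =>
      have e : 2 * 0 + 1 ≤ N → T.turn^[2 * 0 + 1] x = (T.fan x (2 * 0 + 1), .d2) :=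
        fun h => (key x hx (hD 1 one_pos h)).2
      refine ⟨e, fun h => ?_, fun h => odd _ (by rw [e h])⟩
      have h2 := odd _ (by rw [e (by omega)])
      exact Prod.ext rfl (by rw [h2])
    | succ k ih =>
      have e : 2 * (k + 1) + 1 ≤ N →
          T.turn^[2 * (k + 1) + 1] x = (T.fan x (2 * (k + 1) + 1), .d2) := by
        intro h
        have h2 := hD (2 * (k + 1) + 1) (by omega) h
        rw [fan]
        rw [Function.iterate_succ_apply'] at h2 ⊢
        refine (key _ ?_ h2).2
        rw [show 2 * (k + 1) = 2 * k + 2 by ring, ih.2.1 (by omega)]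
        rfl
      refine ⟨e, fun h => ?_, fun h => odd _ (by rw [e h])⟩
      have h2 := odd _ (by rw [e (by omega)])
      exact Prod.ext rfl (by rw [h2])
  have hodd : ∀ m, m % 2 = 1 → m ≤ N → T.turn^[m + 1] x = (T.sc (T.fan x m), .d3) := by
    intro m hm hmN
    obtain ⟨k, rfl⟩ : ∃ k, m = 2 * k + 1 := ⟨m / 2, by omega⟩
    exact (h1 k).2.2 hmN
  have heven : ∀ m, m % 2 = 0 → 0 < m → m ≤ N → T.turn^[m] x = (T.fan x m, .d3) := by
    intro m hm hm0 hmN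
    obtain ⟨k, rfl⟩ : ∃ k, m = 2 * k + 2 := ⟨(m - 2) / 2, by omega⟩
    exact (h1 k).2.1 hmN
  have hN : N % 2 = 0 := by
    by_contra h2
    rw [hodd N (by omega) le_rfl] at hlast
    exact hlast rfl
  refine ⟨hN, fun h => (key x hx (hD 1 one_pos h)).1, fun m hm hmN => ?_, fun m hm hm0 hmN => ?_,
    fun h => ?_⟩
  · rw [fan, hodd m hm hmN.le]
  · have h2 := hD (m + 1) (by omega) hmN
    rw [fan, fan]
    rw [Function.iterate_succ_apply'] at h2 ⊢
    have h3 := heven m hm hm0 hmN.le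
    have h4 := (key _ (by rw [h3]; rfl) h2).1
    rw [h3] at h4 ⊢
    exact nbr_r0_of_eq h4
  · rw [← heven N hN h le_rfl, Function.iterate_succ_apply', T.nbr_eq_fl1_turn]

/-- If the set `S` exhausts the positions of a corner around a vertex, then this corner does not
occur at other positions. -/
theorem corner_iterate_ne {x : Fin f × Fl} {S : Finset ℕ} {k : Fin 4}
    (hS : ∀ m ∈ S, m < T.deg x ∧ (T.turn^[m] x).2.corner = k) (hcard : T.vt x k ≤ S.card) {m : ℕ}
    (hm : m < T.deg x) (hmS : m ∉ S) : (T.turn^[m] x).2.corner ≠ k := by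
  intro h
  have h1 : S = (Finset.range (T.deg x)).filter fun m => (T.turn^[m] x).2.corner = k := by
    apply Finset.eq_of_subset_of_card_le
    · intro m hm
      simpa using hS m hm
    · rw [T.card_filter_corner]; exact hcard
  apply hmS
  rw [h1]
  simpa using ⟨hm, h⟩

/-- The fan at a vertex `αδᴺ`. -/
theorem GammaFour.isFan_alpha (hC : T.GammaFour) {i : Fin f} {a : Fl} {N : ℕ} (ha : a.corner = 0)
    (hv : T.vt (i, a) = ![1, 0, 0, N]) :
    T.IsFan (i, a) N ∧ T.turn^[N + 1] (i, a) = (i, a) := by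
  have hd : T.deg (i, a) = N + 1 := by
    rw [deg_of_vt hv]; simp [Fin.sum_univ_four]; ring
  have h0 : T.turn^[N + 1] (i, a) = (i, a) := by rw [← hd]; exact T.iterate_turn_deg _
  refine ⟨hC.isFan (by cases a <;> simp [Fl.corner] at ha <;> rfl) ?_ ?_, h0⟩
  · intro m hm hmN
    have h1 := corner_iterate_ne (T := T) (x := (i, a)) (S := {0}) (k := 0)
      (by simpa [ha] using T.deg_pos _) (by rw [hv]; simp) (m := m) (by omega) (by simp; omega)
    have h2 := T.vt_pos (T.turn^[m] (i, a))
    rw [vt_iterate_turn, hv] at h2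
    revert h1 h2
    generalize (T.turn^[m] (i, a)).2.corner = k
    fin_cases k <;> simp
  · rw [h0, ha]; simp

/-- The fan at a vertex `β²δᴺ`. -/
theorem GammaFour.isFan_beta (hC : T.GammaFour) {i : Fin f} {N : ℕ}
    (hv : T.vt (i, .b0) = ![0, 2, 0, N]) :
    T.IsFan (i, .b0) N ∧ T.turn^[N + 1] (i, .b0) = (T.sb i, .b1) := by
  have hd : T.deg (i, .b0) = N + 1 + 1 := by
    rw [deg_of_vt hv]; simp [Fin.sum_univ_four]; ring
  have h0 : T.turn^[N + 1] (i, .b0) = (T.sb i, .b1) := by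
    have h1 := T.iterate_turn_deg (i, .b0)
    have h2 := hC.turn_b1 (T.sb i)
    rw [hC.sb_sb] at h2
    rw [hd, Function.iterate_succ_apply'] at h1
    exact T.turn_injective (h1.trans h2.symm)
  refine ⟨hC.isFan rfl ?_ ?_, h0⟩
  · intro m hm hmN
    have h1 := corner_iterate_ne (T := T) (x := (i, .b0)) (S := {0, N + 1}) (k := 1)
      (by
        intro m hm
        simp only [Finset.mem_insert, Finset.mem_singleton] at hm
        rcases hm with rfl | rfl
        · exact ⟨by omega, rfl⟩
        · exact ⟨by omega, by rw [h0]; rfl⟩)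
      (by rw [hv, Finset.card_pair (by omega)]; simp) (m := m) (by omega) (by simp; omega)
    have h2 := T.vt_pos (T.turn^[m] (i, .b0))
    rw [vt_iterate_turn, hv] at h2
    revert h1 h2
    generalize (T.turn^[m] (i, .b0)).2.corner = k
    fin_cases k <;> simp
  · rw [h0]; simp [Fl.corner]

theorem IsFan.step_even' {x : Fin f × Fl} {N : ℕ} (h : T.IsFan x N) {m : ℕ} (hm : m % 2 = 1)
    (h1 : 1 < m) (hN : m ≤ N) : T.nbr (T.fan x m, .a3) = (T.fan x (m - 1), .a3) := by
  have h2 := nbr_symm (h.step_even (m - 1) (by omega) (by omega) (by omega))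
  rwa [Nat.sub_add_cancel (by omega)] at h2

theorem IsFan.step_odd' {x : Fin f × Fl} {N : ℕ} (h : T.IsFan x N) (hC : T.GammaFour) {m : ℕ}
    (hm : m % 2 = 0) (h1 : 0 < m) (hN : m ≤ N) : T.sc (T.fan x m) = T.fan x (m - 1) := by
  have h2 := h.step_odd (m - 1) (by omega) (by omega)
  rw [Nat.sub_add_cancel (by omega)] at h2
  rw [h2, hC.sc_sc]

/-! ### Links between fans -/

/-- Being linked is symmetric, in terms of the tiles across `BC`. -/
theorem GammaFour.link_comm (hC : T.GammaFour) (hAB : T.AlphaBeta) {i j : Fin f}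
    (h : T.nbr (i, .a0) = (T.sb j, .d3)) : T.nbr (j, .a0) = (T.sb i, .d3) := by
  have h1 := hC.link_sb hAB (GammaFour.link_symm (hC.link_of_sb hAB h))
  rwa [hC.sb_sb] at h1

/-- Two fans that are linked at one place are linked all along, in opposite directions: at a vertex
`α²δ²` the link of two tiles is passed on to the next tile of one fan, across `AD`, and to the next
tile of the other fan, across `CD`. -/
theorem GammaFour.link_fan (hC : T.GammaFour) (hAB : T.AlphaBeta)
    (hAA : ∀ {i j}, T.nbr (i, .a3) = (j, .a3) → T.vt (i, .a3) = ![2, 0, 0, 2])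
    {x y : Fin f × Fl} {N N' M a b : ℕ} (hx : T.IsFan x N) (hy : T.IsFan y N') (hM : M % 2 = 0)
    (ha : 0 < a) (hb : b ≤ N) (hbM : b < M) (haM : M ≤ N' + a)
    (h : T.nbr (T.fan x a, .a0) = (T.sb (T.fan y (M - a)), .d3)) :
    ∀ m, a ≤ m → m ≤ b → T.nbr (T.fan x m, .a0) = (T.sb (T.fan y (M - m)), .d3) := by
  have step : ∀ {i i' j}, T.nbr (i, .a0) = (T.sb j, .d3) → T.nbr (i, .a3) = (i', .a3) →
      T.nbr (i', .a0) = (T.sb (T.sc j), .d3) := by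
    intro i i' j h1 h2
    obtain ⟨k, h3, h4⟩ := hC.alpha_alpha (x := (i, .a3)) rfl (hAA h2) (by rw [h2]; rfl)
    obtain rfl := fst_eq_of_nbr h1 h3
    rw [h2] at h4
    rw [hC.sb_sc]
    exact h4
  intro m ham
  induction m, ham using Nat.le_induction with
  | base => exact fun _ => h
  | succ m ham ih =>
    intro hmb
    have ih' := ih (by omega)
    rcases Nat.mod_two_eq_zero_or_one m with hm | hm
    · have h1 := step ih' (hx.step_even m hm (by omega) (by omega))
      rw [hy.step_odd' hC (by omega) (by omega) (by omega)] at h1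
      rwa [show M - (m + 1) = M - m - 1 by omega]
    · have h1 := step (hC.link_comm hAB ih')
        (hy.step_even' (by omega) (by omega) (by omega))
      rw [← hx.step_odd m hm (by omega)] at h1
      rw [show M - (m + 1) = M - m - 1 by omega]
      exact hC.link_comm hAB h1

/-! ### The tilings with `αδ^((f + 8) / 8)` -/

/-- With `f = 8 n`, each tile, or its neighbour across `BC`, is among the first `n` tiles of the fan
of angles `δ` at a vertex `αδ^(n + 1)`. Its position `m` in this fan is a label which determines the
labels of the neighbours and the way in which they are attached. By counting angles there are four
vertices `αδ^(n + 1)`. The symmetry group acts freely on them, so it has at most four elements, and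
it contains two different half-turns. -/
theorem conjugate_groupD_two_of_avc (hf : 8 ∣ f)
    (h : T.avc = {![1, 2, 0, 0], ![0, 0, 4, 0], ![2, 0, 0, 2], ![1, 0, 0, (f + 8) / 8]}) :
    Conjugate T.symmetryGroup (groupD 2) := by
  obtain ⟨n, rfl⟩ := hf
  have hn : 0 < n := by
    obtain ⟨i⟩ := T.exists_tile
    have := i.pos
    omega
  rw [show (8 * n + 8) / 8 = n + 1 by omega] at h
  have hv : ∀ x, T.vt x = ![1, 2, 0, 0] ∨ T.vt x = ![0, 0, 4, 0] ∨ T.vt x = ![2, 0, 0, 2] ∨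
      T.vt x = ![1, 0, 0, n + 1] := by
    intro x
    have := T.vt_mem_avc x
    rwa [h] at this
  have hC : T.GammaFour := by
    intro x hx
    rcases hv x with h1 | h1 | h1 | h1 <;> rw [h1] at hx ⊢ <;> simp at hx ⊢
  have hB : ∀ x, 0 < T.vt x 1 → T.vt x = ![1, 2, 0, 0] := by
    intro x hx
    rcases hv x with h1 | h1 | h1 | h1 <;> rw [h1] at hx ⊢ <;> simp at hx ⊢
  have hAB : T.AlphaBeta := fun x _ hx => hB x hx
  have hAD : ∀ x, 0 < T.vt x 0 → 0 < T.vt x 3 → T.vt x = ![2, 0, 0, 2] ∨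
      T.vt x = ![1, 0, 0, n + 1] := by
    intro x hx hx'
    rcases hv x with h1 | h1 | h1 | h1 <;> rw [h1] at hx hx' ⊢ <;> simp at hx hx' ⊢
  have hAA : ∀ {i j}, T.nbr (i, .a3) = (j, .a3) → T.vt (i, .a3) = ![2, 0, 0, 2] := by
    intro i j e
    have h2 := T.vt_pos (i, .a3)
    rcases hv (i, .a3) with h1 | h1 | h1 | h1
    · exact absurd (congrArg (fun y => y.2.corner) e)
        (corner_nbr_ne (x := (i, .a3)) (by rw [h1]; rfl))
    · rw [h1] at h2; simp [Fl.corner] at h2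
    · exact h1
    · exact absurd (congrArg (fun y => y.2.corner) e)
        (corner_nbr_ne (x := (i, .a3)) (by rw [h1]; rfl))
  have hLK := hC.link_or hB
  have hLa3 : ∀ {i}, (T.nbr (i, .a0)).2 = .b0 → T.nbr (i, .a3) = (T.sb (T.lk i), .b0) := fun hi =>
    hC.nbr_a3_of_nbr_a0 hAB (nbr_a0 hi)
  have hK : ∀ {i j}, T.nbr (i, .a0) = (j, .d3) → T.nbr (T.sb i, .a0) = (j, .b0) := fun hi =>
    hC.link_of_sb hAB hi
  have hKa3 : ∀ {i j}, T.nbr (i, .a0) = (j, .d3) → T.nbr (j, .a3) = (i, .b0) := fun hi =>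
    nbr_symm (nbr_r0_of_eq hi)
  have hKL : ∀ {i j}, T.nbr (i, .a0) = (j, .d3) → (T.nbr (j, .a0)).2 = .b0 := fun hi =>
    snd_nbr (GammaFour.link_symm (hK hi))
  have hnotL : ∀ {i t}, (T.nbr (i, .a3)).2 = t → t ≠ .b0 → (T.nbr (i, .a0)).2 = .d3 := by
    intro i t hi ht
    refine (hLK i).resolve_left fun h1 => ?_
    rw [hLa3 h1] at hi
    exact ht hi.symm
  -- a tile whose side `AD` is the side `DA` of its neighbour has the angle `α` at a vertex `αδⁿ⁺¹`
  have hapex : ∀ {y y'}, T.nbr (y, .a3) = (y', .d3) → T.vt (y, .a3) = ![1, 0, 0, n + 1] := by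
    intro y y' hy
    have h1 := T.vt_nbr_pos (y, .a3)
    rw [hy] at h1
    refine (hAD _ (T.vt_pos (y, .a3)) h1).resolve_left fun h2 => ?_
    obtain ⟨h3, h4⟩ := hC.alpha_delta (x := (y, .a3)) rfl h2 hy
    have h5 := hLK y
    rw [show T.nbr (y, .a0) = _ from h4] at h5
    revert h3 h5
    rcases T.nbr (T.sc y', .d3) with ⟨j, b⟩
    cases b <;> simp [Fl.corner, fl1, Fl.r1]
  have hapex_symm : ∀ {y y'}, T.nbr (y, .a3) = (y', .d3) → T.nbr (y', .a3) = (y, .d3) := fun hy =>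
    nbr_symm (nbr_r0_of_eq hy)
  let Apex : Fin (8 * n) → Prop := fun y => (T.nbr (y, .a3)).2 = .d3
  have hApex : ∀ {y}, Apex y → ∃ y', T.nbr (y, .a3) = (y', .d3) := fun hy =>
    ⟨_, Prod.ext rfl hy⟩
  let e : Fin (8 * n) → ℕ → Fin (8 * n) := fun y => T.fan (y, .a3)
  have hfan : ∀ {y}, Apex y → T.IsFan (y, .a3) (n + 1) := by
    intro y hy
    obtain ⟨y', hy'⟩ := hApex hy
    exact (hC.isFan_alpha rfl (hapex hy')).1
  have he1 : ∀ {y}, Apex y → T.nbr (y, .a3) = (e y 1, .d3) := fun hy =>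
    (hfan hy).first (Nat.succ_pos n)
  have helast : ∀ {y}, Apex y → T.nbr (y, .a0) = (e y (n + 1), .d3) := by
    intro y hy
    obtain ⟨y', hy'⟩ := hApex hy
    have h1 := (hfan hy).last (Nat.succ_pos n)
    rw [(hC.isFan_alpha (a := .a3) rfl (hapex hy')).2] at h1
    exact nbr_symm h1
  have hodd : ∀ {y}, Apex y → n % 2 = 1 := fun hy => by
    have := (hfan hy).even
    omega
  have hesucc : ∀ {y}, Apex y → e y (n + 1) = T.sc (e y n) := fun hy =>
    (hfan hy).step_odd n (hodd hy) (Nat.lt_succ_self n)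
  -- the tiles of the fan, except the last one, are attached along `AB` to a side `DA`
  have heK : ∀ {y m}, Apex y → 0 < m → m ≤ n → (T.nbr (e y m, .a0)).2 = .d3 := by
    intro y m hy hm hmn
    rcases Nat.mod_two_eq_zero_or_one m with h1 | h1
    · exact hnotL (snd_nbr ((hfan hy).step_even m h1 hm (by omega))) (by decide)
    · by_cases h2 : m = 1
      · subst h2
        exact hnotL (snd_nbr (hapex_symm (he1 hy))) (by decide)
      · exact hnotL (snd_nbr ((hfan hy).step_even' h1 (by omega) (by omega))) (by decide)
  have hvA : ∀ {q}, T.vt (q, .a3) = ![1, 0, 0, n + 1] → Apex q := by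
    intro q h5
    have h6 := T.vt_nbr_pos (q, .a3)
    have h7 := corner_nbr_ne (x := (q, .a3)) (T := T) (by rw [h5]; rfl)
    have h9 := T.cls_nbr (q, .a3)
    rw [h5] at h6
    change (T.nbr (q, .a3)).2 = _
    revert h6 h7 h9
    generalize (T.nbr (q, .a3)).2 = b
    cases b <;> simp [Fl.corner, Fl.cls]
  -- the `n`-th tile of a fan is opposite to the `n`-th tile of another one at a vertex `γ⁴`
  have hend : ∀ {y}, Apex y → ∃ z, Apex z ∧ T.sc (e y n) = T.sb (e z n) := by
    intro y hy
    -- the tile `i` is linked, but its neighbour across `CD` is not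
    obtain ⟨i, hi⟩ : ∃ i, i = T.sb (e y n) := ⟨_, rfl⟩
    have h1 : (T.nbr (i, .a0)).2 = .b0 := by
      rw [hi]; exact snd_nbr (hK (nbr_a0 (heK hy hn le_rfl)))
    have h2 : (T.nbr (T.sc i, .a0)).2 = .d3 := by
      rw [hi, ← hC.sb_sc, ← hesucc hy]
      have h3 := snd_nbr (hC.link_sb hAB (nbr_a0 (hKL (helast hy))))
      exact h3
    obtain ⟨q, hq⟩ : ∃ q, q = T.sb (T.lk i) := ⟨_, rfl⟩
    have h3 : T.nbr (q, .a0) = (i, .d3) := by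
      have := nbr_symm (nbr_r0_of_eq (hLa3 h1))
      rwa [← hq] at this
    have h4 := T.vt_nbr_pos (q, .a0)
    rw [h3] at h4
    have h5 : T.vt (q, .a0) = ![1, 0, 0, n + 1] := by
      refine (hAD _ (T.vt_pos (q, .a0)) h4).resolve_left fun h5 => ?_
      obtain ⟨h6, h7⟩ := hC.alpha_delta (x := (q, .a0)) rfl h5 h3
      rcases h8 : T.nbr (T.sc i, .d3) with ⟨j, b⟩
      rw [h8] at h6 h7
      change T.nbr (q, .a3) = (j, b.r1) at h7
      have h9 := cls_of_nbr h8
      cases b <;> simp [Fl.corner, Fl.cls] at h6 h9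
      · have h10 := hKL (nbr_symm h8)
        rw [h2] at h10
        exact absurd h10 (by decide)
      · have h10 := hLK j
        have h11 : T.nbr (j, .a0) = (q, .a3) := nbr_symm h7
        rw [h11] at h10
        simp at h10
    have hqA : Apex q := hvA h5
    obtain rfl : i = e q (n + 1) := fst_eq_of_nbr h3 (helast hqA)
    refine ⟨q, hqA, ?_⟩
    rw [hesucc hqA] at hi
    have h6 : T.sb (T.sc (e q n)) = e y n := by rw [hi, hC.sb_sb]
    rw [← h6, hC.sb_sc, hC.sc_sc]
  -- each fan is linked with another one, in the opposite direction
  have hlink : ∀ {y}, Apex y → ∃ z, Apex z ∧ ∀ m, 0 < m → m ≤ n →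
      T.nbr (e y m, .a0) = (T.sb (e z (n + 1 - m)), .d3) := by
    intro y hy
    have hy1 : Apex (e y 1) := snd_nbr (hapex_symm (he1 hy))
    obtain ⟨z, hz, h1⟩ := hend hy1
    refine ⟨z, hz, ?_⟩
    have h2 := helast hy1
    rw [hesucc hy1, h1] at h2
    exact hC.link_fan hAB hAA (hfan hy) (hfan hz) (M := n + 1) (a := 1) (b := n) (hfan hy).even
      one_pos (by omega) (by omega) (by omega) h2
  -- the label `(m, true)` is for the `m`-th tile of a fan, `(m, false)` for its neighbour across
  -- `BC`
  let A : ℕ → Fin (8 * n) → Prop := fun m i => ∃ y, Apex y ∧ 0 < m ∧ m ≤ n ∧ i = e y m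
  let L : ℕ × Bool → Fin (8 * n) → Prop := fun l i => A l.1 (bif l.2 then i else T.sb i)
  have hLsb : ∀ {m t i}, L (m, t) i → L (m, !t) (T.sb i) := by
    intro m t i hi
    cases t
    · exact hi
    · change A m (T.sb (T.sb i)); rw [hC.sb_sb]; exact hi
  have hLlk : ∀ m t, ∃ l0, ∀ i, L (m, t) i →
      ∃ j, T.nbr (i, .a0) = (j, bif t then .d3 else .b0) ∧ L l0 j := by
    intro m t
    refine ⟨(n + 1 - m, false), fun i hi => ?_⟩
    have key : ∀ {i}, A m i → ∃ j, T.nbr (i, .a0) = (j, .d3) ∧ L (n + 1 - m, false) j := by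
      rintro i ⟨y, hy, hm, hmn, rfl⟩
      obtain ⟨z, hz, h1⟩ := hlink hy
      refine ⟨_, h1 m hm hmn, ?_⟩
      change A _ (T.sb (T.sb _))
      rw [hC.sb_sb]
      exact ⟨z, hz, by omega, by omega, rfl⟩
    cases t
    · obtain ⟨j, h1, h2⟩ := key (i := T.sb i) hi
      have h3 := hK h1
      rw [hC.sb_sb] at h3
      exact ⟨j, h3, h2⟩
    · exact key hi
  have hLsc : ∀ m t, ∃ lc, ∀ i, L (m, t) i → L lc (T.sc i) := by
    have key : ∀ m, ∃ m' t', ∀ i, A m i → L (m', t') (T.sc i) := by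
      intro m
      rcases Nat.mod_two_eq_zero_or_one m with h1 | h1
      · refine ⟨m - 1, true, ?_⟩
        rintro i ⟨y, hy, hm, hmn, rfl⟩
        exact ⟨y, hy, by omega, by omega, (hfan hy).step_odd' hC h1 hm (by omega)⟩
      · by_cases h2 : m = n
        · refine ⟨n, false, ?_⟩
          rintro i ⟨y, hy, hm, hmn, rfl⟩
          obtain ⟨z, hz, h3⟩ := hend hy
          refine ⟨z, hz, hn, le_rfl, ?_⟩
          change T.sb (T.sc (e y m)) = e z n
          rw [show e y m = e y n from congrArg (e y) h2, h3, hC.sb_sb]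
        · refine ⟨m + 1, true, ?_⟩
          rintro i ⟨y, hy, hm, hmn, rfl⟩
          exact ⟨y, hy, by omega, by omega, ((hfan hy).step_odd m h1 (by omega)).symm⟩
    intro m t
    obtain ⟨m', t', h1⟩ := key m
    cases t
    · refine ⟨(m', !t'), fun i hi => ?_⟩
      have h2 := hLsb (h1 (T.sb i) hi)
      rwa [hC.sb_sc, hC.sb_sb] at h2
    · exact ⟨(m', t'), h1⟩
  have hLa3' : ∀ m t, ∃ t3 l3, ∀ i, L (m, t) i → ∃ j, T.nbr (i, .a3) = (j, t3) ∧ L l3 j := by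
    rintro m (_ | _)
    · obtain ⟨⟨m', t'⟩, h1⟩ := hLlk m false
      refine ⟨.b0, (m', !t'), fun i hi => ?_⟩
      obtain ⟨j, h2, h3⟩ := h1 i hi
      exact ⟨_, hC.nbr_a3_of_nbr_a0 hAB h2, hLsb h3⟩
    · rcases Nat.mod_two_eq_zero_or_one m with h1 | h1
      · refine ⟨.a3, (m + 1, true), ?_⟩
        rintro i ⟨y, hy, hm, hmn, rfl⟩
        have h2 := hodd hy
        exact ⟨_, (hfan hy).step_even m h1 hm (by omega), y, hy, by simp, by simp; omega, rfl⟩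
      · by_cases h2 : m = 1
        · refine ⟨.d3, (1, true), ?_⟩
          rintro i ⟨y, hy, hm, hmn, rfl⟩
          subst h2
          have h3 : Apex (e y 1) := snd_nbr (hapex_symm (he1 hy))
          exact ⟨y, hapex_symm (he1 hy), e y 1, h3, one_pos, hn,
            fst_eq_of_nbr (hapex_symm (he1 hy)) (he1 h3)⟩
        · refine ⟨.a3, (m - 1, true), ?_⟩
          rintro i ⟨y, hy, hm, hmn, rfl⟩
          exact ⟨_, (hfan hy).step_even' h1 (by omega) (by omega), y, hy, by simp; omega,
            by simp; omega, rfl⟩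
  have hlabel : ∀ {g i j} (l : ℕ × Bool), L l i → L l j → T.Maps g i j → g ∈ T.symmetryGroup := by
    intro g i j l hi hj hg
    refine hC.mem_symmetryGroup_of_label L ?_ hi hj hg
    rintro ⟨m, t⟩
    obtain ⟨l0, h0⟩ := hLlk m t
    obtain ⟨t3, l3, h3⟩ := hLa3' m t
    obtain ⟨lc, hc⟩ := hLsc m t
    exact ⟨_, t3, l0, l3, (m, !t), lc, fun i hi => ⟨h0 i hi, h3 i hi, hLsb hi, hc i hi⟩⟩
  -- the weights vanish at all vertices except those of type `αδⁿ⁺¹`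
  have hcount : {v | v ∈ T.vertices ∧ T.vertexType v = ![1, 0, 0, n + 1]}.ncard = 4 := by
    have h1 := T.mul_ncard_vertices ![2, -1, 0, -2] (-2 * n) (· = ![1, 0, 0, n + 1])
      (fun x hx => by rw [hx]; simp [Fin.sum_univ_four]; ring)
      (fun x hx => by
        rcases hv x with h1 | h1 | h1 | h1
        · rw [h1]; simp [Fin.sum_univ_four]
        · rw [h1]; simp [Fin.sum_univ_four]
        · rw [h1]; simp [Fin.sum_univ_four]
        · exact absurd h1 hx)
    simp only [Fin.sum_univ_four] at h1
    generalize {v | v ∈ T.vertices ∧ T.vertexType v = ![1, 0, 0, n + 1]}.ncard = c at h1 ⊢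
    simp at h1
    have h2 : (n : ℤ) * (2 * c) = n * 8 := by linarith
    have h3 := mul_left_cancel₀ (by exact_mod_cast hn.ne') h2
    omega
  obtain ⟨hfin, hcard⟩ := T.card_symmetryGroup_le (t := ![1, 0, 0, n + 1]) rfl (by rw [h]; simp)
  rw [hcount] at hcard
  have hvApex : ∀ v ∈ T.vertices, T.vertexType v = ![1, 0, 0, n + 1] →
      ∃ y, Apex y ∧ (T.tile y).corner 0 = v := by
    rintro v ⟨i, k, rfl⟩ hvt
    obtain ⟨a, rfl⟩ := Fl.exists_corner k
    obtain ⟨y, hy⟩ := T.exists_flag_corner .a3 (x := (i, a))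
      (by change 0 < T.vertexType ((T.tile i).corner a.corner) 0; rw [hvt]; simp)
    have h5 : T.vt (y, .a3) = ![1, 0, 0, n + 1] := by rw [vt, hy]; exact hvt
    exact ⟨y, hvA h5, hy⟩
  -- the half-turns about the midpoints of the edges `AD`-`DA`
  have hflip : ∀ {y}, Apex y → ∃ κ ∈ T.symmetryGroup, ∃ m ∈ (T.tile y).openSide 3,
      IsHalfTurn κ m := by
    intro y hy
    have h1 : Apex (e y 1) := snd_nbr (hapex_symm (he1 hy))
    have h2 : e (e y 1) 1 = y := fst_eq_of_nbr (he1 h1) (hapex_symm (he1 hy))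
    have h3 : Apex (e (e y 1) 1) := by rw [h2]; exact hy
    obtain ⟨κ, hκ⟩ := T.exists_maps y (e y 1)
    obtain ⟨m, hm, h4⟩ := hκ.isHalfTurn (he1 hy)
    exact ⟨κ, hlabel (1, true) ⟨e y 1, h1, one_pos, hn, h2.symm⟩ ⟨y, hy, one_pos, hn, rfl⟩ hκ,
      m, hm, h4⟩
  obtain ⟨y, hy⟩ : ∃ y, Apex y := by
    obtain ⟨x, hx⟩ := T.exists_flag_of_mem_avc (t := ![1, 0, 0, n + 1]) (by rw [h]; simp)
    obtain ⟨y, h1, -⟩ := hvApex _ ⟨x.1, x.2.corner, rfl⟩ hx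
    exact ⟨y, h1⟩
  obtain ⟨z, hz, hzy, hzy'⟩ : ∃ z, Apex z ∧ z ≠ y ∧ z ≠ e y 1 := by
    by_contra! hcon
    have h1 : {v | v ∈ T.vertices ∧ T.vertexType v = ![1, 0, 0, n + 1]} ⊆
        {(T.tile y).corner 0, (T.tile (e y 1)).corner 0} := by
      rintro v ⟨h1, h2⟩
      obtain ⟨z, h3, rfl⟩ := hvApex v h1 h2
      by_cases h4 : z = y
      · rw [h4]; exact mem_insert _ _
      · rw [hcon z h3 h4]; exact mem_insert_of_mem _ rfl
    have h2 := (Set.ncard_le_ncard h1 (Set.toFinite _)).trans (Set.ncard_insert_le _ _)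
    rw [hcount, Set.ncard_singleton] at h2
    omega
  obtain ⟨κ, hκ, m, hm, hκm⟩ := hflip hy
  obtain ⟨κ', hκ', m', hm', hκm'⟩ := hflip hz
  -- the half-turn about the midpoint of an edge `AB` in the middle of two linked fans
  obtain ⟨i, η, hη, m'', hi, hm'', hηm⟩ : ∃ i, ∃ η ∈ T.symmetryGroup, ∃ m : S2,
      (T.nbr (i, .a0)).2 = .b0 ∧ m ∈ (T.tile i).openSide 0 ∧ IsHalfTurn η m := by
    obtain ⟨z, hz, h1⟩ := hlink hy
    have h2 := hodd hy
    obtain ⟨k, hk⟩ : ∃ k, k = (n + 1) / 2 := ⟨_, rfl⟩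
    have h3 := h1 k (by omega) (by omega)
    rw [show n + 1 - k = k by omega] at h3
    have h4 := hK h3
    obtain ⟨η, hη⟩ := T.exists_maps (T.sb (e y k)) (T.sb (e z k))
    obtain ⟨m, hm, h5⟩ := hη.isHalfTurn h4
    refine ⟨_, η, hlabel (k, false) ?_ ?_ hη, m, snd_nbr h4, hm, h5⟩
    · exact ⟨y, hy, by simp; omega, by simp; omega, hC.sb_sb _⟩
    · exact ⟨z, hz, by simp; omega, by simp; omega, hC.sb_sb _⟩
  have hiy : ∀ {y}, Apex y → (m'' : E3) ∉ ((↑) '' (T.tile y).openSide 3 : Set E3) := by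
    rintro y hy ⟨p, hp, hp'⟩
    obtain rfl : p = m'' := Subtype.ext hp'
    have hne : ∀ {y}, Apex y → i ≠ y := by
      rintro y hy rfl
      have h1 := hLa3 hi
      exact absurd ((show (T.nbr (i, .a3)).2 = .d3 from hy).symm.trans (snd_nbr h1)) (by decide)
    rcases eq_or_eq_nbr_of_mem_region (a := .a3) hp ((T.tile i).side_subset_region _ hm''.1)
      with h1 | h1
    · exact hne hy h1
    · rw [he1 hy] at h1
      exact hne (snd_nbr (hapex_symm (he1 hy))) h1
  have hmm' : (m' : E3) ≠ m := by
    intro h1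
    rw [Subtype.ext h1] at hm'
    rcases eq_or_eq_nbr_of_mem_region (a := .a3) hm ((T.tile z).side_subset_region _ hm'.1)
      with h1 | h1
    · exact hzy h1
    · rw [he1 hy] at h1
      exact hzy' h1
  by_cases h1 : κ = κ'
  · by_cases h2 : κ = η
    · -- a half-turn does not have three fixed points
      exfalso
      subst h1 h2
      have h3 := (hκm.eq_or_eq_neg hκm'.norm hκm'.apply_self).resolve_left hmm'
      rcases hκm.eq_or_eq_neg hηm.norm hηm.apply_self with h4 | h4
      · exact hiy hy ⟨m, hm, h4.symm⟩
      · exact hiy hz ⟨m', hm', h3.trans h4.symm⟩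
    · exact conjugate_groupD_two hκm hηm hκ hη h2 hfin hcard
  · exact conjugate_groupD_two hκm hκm' hκ hκ' h1 hfin hcard

/-! ### The tilings with `β²δ^((f - 8) / 8)` and `αδ^((f + 8) / 8)` -/

/-- With `f = 8 (p + 1)`, each tile, or its neighbour across `BC`, is in the fan of angles `δ` at a
vertex `β²δᵖ` or at a vertex `αδᵖ⁺²`. The kind of the fan and the position of the tile in it are a
label which determines the labels of the neighbours and the way in which they are attached. There
are at most two vertices `αδᵖ⁺²`, on which the symmetry group acts freely, and the half-turn about
the midpoint of an edge `AD`-`DA` between two paired fans is a symmetry. -/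
theorem conjugate_groupC_two_of_avc (hf : 8 ∣ f)
    (h : T.avc = {![1, 2, 0, 0], ![2, 0, 0, 2], ![0, 0, 4, 0], ![0, 2, 0, (f - 8) / 8],
      ![1, 0, 0, (f + 8) / 8]}) :
    Conjugate T.symmetryGroup (groupC 2) := by
  obtain ⟨p, rfl⟩ : ∃ p, f = 8 * (p + 1) := by
    obtain ⟨n, rfl⟩ := hf
    obtain ⟨i⟩ := T.exists_tile
    have := i.pos
    exact ⟨n - 1, by omega⟩
  rw [show (8 * (p + 1) - 8) / 8 = p by omega, show (8 * (p + 1) + 8) / 8 = p + 2 by omega] at h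
  have hv : ∀ x, T.vt x = ![1, 2, 0, 0] ∨ T.vt x = ![2, 0, 0, 2] ∨ T.vt x = ![0, 0, 4, 0] ∨
      T.vt x = ![0, 2, 0, p] ∨ T.vt x = ![1, 0, 0, p + 2] := by
    intro x
    have := T.vt_mem_avc x
    rwa [h] at this
  have hC : T.GammaFour := by
    intro x hx
    rcases hv x with h1 | h1 | h1 | h1 | h1 <;> rw [h1] at hx ⊢ <;> simp at hx ⊢
  have hAB : T.AlphaBeta := by
    intro x hx hx'
    rcases hv x with h1 | h1 | h1 | h1 | h1 <;> rw [h1] at hx hx' ⊢ <;> simp at hx hx' ⊢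
  have hAD : ∀ x, 0 < T.vt x 0 → 0 < T.vt x 3 → T.vt x = ![2, 0, 0, 2] ∨
      T.vt x = ![1, 0, 0, p + 2] := by
    intro x hx hx'
    rcases hv x with h1 | h1 | h1 | h1 | h1 <;> rw [h1] at hx hx' ⊢ <;> simp at hx hx' ⊢
  have hBD : ∀ x, 0 < T.vt x 1 → 0 < T.vt x 3 → T.vt x = ![0, 2, 0, p] := by
    intro x hx hx'
    rcases hv x with h1 | h1 | h1 | h1 | h1 <;> rw [h1] at hx hx' ⊢ <;> simp at hx hx' ⊢
  have hAA' : ∀ {x}, x.2.corner = 0 → (T.nbr x).2.corner = 0 → T.vt x = ![2, 0, 0, 2] := by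
    intro x hx e
    have h2 := T.vt_pos x
    have h3 := corner_nbr_ne (T := T) (x := x)
    rw [hx] at h2 h3
    rcases hv x with h1 | h1 | h1 | h1 | h1
    · exact absurd e (h3 (by rw [h1]; rfl))
    · exact h1
    · rw [h1] at h2; simp at h2
    · rw [h1] at h2; simp at h2
    · exact absurd e (h3 (by rw [h1]; rfl))
  have hAA : ∀ {i j}, T.nbr (i, .a3) = (j, .a3) → T.vt (i, .a3) = ![2, 0, 0, 2] := fun e =>
    hAA' rfl (by rw [e]; rfl)
  have hBB : ∀ {i j}, T.nbr (i, .b0) ≠ (j, .b0) := by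
    intro i j e
    have h1 := hC.three_le_beta e
    rcases hv (i, .b0) with h2 | h2 | h2 | h2 | h2 <;> rw [h2] at h1 <;> simp at h1
  have hT : ∀ {i j}, T.nbr (i, .a0) ≠ (j, .a0) := fun e => hBB (nbr_r0_of_eq e)
  have hK : ∀ {i j}, T.nbr (i, .a0) = (j, .d3) → T.nbr (T.sb i, .a0) = (j, .b0) := fun hi =>
    hC.link_of_sb hAB hi
  have hKL : ∀ {i j}, T.nbr (i, .a0) = (j, .d3) → (T.nbr (j, .a0)).2 = .b0 := fun hi =>
    snd_nbr (GammaFour.link_symm (hK hi))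
  have hL : ∀ {i j}, T.nbr (i, .a0) = (j, .b0) → T.nbr (T.sb i, .a0) = (j, .d3) := fun hi =>
    hC.link_sb hAB hi
  have hLa3 : ∀ {i j}, T.nbr (i, .a0) = (j, .b0) → T.nbr (i, .a3) = (T.sb j, .b0) := fun hi =>
    hC.nbr_a3_of_nbr_a0 hAB hi
  have hAB3 : ∀ i, (T.nbr (i, .a0)).2 = .b0 ∨ (T.nbr (i, .a0)).2 = .d3 ∨
      (T.nbr (i, .a0)).2 = .a3 := by
    intro i
    have h1 := T.cls_nbr (i, .a0)
    have h2 : (T.nbr (i, .a0)).2 ≠ .a0 := fun e => hT (nbr_a0 e)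
    revert h1 h2
    generalize (T.nbr (i, .a0)).2 = b
    cases b <;> simp [Fl.cls]
  -- the tiles that are attached along `AB` to an edge `AD` with the same end `A`
  have hS : ∀ {i j}, T.nbr (i, .a0) = (j, .a3) → ∃ k, T.nbr (i, .a3) = (k, .d3) ∧
      T.nbr (j, .a0) = (T.sc k, .d3) ∧ T.vt (i, .a3) = ![2, 0, 0, 2] := by
    intro i j e
    have h1 : T.vt (i, .a0) = ![2, 0, 0, 2] := hAA' rfl (by rw [e]; rfl)
    obtain ⟨k, h2, h3⟩ := hC.alpha_alpha (x := (i, .a0)) rfl h1 (by rw [e]; rfl)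
    rw [e] at h3
    exact ⟨k, h2, h3, h1⟩
  -- `S`: the side `AB` is the side `AD` of the neighbour
  let S : Fin (8 * (p + 1)) → Prop := fun i => (T.nbr (i, .a0)).2 = .a3
  have hSsb : ∀ {i}, S i → S (T.sb i) := by
    intro i (hi : _ = _)
    rcases hAB3 (T.sb i) with h1 | h1 | h1
    · have h2 := snd_nbr (hL (nbr_a0 h1))
      rw [hC.sb_sb, hi] at h2
      exact absurd h2 (by decide)
    · have h2 := snd_nbr (hK (nbr_a0 h1))
      rw [hC.sb_sb, hi] at h2
      exact absurd h2 (by decide)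
    · exact h1
  -- an edge `AD`-`DA` whose end `A` is at a vertex `α²δ²`
  have hQ : ∀ {k i}, T.nbr (k, .a3) = (i, .d3) → T.vt (k, .a3) = ![2, 0, 0, 2] →
      (T.nbr (T.sc i, .a0)).2 = .b0 ∧ S k := by
    intro k i hk hvk
    obtain ⟨h1, h2⟩ := hC.alpha_delta (x := (k, .a3)) rfl hvk hk
    rcases e : T.nbr (T.sc i, .d3) with ⟨j, b⟩
    have h3 := cls_of_nbr e
    rw [e] at h1 h2
    change T.nbr (k, .a0) = (j, b.r1) at h2
    cases b <;> simp [Fl.corner, Fl.cls] at h1 h3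
    · exact ⟨hKL (nbr_symm e), snd_nbr h2⟩
    · exact absurd h2 hT
  have hQsymm : ∀ {k i}, T.nbr (k, .a3) = (i, .d3) → T.nbr (i, .a3) = (k, .d3) := fun hk =>
    nbr_symm (nbr_r0_of_eq hk)
  have hp : 0 < p := by
    obtain ⟨x, hx⟩ := T.exists_flag_of_mem_avc (t := ![0, 2, 0, p]) (by rw [h]; simp)
    have h1 := T.three_le_deg x
    rw [deg_of_vt hx] at h1
    simp [Fin.sum_univ_four] at h1
    omega
  -- the fans at the vertices `αδᵖ⁺²` and `β²δᵖ`, indexed by the first tile `St` of the former,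
  -- which has its angle `β` at the latter
  let V : Fin (8 * (p + 1)) → ℕ → Fin (8 * (p + 1)) := fun i => T.fan ((T.nbr (i, .a3)).1, .a3)
  let W : Fin (8 * (p + 1)) → ℕ → Fin (8 * (p + 1)) := fun i => T.fan (i, .b0)
  let St : Fin (8 * (p + 1)) → Prop := fun i => S i ∧ (T.nbr (T.sc i, .a0)).2 = .d3
  have hW : ∀ {i}, S i → T.IsFan (i, .b0) p ∧ T.nbr (i, .a0) = (W i 1, .a3) ∧
      T.nbr (T.sb i, .a0) = (W i p, .a3) := by
    intro i hi
    have h1 : T.nbr (i, .b0) = (T.lk i, .d3) := nbr_r0_of_eq (nbr_a0 hi)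
    have h2 := T.vt_nbr_pos (i, .b0)
    rw [h1] at h2
    obtain ⟨h3, h4⟩ := hC.isFan_beta (hBD _ (T.vt_pos (i, .b0)) h2)
    refine ⟨h3, nbr_r0_of_eq (h3.first hp), ?_⟩
    have h5 := h3.last hp
    rw [h4] at h5
    exact nbr_r0_of_eq (nbr_symm h5)
  have hVfan : ∀ {k i}, T.nbr (k, .a3) = (i, .d3) → T.vt (k, .a3) = ![1, 0, 0, p + 2] →
      T.IsFan (k, .a3) (p + 2) ∧ T.fan (k, .a3) 1 = i ∧
        T.nbr (k, .a0) = (T.fan (k, .a3) (p + 2), .d3) := by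
    intro k i hk hvk
    obtain ⟨h1, h2⟩ := hC.isFan_alpha rfl hvk
    refine ⟨h1, fst_eq_of_nbr (h1.first (by omega)) hk, ?_⟩
    have h3 := h1.last (by omega)
    rw [h2] at h3
    exact nbr_symm h3
  have hor : ∀ {i k}, T.nbr (i, .a3) = (k, .d3) →
      ((T.nbr (T.sc i, .a0)).2 = .b0 ∧ S k) ∨
      ((T.nbr (T.sc i, .a0)).2 = .d3 ∧ T.vt (k, .a3) = ![1, 0, 0, p + 2]) := by
    intro i k hi
    have hk := hQsymm hi
    have h1 := T.vt_nbr_pos (k, .a3)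
    rw [hk] at h1
    rcases hAD _ (T.vt_pos (k, .a3)) h1 with h2 | h2
    · exact Or.inl (hQ hk h2)
    · right
      refine ⟨?_, h2⟩
      obtain ⟨h3, h4, -⟩ := hVfan hk h2
      have h5 := h3.step_odd 1 rfl (by omega)
      rw [h4] at h5
      have h6 := h3.step_even 2 rfl two_pos (by omega)
      rw [show 2 = 1 + 1 from rfl, h5] at h6
      rcases hAB3 (T.sc i) with h7 | h7 | h7
      · exact absurd (snd_eq_of_nbr h6 (hLa3 (nbr_a0 h7))) (by decide)
      · exact h7
      · obtain ⟨l, h8, -⟩ := hS (nbr_a0 h7)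
        exact absurd (snd_eq_of_nbr h6 h8) (by decide)
  have hSt : ∀ {i}, S i → (T.nbr (T.sc i, .a0)).2 = .b0 → St (T.sb i) := by
    intro i hi h1
    refine ⟨hSsb hi, ?_⟩
    rw [← hC.sb_sc]
    exact snd_nbr (hL (nbr_a0 h1))
  -- the first tiles of the fans come in pairs
  have hpair : ∀ {i}, St i → ∃ j, St j ∧ T.nbr (T.sb i, .a3) = (T.sb j, .d3) := by
    intro i hi
    obtain ⟨k, h1, -, h2⟩ := hS (nbr_a0 (hSsb hi.1))
    have h3 := snd_nbr (hK (nbr_a0 hi.2))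
    rw [hC.sb_sc] at h3
    rcases hor h1 with h4 | h4
    · refine ⟨T.sb k, hSt h4.2 (hQ h1 h2).1, ?_⟩
      rw [hC.sb_sb]
      exact h1
    · exact absurd (h3.symm.trans h4.1) (by decide)
  have hVdata : ∀ {i}, St i → T.IsFan ((T.nbr (i, .a3)).1, .a3) (p + 2) ∧ V i 1 = i ∧
      T.nbr ((T.nbr (i, .a3)).1, .a0) = (V i (p + 2), .d3) ∧
      T.nbr (i, .a3) = ((T.nbr (i, .a3)).1, .d3) := by
    intro i hi
    obtain ⟨k, h1, -, -⟩ := hS (nbr_a0 hi.1)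
    rcases hor h1 with h2 | h2
    · exact absurd (h2.1.symm.trans hi.2) (by decide)
    · have h3 := hVfan (hQsymm h1) h2.2
      have h4 : (T.nbr (i, .a3)).1 = k := by rw [h1]
      refine ⟨?_, ?_, ?_, ?_⟩
      · rw [h4]; exact h3.1
      · change T.fan ((T.nbr (i, .a3)).1, .a3) 1 = i; rw [h4]; exact h3.2.1
      · change T.nbr _ = (T.fan ((T.nbr (i, .a3)).1, .a3) _, _); rw [h4]; exact h3.2.2
      · rw [h4]; exact h1
  have heven : ∀ {i}, St i → p % 2 = 0 := fun hi => (hW hi.1).1.even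
  -- a fan `V` is linked with the fan `W` of the paired tile, except for its ends
  have hlink : ∀ {i j}, St i → St j → T.nbr (T.sb i, .a3) = (T.sb j, .d3) → ∀ m, 2 ≤ m →
      m ≤ p + 1 → T.nbr (V i m, .a0) = (T.sb (W j (p + 2 - m)), .d3) := by
    intro i j hi hj hij
    obtain ⟨hf1, h1, -⟩ := hVdata hi
    obtain ⟨hf2, -, h3⟩ := hW hj.1
    refine hC.link_fan hAB hAA (M := p + 2) (a := 2) (b := p + 1) hf1 hf2 hf1.even two_pos
      (by omega) (by omega) (by omega) ?_
    obtain ⟨k, h4, h5, -⟩ := hS h3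
    obtain rfl := fst_eq_of_nbr h4 (hQsymm hij)
    have h6 : V i 2 = T.sc i := by
      have h7 := hf1.step_odd 1 rfl (by omega)
      change V i (1 + 1) = T.sc (V i 1) at h7
      rwa [h1] at h7
    apply hC.link_comm hAB
    change T.nbr (W j p, .a0) = (T.sb (V i 2), .d3)
    rw [h5, h6, hC.sb_sc]
  have hend : ∀ {i j}, St i → St j → T.nbr (T.sb i, .a3) = (T.sb j, .d3) →
      (T.nbr (i, .a3)).1 = T.sb (V j (p + 2)) := by
    intro i j hi hj hij
    obtain ⟨hf1, -, -⟩ := hVdata hj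
    obtain ⟨-, h2, -⟩ := hW hi.1
    obtain ⟨k, h3, h4, -⟩ := hS h2
    have h5 := hlink hj hi (hQsymm hij) (p + 1) (by omega) le_rfl
    rw [show p + 2 - (p + 1) = 1 by omega] at h5
    have h6 := fst_eq_of_nbr h4 (hC.link_comm hAB h5)
    have h7 : V j (p + 2) = T.sc (V j (p + 1)) :=
      hf1.step_odd (p + 1) (by have := heven hi; omega) (by omega)
    rw [h3, h7, hC.sb_sc, ← h6, hC.sc_sc]
  have hlast : ∀ {i j}, St i → St j → T.nbr (T.sb i, .a3) = (T.sb j, .d3) →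
      T.nbr (T.sb (V j (p + 2)), .a0) = (V i (p + 2), .d3) := by
    intro i j hi hj hij
    rw [← hend hi hj hij]
    exact (hVdata hi).2.2.1
  -- the label `(c, m, t)`: the kind `c` of the fan, the position `m` in it, and whether the tile
  -- itself or its neighbour across `BC` is in the fan
  let A : Bool → ℕ → Fin (8 * (p + 1)) → Prop := fun c m i =>
    ∃ s, St s ∧ 0 < m ∧ m ≤ (bif c then p + 2 else p) ∧ i = bif c then V s m else W s m
  let L : Bool × ℕ × Bool → Fin (8 * (p + 1)) → Prop := fun l i =>
    A l.1 l.2.1 (bif l.2.2 then i else T.sb i)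
  have hVL : ∀ {s m}, St s → 0 < m → m ≤ p + 2 → L (true, m, true) (V s m) := fun hs h1 h2 =>
    ⟨_, hs, h1, h2, rfl⟩
  have hWL : ∀ {s m}, St s → 0 < m → m ≤ p → L (false, m, true) (W s m) := fun hs h1 h2 =>
    ⟨_, hs, h1, h2, rfl⟩
  have hLsb : ∀ {c m t i}, L (c, m, t) i → L (c, m, !t) (T.sb i) := by
    intro c m t i hi
    cases t
    · exact hi
    · change A c m (T.sb (T.sb i)); rw [hC.sb_sb]; exact hi
  have hL1 : ∀ {s}, St s → L (true, 1, true) s := fun {s} hs =>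
    ⟨s, hs, one_pos, by simp, (hVdata hs).2.1.symm⟩
  have hstep : ∀ c m t, ∃ (t0 t3 : Fl) (l0 l3 lc : Bool × ℕ × Bool), ∀ i, L (c, m, t) i →
      (∃ j, T.nbr (i, .a0) = (j, t0) ∧ L l0 j) ∧ (∃ j, T.nbr (i, .a3) = (j, t3) ∧ L l3 j) ∧
      L lc (T.sc i) := by
    have hsc : ∀ c m, ∃ m', ∀ i, A c m i → A c m' (T.sc i) := by
      intro c m
      have hfan : ∀ {s}, St s → ∃ x, T.IsFan x (bif c then p + 2 else p) ∧
          (bif c then V s else W s) = T.fan x := by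
        intro s hs
        cases c
        · exact ⟨_, (hW hs.1).1, rfl⟩
        · exact ⟨_, (hVdata hs).1, rfl⟩
      have hbif : ∀ s m, (bif c then V s m else W s m) = (bif c then V s else W s) m := by
        intro s m; cases c <;> rfl
      rcases Nat.mod_two_eq_zero_or_one m with h1 | h1
      · refine ⟨m - 1, ?_⟩
        rintro i ⟨s, hs, hm, hmn, rfl⟩
        obtain ⟨x, hx, hx'⟩ := hfan hs
        refine ⟨s, hs, by omega, by omega, ?_⟩
        rw [hbif, hbif, hx']
        exact hx.step_odd' hC h1 hm hmn
      · refine ⟨m + 1, ?_⟩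
        rintro i ⟨s, hs, hm, hmn, rfl⟩
        obtain ⟨x, hx, hx'⟩ := hfan hs
        have h2 := hx.even
        refine ⟨s, hs, by omega, by omega, ?_⟩
        rw [hbif, hbif, hx']
        exact (hx.step_odd m h1 (by omega)).symm
    have hsc' : ∀ c m t, ∃ lc, ∀ i, L (c, m, t) i → L lc (T.sc i) := by
      intro c m t
      obtain ⟨m', h1⟩ := hsc c m
      refine ⟨(c, m', t), fun i hi => ?_⟩
      cases t
      · have h2 := h1 (T.sb i) hi
        rw [← hC.sb_sc] at h2
        exact h2
      · exact h1 i hi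
    suffices h0 : ∀ c m, ∃ (t0 t3 u0 u3 : Fl) (l0 l3 k0 k3 : Bool × ℕ × Bool), ∀ i, A c m i →
        (∃ j, T.nbr (i, .a0) = (j, t0) ∧ L l0 j) ∧ (∃ j, T.nbr (i, .a3) = (j, t3) ∧ L l3 j) ∧
        (∃ j, T.nbr (T.sb i, .a0) = (j, u0) ∧ L k0 j) ∧
        (∃ j, T.nbr (T.sb i, .a3) = (j, u3) ∧ L k3 j) by
      intro c m t
      obtain ⟨lc, hlc⟩ := hsc' c m t
      obtain ⟨t0, t3, u0, u3, l0, l3, k0, k3, h1⟩ := h0 c m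
      cases t
      · refine ⟨u0, u3, k0, k3, lc, fun i hi => ?_⟩
        obtain ⟨-, -, h2, h3⟩ := h1 (T.sb i) hi
        rw [hC.sb_sb] at h2 h3
        exact ⟨h2, h3, hlc i hi⟩
      · refine ⟨t0, t3, l0, l3, lc, fun i hi => ?_⟩
        obtain ⟨h2, h3, -, -⟩ := h1 i hi
        exact ⟨h2, h3, hlc i hi⟩
    -- linked tiles in the two kinds of fans
    have hmid : ∀ {i j : Fin (8 * (p + 1))} {l : Bool × ℕ},
        T.nbr (i, .a0) = (T.sb j, .d3) → L (l.1, l.2, true) j →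
        (∃ j, T.nbr (i, .a0) = (j, .d3) ∧ L (l.1, l.2, false) j) ∧
        (∃ j, T.nbr (T.sb i, .a0) = (j, .b0) ∧ L (l.1, l.2, false) j) ∧
        (∃ j, T.nbr (T.sb i, .a3) = (j, .b0) ∧ L (l.1, l.2, true) j) := by
      intro i j l hi hj
      have h1 := hLa3 (hK hi)
      rw [hC.sb_sb] at h1
      exact ⟨⟨_, hi, hLsb hj⟩, ⟨_, hK hi, hLsb hj⟩, ⟨_, h1, hj⟩⟩
    rintro (_ | _) m
    · -- the fan at a vertex `β²δᵖ`
      have h0 : ∃ t3 l3, ∀ s, St s → 0 < m → m ≤ p →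
          ∃ j, T.nbr (W s m, .a3) = (j, t3) ∧ L l3 j := by
        by_cases h1 : m = 1
        · refine ⟨.a0, (true, 1, true), fun s hs _ _ => ⟨s, ?_, hL1 hs⟩⟩
          rw [h1]; exact nbr_symm (hW hs.1).2.1
        by_cases h2 : m = p
        · refine ⟨.a0, (true, 1, false), fun s hs _ _ => ⟨T.sb s, ?_, hLsb (hL1 hs)⟩⟩
          have h3 := nbr_symm (hW hs.1).2.2
          rwa [show W s p = W s m from congrArg (W s) h2.symm] at h3
        rcases Nat.mod_two_eq_zero_or_one m with h3 | h3
        · exact ⟨.a3, (false, m + 1, true), fun s hs hm hmp =>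
            ⟨_, (hW hs.1).1.step_even m h3 hm (by omega), hWL hs (by omega) (by omega)⟩⟩
        · exact ⟨.a3, (false, m - 1, true), fun s hs hm hmp =>
            ⟨_, (hW hs.1).1.step_even' h3 (by omega) hmp, hWL hs (by omega) (by omega)⟩⟩
      obtain ⟨t3, l3, h0⟩ := h0
      refine ⟨.d3, t3, .b0, .b0, (true, p + 2 - m, false), l3, (true, p + 2 - m, false),
        (true, p + 2 - m, true), ?_⟩
      rintro i ⟨s, hs, hm, hmp, rfl⟩
      change m ≤ p at hmp
      obtain ⟨j, hj, hij⟩ := hpair hs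
      have h1 := hC.link_comm hAB (hlink hj hs (hQsymm hij) (p + 2 - m) (by omega) (by omega))
      rw [show p + 2 - (p + 2 - m) = m by omega] at h1
      obtain ⟨h2, h3, h4⟩ := hmid (l := (true, p + 2 - m)) h1 (hVL hj (by omega) (by omega))
      exact ⟨h2, h0 s hs hm hmp, h3, h4⟩
    · -- the fan at a vertex `αδᵖ⁺²`
      by_cases h1 : m = 1
      · refine ⟨.a3, .d3, .a3, .d3, (false, 1, true), (true, p + 2, false), (false, p, true),
          (true, 1, false), ?_⟩
        rintro i ⟨s, hs, hm, hmp, rfl⟩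
        subst h1
        obtain ⟨j, hj, hij⟩ := hpair hs
        obtain ⟨-, h2, -, h3⟩ := hVdata hs
        rw [hend hs hj hij] at h3
        change (∃ j, T.nbr (V s 1, _) = _ ∧ _) ∧ (∃ j, T.nbr (V s 1, _) = _ ∧ _) ∧
          (∃ j, T.nbr (T.sb (V s 1), _) = _ ∧ _) ∧ (∃ j, T.nbr (T.sb (V s 1), _) = _ ∧ _)
        rw [h2]
        exact ⟨⟨_, (hW hs.1).2.1, hWL hs one_pos hp⟩,
          ⟨_, h3, hLsb (hVL hj (by omega) le_rfl)⟩, ⟨_, (hW hs.1).2.2, hWL hs hp le_rfl⟩,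
          ⟨_, hij, hLsb (hL1 hj)⟩⟩
      by_cases h2 : m = p + 2
      · refine ⟨.b0, .b0, .d3, .d3, (true, p + 2, true), (true, p + 2, false),
          (true, p + 2, true), (true, 1, true), ?_⟩
        rintro i ⟨s, hs, hm, hmp, rfl⟩
        change (∃ j, T.nbr (V s m, _) = _ ∧ _) ∧ (∃ j, T.nbr (V s m, _) = _ ∧ _) ∧
          (∃ j, T.nbr (T.sb (V s m), _) = _ ∧ _) ∧ (∃ j, T.nbr (T.sb (V s m), _) = _ ∧ _)
        rw [show V s m = V s (p + 2) from congrArg (V s) h2]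
        obtain ⟨j, hj, hij⟩ := hpair hs
        have h3 := hlast hj hs (hQsymm hij)
        have h4 := hK h3
        rw [hC.sb_sb] at h4
        have h5 := (hVdata hj).2.2.2
        rw [hend hj hs (hQsymm hij)] at h5
        have h6 := hVL hj (by omega) le_rfl (m := p + 2)
        exact ⟨⟨_, h4, h6⟩, ⟨_, hLa3 h4, hLsb h6⟩, ⟨_, h3, h6⟩, ⟨_, hQsymm h5, hL1 hj⟩⟩
      have h0 : ∃ l3, ∀ s, St s → 0 < m → m ≤ p + 2 →
          ∃ j, T.nbr (V s m, .a3) = (j, .a3) ∧ L l3 j := by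
        rcases Nat.mod_two_eq_zero_or_one m with h3 | h3
        · exact ⟨(true, m + 1, true), fun s hs hm hmp =>
            ⟨_, (hVdata hs).1.step_even m h3 hm (by omega), hVL hs (by omega) (by omega)⟩⟩
        · exact ⟨(true, m - 1, true), fun s hs hm hmp =>
            ⟨_, (hVdata hs).1.step_even' h3 (by omega) hmp, hVL hs (by omega) (by omega)⟩⟩
      obtain ⟨l3, h0⟩ := h0
      refine ⟨.d3, .a3, .b0, .b0, (false, p + 2 - m, false), l3, (false, p + 2 - m, false),
        (false, p + 2 - m, true), ?_⟩
      rintro i ⟨s, hs, hm, hmp, rfl⟩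
      change m ≤ p + 2 at hmp
      obtain ⟨j, hj, hij⟩ := hpair hs
      obtain ⟨h3, h4, h5⟩ := hmid (l := (false, p + 2 - m))
        (hlink hs hj hij m (by omega) (by omega)) (hWL hj (by omega) (by omega))
      exact ⟨h3, h0 s hs hm hmp, h4, h5⟩
  have hlabel : ∀ {g i j} (l : Bool × ℕ × Bool), L l i → L l j → T.Maps g i j →
      g ∈ T.symmetryGroup := by
    intro g i j l hi hj hg
    refine hC.mem_symmetryGroup_of_label L ?_ hi hj hg
    rintro ⟨c, m, t⟩
    obtain ⟨t0, t3, l0, l3, lc, h1⟩ := hstep c m t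
    refine ⟨t0, t3, l0, l3, (c, m, !t), lc, fun i hi => ?_⟩
    obtain ⟨h2, h3, h4⟩ := h1 i hi
    exact ⟨h2, h3, hLsb hi, h4⟩
  -- the half-turn that exchanges two paired fans
  obtain ⟨i, hi⟩ : ∃ i, St i := by
    obtain ⟨x, hx⟩ := T.exists_flag_of_mem_avc (t := ![0, 2, 0, p]) (by rw [h]; simp)
    obtain ⟨i, h1⟩ := T.exists_flag_corner .b0 (x := x) (by rw [hx]; simp [Fl.corner])
    have h2 : T.vt (i, .b0) = ![0, 2, 0, p] := by rw [vt, h1, hx]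
    have h3 : S i := by
      have h4 := T.vt_nbr_pos (i, .b0)
      rcases e : T.nbr (i, .b0) with ⟨j, b⟩
      have h5 := cls_of_nbr e
      have h6 : T.nbr (i, .a0) = (j, b.r0) := nbr_r0_of_eq e
      rw [e, h2] at h4
      change (T.nbr (i, .a0)).2 = _
      rw [h6]
      cases b <;> simp [Fl.corner, Fl.cls, Fl.r0] at h4 h5 ⊢
      exact hBB e
    obtain ⟨k, h4, -⟩ := hS (nbr_a0 h3)
    rcases hor h4 with h5 | h5
    · exact ⟨_, hSt h3 h5.1⟩
    · exact ⟨i, h3, h5.1⟩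
  obtain ⟨j, hj, hij⟩ := hpair hi
  obtain ⟨η, hη⟩ := T.exists_maps (T.sb i) (T.sb j)
  obtain ⟨m, -, hηm⟩ := hη.isHalfTurn hij
  have hηS : η ∈ T.symmetryGroup := hlabel (true, 1, false) (hLsb (hL1 hi)) (hLsb (hL1 hj)) hη
  -- there are at most two vertices `αδᵖ⁺²`
  have hcount : {v | v ∈ T.vertices ∧ T.vertexType v = ![1, 0, 0, p + 2]}.ncard ≤ 2 := by
    have h1 := T.mul_ncard_vertices ![2, -1, 0, -2] (-2 * (p + 1))
      (fun t => t = ![1, 0, 0, p + 2] ∨ t = ![0, 2, 0, p])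
      (fun x hx => by
        rcases hx with hx | hx <;> rw [hx] <;> simp [Fin.sum_univ_four] <;> ring)
      (fun x hx => by
        rcases hv x with h1 | h1 | h1 | h1 | h1
        · rw [h1]; simp [Fin.sum_univ_four]
        · rw [h1]; simp [Fin.sum_univ_four]
        · rw [h1]; simp [Fin.sum_univ_four]
        · exact absurd (Or.inr h1) hx
        · exact absurd (Or.inl h1) hx)
    obtain ⟨c, hc⟩ : ∃ c, c = {v | v ∈ T.vertices ∧ (T.vertexType v = ![1, 0, 0, p + 2] ∨
      T.vertexType v = ![0, 2, 0, p])}.ncard := ⟨_, rfl⟩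
    rw [← hc] at h1
    -- at both kinds of vertices the weights add up to `-2 (p + 1)`
    have hc4 : c = 4 := by
      simp only [Fin.sum_univ_four] at h1
      simp at h1
      have h2 : ((p : ℤ) + 1) * (2 * c) = (p + 1) * 8 := by linarith
      have h3 := mul_left_cancel₀ (by positivity) h2
      omega
    have hvB : ∀ {i}, St i → T.vertexType ((T.tile i).corner 1) = ![0, 2, 0, p] := by
      intro i hi
      have h1 : T.nbr (i, .b0) = (T.lk i, .d3) := nbr_r0_of_eq (nbr_a0 hi.1)
      have h2 := T.vt_nbr_pos (i, .b0)
      rw [h1] at h2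
      exact hBD _ (T.vt_pos (i, .b0)) h2
    -- the vertices `B` of the two first tiles are different
    have hne : (T.tile i).corner 1 ≠ (T.tile j).corner 1 := by
      intro he
      have h2 : {k : Fin (8 * (p + 1)) | (T.tile k).corner 1 = (T.tile i).corner 1}.ncard = 2 :=
        congrFun (hvB hi) 1
      have hsb : (T.tile (T.sb i)).corner 1 = (T.tile i).corner 1 := by
        have := T.vtx_nbr (i, .b1)
        rw [hC.nbr_b1] at this
        exact this
      have h3 : ({i, T.sb i, j} : Set (Fin (8 * (p + 1)))) ⊆
          {k | (T.tile k).corner 1 = (T.tile i).corner 1} := by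
        rintro k (rfl | rfl | rfl)
        · exact rfl
        · exact hsb
        · exact he.symm
      have h4 := Set.ncard_le_ncard h3 (Set.toFinite _)
      have hij' : i ≠ j := by
        rintro rfl
        have := T.nbr_fst_ne (T.sb i, .a3)
        rw [hij] at this
        exact this rfl
      have hsbj : T.sb i ≠ j := by
        rintro rfl
        have h5 := hj.2
        rw [← hC.sb_sc, hK (nbr_a0 hi.2)] at h5
        exact absurd (show Fl.b0 = Fl.d3 from h5) (by decide)
      rw [h2, ncard_insert_of_notMem (by simp [hij', (hC.sb_ne i).symm]),
        ncard_pair hsbj] at h4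
      omega
    have hdisj : Disjoint {v | v ∈ T.vertices ∧ T.vertexType v = ![1, 0, 0, p + 2]}
        {(T.tile i).corner 1, (T.tile j).corner 1} := by
      rw [Set.disjoint_left]
      rintro v ⟨-, h2⟩ (rfl | rfl)
      · rw [hvB hi] at h2; exact absurd (congrFun h2 0) (by simp)
      · rw [hvB hj] at h2; exact absurd (congrFun h2 0) (by simp)
    have hsub : {v | v ∈ T.vertices ∧ T.vertexType v = ![1, 0, 0, p + 2]} ∪
        {(T.tile i).corner 1, (T.tile j).corner 1} ⊆
        {v | v ∈ T.vertices ∧ (T.vertexType v = ![1, 0, 0, p + 2] ∨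
          T.vertexType v = ![0, 2, 0, p])} := by
      rintro v (⟨h2, h3⟩ | rfl | rfl)
      · exact ⟨h2, Or.inl h3⟩
      · exact ⟨⟨_, _, rfl⟩, Or.inr (hvB hi)⟩
      · exact ⟨⟨_, _, rfl⟩, Or.inr (hvB hj)⟩
    have h5 := Set.ncard_le_ncard hsub (T.finite_vertices.subset fun v hv => hv.1)
    rw [← hc, hc4, Set.ncard_union_eq hdisj (T.finite_vertices.subset fun v hv => hv.1)
      (Set.toFinite _), ncard_pair hne] at h5
    omega
  obtain ⟨hfin, hcard⟩ := T.card_symmetryGroup_le (t := ![1, 0, 0, p + 2]) rfl (by rw [h]; simp)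
  have hG : T.symmetryGroup = Subgroup.closure {η} := by
    refine le_antisymm (fun g hg => ?_) ((Subgroup.closure_le _).mpr (by simpa using hηS))
    have hsub : ({1, η} : Set O3) ⊆ (T.symmetryGroup : Set O3) := by
      rintro _ (rfl | rfl)
      · exact one_mem _
      · exact hηS
    have heq : ({1, η} : Set O3) = (T.symmetryGroup : Set O3) := by
      apply eq_of_subset_of_ncard_le hsub _ (show (T.symmetryGroup : Set O3).Finite from hfin)
      rw [ncard_pair hηm.ne_one.symm]
      exact hcard.trans hcount
    have hg' : g ∈ ({1, η} : Set O3) := by rw [heq]; exact hg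
    rcases hg' with rfl | rfl
    · exact one_mem _
    · exact Subgroup.subset_closure rfl
  rw [hG]
  exact conjugate_groupC_two hηm

end Tiling
end SphereTiling

/-- The symmetry groups, as subgroups of `O(3)` up to conjugation, of the tilings of the sphere by
`f` congruent quadrilaterals with exactly two equal edges. The vector `![a, b, c, d]` stands for the
vertex `α^a β^b γ^c δ^d`. -/
theorem mainTheorem10 (f : ℕ) (T : SphereTiling.Tiling f) :
    -- earth map tilings
    (T.avc = {![0, 1, 1, 1], ![f / 2, 0, 0, 0]} →
      2 ∣ f ∧ SphereTiling.Conjugate T.symmetryGroup (SphereTiling.groupD (f / 2))) ∧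
    -- quadrilateral subdivision of the cube
    (T.avc = {![3, 0, 0, 0], ![0, 2, 0, 2], ![0, 0, 4, 0]} →
      SphereTiling.Conjugate T.symmetryGroup SphereTiling.groupTh) ∧
    -- quadrilateral subdivision of the triangular prism
    (T.avc = {![3, 0, 0, 0], ![1, 2, 0, 0], ![2, 0, 0, 2], ![0, 2, 0, 2], ![0, 0, 4, 0]} →
      SphereTiling.Conjugate T.symmetryGroup (SphereTiling.groupD 3)) ∧
    -- `(f / 4, 4)`-earth map tilings
    (4 ∣ f → T.avc = {![1, 2, 0, 0], ![2, 0, 0, 2], ![0, 0, 4, 0], ![0, 0, 0, f / 4]} →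
      8 ∣ f ∧ SphereTiling.Conjugate T.symmetryGroup (SphereTiling.groupDv (f / 8))) ∧
    -- the family with `β^2 δ^((f - 8) / 8)`
    (8 ∣ f → T.avc = {![1, 2, 0, 0], ![2, 0, 0, 2], ![0, 0, 4, 0], ![0, 2, 0, (f - 8) / 8],
        ![1, 0, 0, (f + 8) / 8]} →
      SphereTiling.Conjugate T.symmetryGroup (SphereTiling.groupC 2)) ∧
    -- the family with `α δ^((f + 8) / 8)` only
    (8 ∣ f → T.avc = {![1, 2, 0, 0], ![0, 0, 4, 0], ![2, 0, 0, 2], ![1, 0, 0, (f + 8) / 8]} →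
      SphereTiling.Conjugate T.symmetryGroup (SphereTiling.groupD 2)) := by
  exact ⟨fun h => SphereTiling.Tiling.two_dvd_and_conjugate_groupD h,
    fun h => SphereTiling.Tiling.conjugate_groupTh_of_avc h,
    fun h => SphereTiling.Tiling.conjugate_groupD_three h,
    fun hf h => SphereTiling.Tiling.eight_dvd_and_conjugate_groupDv hf h,
    fun hf h => SphereTiling.Tiling.conjugate_groupC_two_of_avc hf h,
    fun hf h => SphereTiling.Tiling.conjugate_groupD_two_of_avc hf h⟩
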